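/- **Definitions.** For a nonzero finite Borel measure $\xi$ on $\mathbb R$ let $$\Lambda_{Poi}(\xi)=\inf_f\frac{\int f'^2\,d\xi}{\int f^2\,d\xi},\qquad \Lambda_{LS}(\xi)=\inf_f\frac{2\int f'^2\,d\xi}{\int f^2\log(f^2)\,d\xi},$$ where the first infimum is over $f\in C_c^\infty(\mathbb R)$ with $\int f\,d\xi=0$ and $\int f^2d\xi>0$, and the second over $f\in C^\infty(\mathbb R)$ with $f^2=1+g$, $g\in C_c^\infty(\mathbb R)$, $\int g\,d\xi=0$, and $\int f^2\log (f^2)\,d\xi>0$. For a probability measure $\xi=J\,dx$ let $$\mathfrak h_{Che}(\xi)=\inf\Big\{\frac{\sum_{x\in\partial A}J(x)}{\xi(A)}:\ A\subset\mathbb R\text{ open with smooth boundary},\ 0<\xi(A)\le\tfrac12\Big\}.$$ For $K\in\mathbb R$ and $D\in(0,\infty]$, with $K>0$ if $D=\infty$, let $\xi_K$ be the probability measure on $\mathbb R$ with density $c_K^{-1}e^{-Kx^2/2}1_{[-D/2,D/2]}(x)$, $c_K=\int_{-D/2}^{D/2}e^{-Ky^2/2}dy$. For $K\in\mathbb R$,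 $D\in(0,\infty]$ let $\mathcal F_{[K,\infty,D]}$ be the class of finite measures $\xi=J\,dx$ on $\mathbb R$ whose support is an interval of length at most $D$, with $J$ smooth and strictly positive and $-(\log J)''\ge K$ on the interior of the support (the one-dimensional condition $CDD_b(K,\infty,D)$), and let $$\lambda_{K,\infty,D}=\inf_{0\ne\xi\in\mathcal F_{[K,\infty,D]}}\Lambda_{Poi}(\xi),\qquad \rho_{K,\infty,D}=\inf_{0\ne\xi\in\mathcal F_{[K,\infty,D]}}\Lambda_{LS}(\xi)$$ be the worst Poincaré and log-Sobolev constants. Write $a\asymp b$ if $a\le Cb$ and $b\le Ca$ with a universal constant $C<\infty$ (independent of $K$ and $D$). **Theorem.** 1. If $K\ge0$ and $D\in(0,\infty]$ (with $K>0$ if $D=\infty$), then $$\Lambda_{LS}(\xi_K)\asymp\Lambda_{Poi}(\xi_K)\asymp\mathfrak h_{Che}(\xi_K)^2\asymp\max\Big(K,\frac1{D^2}\Big).$$ 2. If $K=-k<0$ and $D\in(0,\infty)$, then $$\Lambda_{Poi}(\xi_K)\asymp\Lambda_{LS}(\xi_K)\asymp\max\Big\{\sqrt k,\frac1D\Big\}\frac{kD}{e^{kD^2/8}-1},\qquad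 \mathfrak h_{Che}(\xi_K)\asymp\frac{kD}{e^{kD^2/8}-1}.$$ 3. For all $K\in\mathbb R$ and $D\in(0,\infty]$, $\lambda_{K,\infty,D}\asymp\rho_{K,\infty,D}$; moreover, $\lambda_{K,\infty,D}\asymp\Lambda_{Poi}(\xi_K)$ and $\rho_{K,\infty,D}\asymp\Lambda_{LS}(\xi_K)$ whenever $\xi_K$ is defined (that is, $D<\infty$ or $K>0$). -/

import Mathlib

open MeasureTheory Set
open scoped ENNReal NNReal ContDiff

namespace OneDimFunctionalInequalities

noncomputable section

/-- `a` and `b` agree up to the multiplicative constant `C` (in both directions). -/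
def EquivUpTo (C : ℝ≥0) (a b : ℝ≥0∞) : Prop :=
  a ≤ (C : ℝ≥0∞) * b ∧ b ≤ (C : ℝ≥0∞) * a

/-- Smooth compactly supported functions on the line with `ξ`-mean zero. -/
def PoiTest (ξ : Measure ℝ) : Set (ℝ → ℝ) :=
  {f | ContDiff ℝ ∞ f ∧ HasCompactSupport f ∧ ∫ x, f x ∂ξ = 0}

/-- Smooth functions `f` on the line with `f ^ 2 = 1 + g`, where `g` is smooth, compactly
supported and has `ξ`-mean zero. -/
def LSTest (ξ : Measure ℝ) : Set (ℝ → ℝ) :=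
  {f | ContDiff ℝ ∞ f ∧ ∃ g ∈ PoiTest ξ, ∀ x, f x ^ 2 = 1 + g x}

/-- The Poincaré constant of a finite measure `ξ` on the line: the infimum of
`∫ f'^2 dξ / ∫ f^2 dξ` over the mean zero test functions. Functions which vanish `ξ`-almost
everywhere put no constraint on the best constant and are left out. -/
def poincareConst (ξ : Measure ℝ) : ℝ≥0∞ :=
  ⨅ (f : ℝ → ℝ) (_ : f ∈ PoiTest ξ) (_ : 0 < ∫ x, f x ^ 2 ∂ξ),
    ENNReal.ofReal ((∫ x, deriv f x ^ 2 ∂ξ) / ∫ x, f x ^ 2 ∂ξ)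

/-- The log-Sobolev constant of a finite measure `ξ` on the line: the infimum of
`2 ∫ f'^2 dξ / ∫ f^2 log (f^2) dξ` over the normalized test functions. Functions of zero entropy
put no constraint on the best constant and are left out. -/
def logSobolevConst (ξ : Measure ℝ) : ℝ≥0∞ :=
  ⨅ (f : ℝ → ℝ) (_ : f ∈ LSTest ξ) (_ : 0 < ∫ x, f x ^ 2 * Real.log (f x ^ 2) ∂ξ),
    ENNReal.ofReal ((2 * ∫ x, deriv f x ^ 2 ∂ξ) / ∫ x, f x ^ 2 * Real.log (f x ^ 2) ∂ξ)

/-- Open subsets of the line with smooth boundary: near each of its boundary points the set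
is a one-sided interval. -/
def IsSmoothOpen (A : Set ℝ) : Prop :=
  IsOpen A ∧ ∀ x ∈ frontier A, ∃ r > 0,
    A ∩ Ioo (x - r) (x + r) = Ioo (x - r) x ∨ A ∩ Ioo (x - r) (x + r) = Ioo x (x + r)

/-- The surface measure of `A` for the measure with density `J`: the integral of `J` over the
boundary of `A` against the zero-dimensional Hausdorff (that is, counting) measure. -/
def surfaceMeasure (J : ℝ → ℝ≥0∞) (A : Set ℝ) : ℝ≥0∞ :=
  ∑' x : frontier A, J x

/-- The Cheeger constant of the probability measure with Lebesgue density `J`. -/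
def cheegerConst (J : ℝ → ℝ≥0∞) : ℝ≥0∞ :=
  ⨅ (A : Set ℝ) (_ : IsSmoothOpen A) (_ : 0 < volume.withDensity J A)
    (_ : volume.withDensity J A ≤ 1 / 2), surfaceMeasure J A / volume.withDensity J A

/-- The interval `[-D/2, D/2]`; this is the whole line when `D = ∞`. -/
def symInterval (D : ℝ≥0∞) : Set ℝ :=
  {x | ENNReal.ofReal |x| ≤ D / 2}

/-- The density of `ξ_K`: the function `exp (-K x^2 / 2)` on `[-D/2, D/2]`, normalized to total
mass one. -/
def xiDensity (K : ℝ) (D : ℝ≥0∞) (x : ℝ) : ℝ≥0∞ :=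
  (symInterval D).indicator
    (fun x => ENNReal.ofReal
      (Real.exp (-K * x ^ 2 / 2) / ∫ y in symInterval D, Real.exp (-K * y ^ 2 / 2))) x

/-- The probability measure `ξ_K` on `[-D/2, D/2]`. -/
def xi (K : ℝ) (D : ℝ≥0∞) : Measure ℝ :=
  volume.withDensity (xiDensity K D)

/-- The class of measures on the line that satisfy the curvature-dimension-diameter condition
`CDD_b(K, ∞, D)`: finite measures, supported on an interval of length at most `D`, with a
density `J` which on the interior of that interval is smooth, positive and satisfies
`-(log J)'' ≥ K`. -/
structure IsCDD (K : ℝ) (D : ℝ≥0∞) (ξ : Measure ℝ) : Prop where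
  finite : IsFiniteMeasure ξ
  interval : ξ.support.OrdConnected
  diam_le : Metric.ediam ξ.support ≤ D
  density : ∃ J : ℝ → ℝ, Measurable J ∧
    ξ = volume.withDensity (fun x => ENNReal.ofReal (J x)) ∧
    ContDiffOn ℝ ∞ J (interior ξ.support) ∧
    ∀ x ∈ interior ξ.support,
      0 < J x ∧ K ≤ -deriv (deriv fun y => Real.log (J y)) x

/-- The worst Poincaré constant under `CDD_b(K, ∞, D)`. -/
def worstPoincare (K : ℝ) (D : ℝ≥0∞) : ℝ≥0∞ :=
  ⨅ (ξ : Measure ℝ) (_ : IsCDD K D ξ) (_ : ξ ≠ 0), poincareConst ξ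

/-- The worst log-Sobolev constant under `CDD_b(K, ∞, D)`. -/
def worstLogSobolev (K : ℝ) (D : ℝ≥0∞) : ℝ≥0∞ :=
  ⨅ (ξ : Measure ℝ) (_ : IsCDD K D ξ) (_ : ξ ≠ 0), logSobolevConst ξ

end

end OneDimFunctionalInequalities

/-!
The constants of the theorem are all compared with one explicit rate, `modelRate K D`. Since
`xi K D` belongs to the class defining the worst constants, and since a logarithmic Sobolev
inequality linearizes to a Poincaré inequality (`logSobolevConst_le_mul_poincareConst`), each of
the four constants lies, up to a factor `5`, between `worstLogSobolev K D` and
`poincareConst (xi K D)`. Hence two one-sided estimates suffice: a lower bound on the log-Sobolev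
constant of every measure of the class (`exists_modelRate_le_logSobolevConst`), and an upper bound
on the Poincaré constant of `xi K D` (`exists_poincareConst_xi_le_modelRate`).

The lower bound is a Hardy-type argument. On a compact interval, the entropy of `f ^ 2` is at most
the integral of `entropyGap s (f ^ 2)` for any level `s`; with `s` the larger of the value of
`f ^ 2` at the median `m` and a multiple `σ` of the energy, each half-interval is treated
separately. For `v x` the mass of the tail beyond `x`, a supersolution `w ≥ v (2 - log v)` of a
Riccati inequality makes `A * ∫ t in m..x, f' ^ 2 J - w * (f - f m) ^ 2` nondecreasing in `x`, with
a derivative that controls `(1 - log v) J (f - f m) ^ 2`; this bounds `f` pointwise, and then the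
entropy (`integral_entropyGap_le_of_riccati`). The supersolution comes from comparing `v` with `J`.
For `K > 0` the Gaussian isoperimetric estimate `v √(1 - log v) ≤ C J / √K`
(`sq_tail_mul_log_le`) allows `w = 2 v (2 - log v)`. For `K = -k < 0` the bound
`v (2 - log v) ≤ J * tailWeight k L` (`tail_mul_log_le`), with a weight that does not depend on the
measure, allows `w = v (2 - log v) (1 + ψ)`, where `ψ` is a normalized primitive of the weight. In
both cases the slope of `log J` at `x` decides whether the mass on the left of `x`, which is at
least `1 / 2`, or the one on the right yields the estimate. The integral of the weight has the
order of the inverse of the rate (`entropyConst_mul_negRate_le`). General measures of the class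
are exhausted by compact intervals (`IsCDD.integral_mul_log_le`), and for `K ≥ 0` the part
`1 / D ^ 2` of the rate follows from the weaker curvature bound `-1 / D ^ 2`.

The upper bound is obtained from a smooth odd step function (`oddStep`) which, for `K < 0`,
varies only near the origin, where the density is smallest. The Cheeger constant is
comparable to the density at the origin (`cheegerConst_xi_bounds`): the half-line bounds it from
above, and the boundary points of a set closest to the origin bound it from below.

When `D = ∞` and `K ≤ 0` both worst constants vanish, because the class contains the uniform
measures on arbitrarily long intervals (`worstPoincare_top_eq_zero`).
-/

namespace OneDimFunctionalInequalities

/-! ### Entropy on a half-interval from a Riccati supersolution -/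

/-- The integrand `y log (y / s) - y + s` of the variational formula for the entropy: the entropy
of `y` is the infimum over `s > 0` of its integral. -/
noncomputable def entropyGap (s y : ℝ) : ℝ := y * Real.log (y / s) - y + s

theorem entropyGap_le_sq {s y : ℝ} (hs : 0 < s) (hy : 0 ≤ y) :
    entropyGap s y ≤ (y - s) ^ 2 / s := by
  unfold entropyGap
  rcases hy.eq_or_lt with rfl | hy
  · simp [pow_two, hs.ne']
  · have h := Real.log_le_sub_one_of_pos (div_pos hy hs)
    have h2 : y * Real.log (y / s) ≤ y * (y / s - 1) := by gcongr
    have h3 : y * (y / s - 1) - y + s = (y - s) ^ 2 / s := by field_simp; ring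
    linarith

/-- Pointwise bound for the entropy integrand of `(c + g) ^ 2`, with the reference level
`s = max (c ^ 2) σ`: it is quadratic in `g` up to the logarithmic factor `h`, which has to
dominate `1 + log (g ^ 2 / σ)`. -/
theorem entropyGap_add_sq_le {c g σ h : ℝ} (hσ : 0 < σ) (hh : 1 ≤ h)
    (hg : g ^ 2 ≤ σ * Real.exp (h - 1)) :
    entropyGap (max (c ^ 2) σ) ((c + g) ^ 2) ≤ 9 * (g ^ 2 * h + σ) := by
  set s := max (c ^ 2) σ with hs_def
  have hs : 0 < s := lt_max_of_lt_right hσ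
  have hcs : c ^ 2 ≤ s := le_max_left _ _
  have hσs : σ ≤ s := le_max_right _ _
  have hg0 : g ^ 2 ≤ g ^ 2 * h := le_mul_of_one_le_right (sq_nonneg g) hh
  rcases le_or_gt (g ^ 2) s with hgs | hgs
  · refine (entropyGap_le_sq hs (sq_nonneg _)).trans ?_
    rw [div_le_iff₀ hs]
    rcases le_total σ (c ^ 2) with h1 | h1
    · have hsc : s = c ^ 2 := max_eq_left h1
      have h2 : ((c + g) ^ 2 - s) ^ 2 = g ^ 2 * (2 * c + g) ^ 2 := by rw [hsc]; ring
      have h3 : (2 * c + g) ^ 2 ≤ 9 * s := by nlinarith [sq_nonneg (c - g)]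
      rw [h2]
      calc g ^ 2 * (2 * c + g) ^ 2 ≤ g ^ 2 * (9 * s) := by gcongr
        _ ≤ 9 * (g ^ 2 * h + σ) * s := by nlinarith
    · have hsc : s = σ := max_eq_right h1
      have h2 : (c + g) ^ 2 ≤ 4 * s := by nlinarith [sq_nonneg (c - g)]
      have h3 : ((c + g) ^ 2 - s) ^ 2 ≤ 9 * s * s := by
        nlinarith [sq_nonneg (c + g)]
      have : 0 ≤ g ^ 2 * h * s := by positivity
      nlinarith
  · have hX : (c + g) ^ 2 ≤ 4 * g ^ 2 := by nlinarith [sq_nonneg (c - g)]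
    unfold entropyGap
    set X := (c + g) ^ 2 with hXdef
    have hX0 : 0 ≤ X := sq_nonneg _
    rcases le_or_gt X s with hXs | hXs
    · have : Real.log (X / s) ≤ 0 :=
        Real.log_nonpos (by positivity) ((div_le_one hs).2 hXs)
      nlinarith
    · have hl : Real.log (X / s) ≤ 1 + h := by
        have h4 : Real.log 4 ≤ 2 := by
          have : (4 : ℝ) = 2 * 2 := by norm_num
          rw [this, Real.log_mul (by norm_num) (by norm_num)]
          have := Real.log_two_lt_d9
          linarith
        have hXs' : X / s ≤ 4 * Real.exp (h - 1) := by
          rw [div_le_iff₀ hs]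
          nlinarith [Real.exp_pos (h - 1)]
        calc Real.log (X / s) ≤ Real.log (4 * Real.exp (h - 1)) :=
              Real.log_le_log (div_pos (hs.trans hXs) hs) hXs'
          _ = Real.log 4 + (h - 1) := by
              rw [Real.log_mul (by norm_num) (Real.exp_pos _).ne', Real.log_exp]
          _ ≤ 1 + h := by linarith
      have : X * Real.log (X / s) ≤ 4 * g ^ 2 * (2 * h) := by
        apply mul_le_mul hX (by linarith) (Real.log_nonneg ((one_le_div hs).2 hXs.le))
        positivity
      nlinarith

theorem continuous_entropyGap (s : ℝ) (hs : 0 < s) : Continuous (entropyGap s) := by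
  have : entropyGap s = fun y => s * ((y / s) * Real.log (y / s)) - y + s := by
    funext y; unfold entropyGap; field_simp
  rw [this]
  have := Real.continuous_mul_log.comp (continuous_id.div_const s)
  exact ((continuous_const.mul this).sub continuous_id).add continuous_const

theorem mul_two_sub_log_nonneg {v : ℝ} (h0 : 0 ≤ v) (h1 : v ≤ 1) : 0 ≤ v * (2 - Real.log v) :=
  mul_nonneg h0 (by linarith [Real.log_nonpos h0 h1])

theorem neg_mul_log_le {v : ℝ} (h0 : 0 ≤ v) : -(v * Real.log v) ≤ 1 - v := by
  rcases h0.eq_or_lt with rfl | h0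
  · simp
  · have := Real.one_sub_inv_le_log_of_pos h0
    have h2 : v * (1 - v⁻¹) ≤ v * Real.log v := by gcongr
    have : v * (1 - v⁻¹) = v - 1 := by field_simp
    linarith

theorem hasDerivAt_tail {J : ℝ → ℝ} (hJ : Continuous J) (b x : ℝ) :
    HasDerivAt (fun x => ∫ t in x..b, J t) (-J x) x :=
  intervalIntegral.integral_hasDerivAt_left (hJ.intervalIntegrable _ _)
    hJ.stronglyMeasurable.stronglyMeasurableAtFilter hJ.continuousAt

theorem tail_pos {J : ℝ → ℝ} (hJ : Continuous J) (hpos : ∀ x, 0 < J x) {x b : ℝ} (h : x < b) :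
    0 < ∫ t in x..b, J t :=
  intervalIntegral.intervalIntegral_pos_of_pos (hJ.intervalIntegrable _ _) hpos h

/-- The entropy on a half-interval `[m, b]` is controlled by the energy as soon as a
supersolution `w` of the Riccati equation is given which dominates `v (2 - log v)`, for
`v x = ∫ t in x..b, J t`: along `x` the quantity `A * ∫ t in m..x, f' ^ 2 * J - w g ^ 2`, with
`g = f - f m`, increases at least at the rate `(1 - log v) J g ^ 2`. -/
theorem integral_entropyGap_le_of_riccati {J f w w' : ℝ → ℝ} {m b A σ : ℝ} (hmb : m < b)
    (hJ : Continuous J) (hpos : ∀ x, 0 < J x) (hmass : ∫ t in m..b, J t ≤ 1) (hA : 0 < A)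
    (hw : ∀ x ∈ Ico m b, HasDerivAt w (w' x) x)
    (hH : ∀ x ∈ Ico m b, (∫ t in x..b, J t) * (2 - Real.log (∫ t in x..b, J t)) ≤ w x)
    (hric : ∀ x ∈ Ico m b,
      w' x + (1 - Real.log (∫ t in x..b, J t)) * J x + w x ^ 2 / (A * J x) ≤ 0)
    (hf : ContDiff ℝ 1 f) (hσ : 0 < σ) (hE : A * ∫ t in m..b, deriv f t ^ 2 * J t ≤ σ) :
    ∫ t in m..b, entropyGap (max (f m ^ 2) σ) (f t ^ 2) * J t ≤ 18 * σ := by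
  set v : ℝ → ℝ := fun x => ∫ t in x..b, J t with hv
  have hdf : Continuous (deriv f) := hf.continuous_deriv le_rfl
  have hfd : ∀ x, HasDerivAt f (deriv f x) x := fun x =>
    (hf.differentiable one_ne_zero x).hasDerivAt
  have hcE : Continuous fun t => deriv f t ^ 2 * J t := (hdf.pow 2).mul hJ
  have hE0 : ∀ t, 0 ≤ deriv f t ^ 2 * J t := fun t => mul_nonneg (sq_nonneg _) (hpos t).le
  have hs : 0 < max (f m ^ 2) σ := lt_max_of_lt_right hσ
  have hcP : Continuous fun t => entropyGap (max (f m ^ 2) σ) (f t ^ 2) * J t :=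
    ((continuous_entropyGap _ hs).comp (hf.continuous.pow 2)).mul hJ
  have hprim : ∀ {F : ℝ → ℝ}, Continuous F → ∀ x,
      HasDerivAt (fun x => ∫ t in m..x, F t) (F x) x := fun hF x =>
    intervalIntegral.integral_hasDerivAt_right (hF.intervalIntegrable _ _)
      hF.stronglyMeasurable.stronglyMeasurableAtFilter hF.continuousAt
  have hv0 : ∀ x ∈ Ico m b, 0 < v x := fun x hx => tail_pos hJ hpos hx.2
  have hv1 : ∀ x ∈ Ico m b, v x ≤ 1 := fun x hx => by
    have := intervalIntegral.integral_add_adjacent_intervals (hJ.intervalIntegrable m x)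
      (hJ.intervalIntegrable (μ := volume) x b)
    have h2 : 0 ≤ ∫ t in m..x, J t :=
      intervalIntegral.integral_nonneg hx.1 fun t _ => (hpos t).le
    simp only [hv]; linarith
  have hlog : ∀ x ∈ Ico m b, Real.log (v x) ≤ 0 := fun x hx =>
    Real.log_nonpos (hv0 x hx).le (hv1 x hx)
  have hwnn : ∀ x ∈ Ico m b, v x ≤ w x := fun x hx => by
    refine le_trans ?_ (hH x hx)
    have := hv0 x hx
    have := hlog x hx
    simp only [hv] at *
    nlinarith
  have hgder : ∀ x ∈ Ico m b, HasDerivAt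
      (fun x => A * (∫ t in m..x, deriv f t ^ 2 * J t) - w x * (f x - f m) ^ 2)
      (A * (deriv f x ^ 2 * J x) - (w' x * (f x - f m) ^ 2 +
        w x * (2 * (f x - f m) * deriv f x))) x := fun x hx => by
    have h1 := ((hprim hcE x).const_mul A).sub
      ((hw x hx).mul (((hfd x).sub_const (f m)).pow 2))
    exact h1.congr_deriv (by simp)
  -- completing the square in `f'`
  have hrate : ∀ x ∈ Ico m b, (1 - Real.log (v x)) * J x * (f x - f m) ^ 2 ≤
      A * (deriv f x ^ 2 * J x) - (w' x * (f x - f m) ^ 2 +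
        w x * (2 * (f x - f m) * deriv f x)) := fun x hx => by
    have hJx := hpos x
    have h1 := mul_nonneg (neg_nonneg.2 (hric x hx)) (sq_nonneg (f x - f m))
    have h2 : 0 ≤ (A * J x * deriv f x - w x * (f x - f m)) ^ 2 / (A * J x) := by positivity
    have h3 : (A * J x * deriv f x - w x * (f x - f m)) ^ 2 / (A * J x) =
        A * (deriv f x ^ 2 * J x) - w x * (2 * (f x - f m) * deriv f x) +
          w x ^ 2 / (A * J x) * (f x - f m) ^ 2 := by
      field_simp; ring
    simp only [hv] at *
    nlinarith
  -- the quantity vanishes at `m` and is nondecreasing, which bounds `f` in terms of the energy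
  have hmono : ∀ x ∈ Ico m b, w x * (f x - f m) ^ 2 ≤
      A * ∫ t in m..x, deriv f t ^ 2 * J t := fun x hx => by
    have hsub : Icc m x ⊆ Ico m b := fun y hy => ⟨hy.1, hy.2.trans_lt hx.2⟩
    have := monotoneOn_of_deriv_nonneg (convex_Icc m x)
      (fun y hy => (hgder y (hsub hy)).continuousAt.continuousWithinAt)
      (fun y hy => (hgder y (hsub (interior_subset hy))).differentiableAt.differentiableWithinAt)
      (fun y hy => by
        have hy' := hsub (interior_subset hy)
        rw [(hgder y hy').deriv]
        refine le_trans ?_ (hrate y hy')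
        have := hlog y hy'
        have := (hpos y).le
        exact mul_nonneg (mul_nonneg (by linarith) this) (sq_nonneg _))
      (left_mem_Icc.2 hx.1) (right_mem_Icc.2 hx.1) hx.1
    simp only [intervalIntegral.integral_same, sub_self] at this
    nlinarith
  have hEx : ∀ x ∈ Ico m b, A * ∫ t in m..x, deriv f t ^ 2 * J t ≤ σ := fun x hx => by
    refine le_trans ?_ hE
    have := intervalIntegral.integral_add_adjacent_intervals (hcE.intervalIntegrable m x)
      (hcE.intervalIntegrable (μ := volume) x b)
    have h2 : 0 ≤ ∫ t in x..b, deriv f t ^ 2 * J t :=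
      intervalIntegral.integral_nonneg hx.2.le fun t _ => hE0 t
    gcongr
    linarith
  -- that bound and `v ≤ w` are what the pointwise estimate requires, with `h = 1 - log v`
  have hpt : ∀ x ∈ Ico m b, entropyGap (max (f m ^ 2) σ) (f x ^ 2) ≤
      9 * ((f x - f m) ^ 2 * (1 - Real.log (v x)) + σ) := fun x hx => by
    have h := entropyGap_add_sq_le (c := f m) (g := f x - f m) (h := 1 - Real.log (v x)) hσ
      (by linarith [hlog x hx]) (by
        have e1 : Real.exp (1 - Real.log (v x) - 1) = (v x)⁻¹ := by
          rw [show 1 - Real.log (v x) - 1 = -Real.log (v x) by ring, Real.exp_neg,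
            Real.exp_log (hv0 x hx)]
        rw [e1, ← div_eq_mul_inv, le_div_iff₀ (hv0 x hx)]
        have := hmono x hx
        have := hEx x hx
        have := mul_le_mul_of_nonneg_right (hwnn x hx) (sq_nonneg (f x - f m))
        linarith)
    simpa using h
  have hder2 : ∀ x ∈ Ico m b, HasDerivAt
      (fun x => 9 * (A * (∫ t in m..x, deriv f t ^ 2 * J t) - w x * (f x - f m) ^ 2) +
        9 * σ * (∫ t in m..x, J t) -
        ∫ t in m..x, entropyGap (max (f m ^ 2) σ) (f t ^ 2) * J t) _ x := fun x hx =>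
    (((hgder x hx).const_mul 9).add ((hprim hJ x).const_mul (9 * σ))).sub (hprim hcP x)
  have hmain : ∀ x ∈ Ico m b,
      ∫ t in m..x, entropyGap (max (f m ^ 2) σ) (f t ^ 2) * J t ≤ 18 * σ := fun x hx => by
    have hsub : Icc m x ⊆ Ico m b := fun y hy => ⟨hy.1, hy.2.trans_lt hx.2⟩
    have := monotoneOn_of_deriv_nonneg (convex_Icc m x)
      (fun y hy => (hder2 y (hsub hy)).continuousAt.continuousWithinAt)
      (fun y hy => (hder2 y (hsub (interior_subset hy))).differentiableAt.differentiableWithinAt)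
      (fun y hy => by
        have hy' := hsub (interior_subset hy)
        rw [(hder2 y hy').deriv]
        have h1 := hrate y hy'
        have h2 := mul_le_mul_of_nonneg_right (hpt y hy') (hpos y).le
        nlinarith)
      (left_mem_Icc.2 hx.1) (right_mem_Icc.2 hx.1) hx.1
    simp only [intervalIntegral.integral_same, sub_self] at this
    have h1 := hEx x hx
    have h2 : 0 ≤ w x * (f x - f m) ^ 2 :=
      mul_nonneg ((hv0 x hx).le.trans (hwnn x hx)) (sq_nonneg _)
    have h3 : ∫ t in m..x, J t ≤ 1 := by
      have := intervalIntegral.integral_add_adjacent_intervals (hJ.intervalIntegrable m x)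
        (hJ.intervalIntegrable (μ := volume) x b)
      have := hv0 x hx
      simp only [hv] at *
      linarith
    nlinarith
  -- `w` need not extend to `b`, where `v` vanishes
  have hcont : Filter.Tendsto
      (fun x => ∫ t in m..x, entropyGap (max (f m ^ 2) σ) (f t ^ 2) * J t)
      (nhdsWithin b (Iio b)) (nhds (∫ t in m..b, entropyGap (max (f m ^ 2) σ) (f t ^ 2) * J t)) :=
    (hprim hcP b).continuousAt.tendsto.mono_left nhdsWithin_le_nhds
  refine le_of_tendsto hcont ?_
  filter_upwards [Ico_mem_nhdsLT hmb] with x hx using hmain x hx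

/-! ### Tail estimates beyond the median -/

theorem intervalIntegral_exp_neg_sq_le {K : ℝ} (hK : 0 < K) (c : ℝ) {p q : ℝ} (hpq : p ≤ q) :
    ∫ x in p..q, Real.exp (-(K / 2) * (x - c) ^ 2) ≤ Real.sqrt (2 * Real.pi / K) := by
  have hint : Integrable fun x : ℝ => Real.exp (-(K / 2) * (x - c) ^ 2) :=
    (integrable_exp_neg_mul_sq (half_pos hK)).comp_sub_right c
  rw [intervalIntegral.integral_of_le hpq]
  calc ∫ x in Ioc p q, Real.exp (-(K / 2) * (x - c) ^ 2)
      ≤ ∫ x, Real.exp (-(K / 2) * (x - c) ^ 2) :=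
        setIntegral_le_integral hint (Filter.Eventually.of_forall fun x => (Real.exp_pos _).le)
    _ = ∫ x, Real.exp (-(K / 2) * x ^ 2) :=
        integral_sub_right_eq_self (fun x => Real.exp (-(K / 2) * x ^ 2)) c
    _ = Real.sqrt (2 * Real.pi / K) := by
        rw [integral_gaussian]; congr 1; field_simp

theorem intervalIntegral_mul_exp_neg_le_one (s : ℝ) (y b : ℝ) :
    ∫ x in y..b, s * Real.exp (-s * (x - y)) ≤ 1 := by
  have h : ∀ x ∈ uIcc y b, HasDerivAt (fun x => -Real.exp (-s * (x - y)))
      (s * Real.exp (-s * (x - y))) x := fun x _ => by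
    have h1 : HasDerivAt (fun x : ℝ => -s * (x - y)) (-s * 1) x :=
      ((hasDerivAt_id x).sub_const y).const_mul (-s)
    exact h1.exp.neg.congr_deriv (by ring)
  rw [intervalIntegral.integral_eq_sub_of_hasDerivAt h
    (Continuous.intervalIntegrable (by fun_prop) _ _)]
  simp [(Real.exp_pos _).le]

theorem sqrt_mul_two_sub_log_le {v : ℝ} (h0 : 0 ≤ v) :
    Real.sqrt v * (2 - Real.log v) ≤ 2 := by
  have h := neg_mul_log_le (Real.sqrt_nonneg v)
  rw [Real.log_sqrt h0] at h
  nlinarith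

/-- Under a positive curvature bound `K` the tail mass `v` at a point beyond the median satisfies
`v √(1 - log v) ≤ C J / √K`, the isoperimetric profile of the Gaussian measure: let `s` be
minus the logarithmic slope of `J` at `y`. If `s ≤ 0`, then the mass to the left of `y` bounds
`J y` from below. If `s > 0`, then `v ≤ J / s` and `v ≤ C J / √K`, while the mass to the left of
`y` shows that `s` is at least of the order of `√(K log (1 / v))` unless `√v ≤ C J / √K`. -/
theorem sq_tail_mul_log_le {J : ℝ → ℝ} {a y b K s : ℝ} (hay : a ≤ y) (hyb : y < b)
    (hJ : Continuous J) (hpos : ∀ x, 0 < J x) (hK : 0 < K)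
    (htan : ∀ x ∈ Icc a b, J x ≤ J y * Real.exp (-s * (x - y) - K * (x - y) ^ 2 / 2))
    (hleft : 1 / 2 ≤ ∫ t in a..y, J t) (hright : ∫ t in y..b, J t ≤ 1) :
    (∫ t in y..b, J t) ^ 2 * (1 - Real.log (∫ t in y..b, J t)) ≤
      4 * (2 * Real.pi / K) * J y ^ 2 := by
  have hv : 0 < ∫ t in y..b, J t := tail_pos hJ hpos hyb
  set v := ∫ t in y..b, J t with hvdef
  have hJy := hpos y
  set Γ := Real.sqrt (2 * Real.pi / K) with hΓ
  have hΓ0 : 0 < Γ := Real.sqrt_pos.2 (by positivity)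
  have hΓ2 : Γ ^ 2 = 2 * Real.pi / K := Real.sq_sqrt (by positivity)
  have hΓK : 1 / K ≤ Γ ^ 2 := by
    rw [hΓ2]; gcongr; linarith [Real.pi_gt_three]
  rw [← hΓ2]
  have hmulog := neg_mul_log_le hv.le
  -- for `s ≤ 0` the density decreases to the left of `y` faster than a Gaussian centred at `y`, so
  -- that the mass `1 / 2` on that side bounds `J y` from below
  rcases le_or_gt s 0 with hs | hs
  · have h1 : 1 / 2 ≤ J y * Γ := by
      refine hleft.trans ?_
      calc ∫ t in a..y, J t ≤ ∫ t in a..y, J y * Real.exp (-(K / 2) * (t - y) ^ 2) := by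
            refine intervalIntegral.integral_mono_on hay (hJ.intervalIntegrable _ _)
              (Continuous.intervalIntegrable (by fun_prop) _ _) fun x hx => ?_
            refine (htan x ⟨hx.1, hx.2.trans hyb.le⟩).trans ?_
            gcongr
            nlinarith [mul_nonneg_of_nonpos_of_nonpos hs (sub_nonpos.2 hx.2)]
        _ ≤ J y * Γ := by
            rw [intervalIntegral.integral_const_mul]
            gcongr
            exact intervalIntegral_exp_neg_sq_le hK y hay
    have h2 : v ^ 2 * (1 - Real.log v) ≤ 1 := by nlinarith
    nlinarith
  · have h1 : v ≤ J y * Γ := by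
      calc v ≤ ∫ t in y..b, J y * Real.exp (-(K / 2) * (t - y) ^ 2) := by
            refine intervalIntegral.integral_mono_on hyb.le (hJ.intervalIntegrable _ _)
              (Continuous.intervalIntegrable (by fun_prop) _ _) fun x hx => ?_
            refine (htan x ⟨hay.trans hx.1, hx.2⟩).trans ?_
            gcongr
            nlinarith [mul_nonneg hs.le (sub_nonneg.2 hx.1)]
        _ ≤ J y * Γ := by
            rw [intervalIntegral.integral_const_mul]
            gcongr
            exact intervalIntegral_exp_neg_sq_le hK y hyb.le
    have h2 : s * v ≤ J y := by
      calc s * v = ∫ t in y..b, s * J t := by rw [intervalIntegral.integral_const_mul]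
        _ ≤ ∫ t in y..b, J y * (s * Real.exp (-s * (t - y))) := by
            refine intervalIntegral.integral_mono_on hyb.le
              ((hJ.const_mul s).intervalIntegrable _ _)
              (Continuous.intervalIntegrable (by fun_prop) _ _) fun x hx => ?_
            have : J x ≤ J y * Real.exp (-s * (x - y)) := by
              refine (htan x ⟨hay.trans hx.1, hx.2⟩).trans ?_
              gcongr
              nlinarith [mul_nonneg hK.le (sq_nonneg (x - y))]
            nlinarith
        _ ≤ J y := by
            rw [intervalIntegral.integral_const_mul]
            have := intervalIntegral_mul_exp_neg_le_one s y b
            nlinarith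
    -- on the left, `J` lies below a Gaussian centred at `y - s / K`
    have h3 : 1 / 2 ≤ J y * Γ * Real.exp (s ^ 2 / (2 * K)) := by
      refine hleft.trans ?_
      calc ∫ t in a..y, J t ≤ ∫ t in a..y, J y * Real.exp (s ^ 2 / (2 * K)) *
              Real.exp (-(K / 2) * (t - (y - s / K)) ^ 2) := by
            refine intervalIntegral.integral_mono_on hay (hJ.intervalIntegrable _ _)
              (Continuous.intervalIntegrable (by fun_prop) _ _) fun x hx => ?_
            refine (htan x ⟨hx.1, hx.2.trans hyb.le⟩).trans (le_of_eq ?_)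
            rw [mul_assoc, ← Real.exp_add]
            congr 2
            field_simp
            ring
        _ ≤ J y * Real.exp (s ^ 2 / (2 * K)) * Γ := by
            rw [intervalIntegral.integral_const_mul]
            gcongr
            exact intervalIntegral_exp_neg_sq_le hK _ hay
        _ = _ := by ring
    have hsq := Real.sq_sqrt hv.le
    have hsv : 0 < Real.sqrt v := Real.sqrt_pos.2 hv
    rcases le_or_gt (Real.sqrt v) (J y * Γ) with h4 | h4
    · have h5 : v ^ 2 * (1 - Real.log v) ≤ v := by nlinarith
      have h6 : v ≤ (J y * Γ) ^ 2 := by rw [← hsq]; gcongr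
      nlinarith [sq_nonneg (J y * Γ)]
    · have h5 : 1 / 2 ≤ Real.sqrt v * Real.exp (s ^ 2 / (2 * K)) :=
        h3.trans (by gcongr)
      have h6 := Real.log_le_log (by norm_num) h5
      rw [Real.log_mul hsv.ne' (Real.exp_pos _).ne', Real.log_exp, Real.log_sqrt hv.le,
        one_div, Real.log_inv] at h6
      have h7 := Real.log_two_lt_d9
      have h8 : 1 - Real.log v ≤ 3 + s ^ 2 / K := by
        have : s ^ 2 / (2 * K) = s ^ 2 / K / 2 := by field_simp
        linarith
      have h9 : v ^ 2 ≤ (J y * Γ) ^ 2 := by gcongr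
      have h10 : (s * v) ^ 2 ≤ J y ^ 2 := by gcongr
      have h11 : (s * v) ^ 2 / K ≤ J y ^ 2 * Γ ^ 2 := by
        calc (s * v) ^ 2 / K ≤ J y ^ 2 / K := by gcongr
          _ = J y ^ 2 * (1 / K) := by ring
          _ ≤ _ := by gcongr
      calc v ^ 2 * (1 - Real.log v) ≤ v ^ 2 * (3 + s ^ 2 / K) := by gcongr
        _ = 3 * v ^ 2 + (s * v) ^ 2 / K := by ring
        _ ≤ 4 * Γ ^ 2 * J y ^ 2 := by nlinarith

/-- The weight which bounds `v (2 - log v) / J` under the curvature bound `-k` on `[-L, L]`. The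
second term is independent of `y`; its exponential carries the factor `3 / 4 < 1`, so that its
integral is dominated by that of the first term when `k L ^ 2` is large. -/
noncomputable def tailWeight (k L y : ℝ) : ℝ :=
  12 * (Real.exp (-(k * y ^ 2 / 2)) * ∫ x in (-L)..L, Real.exp (k * x ^ 2 / 2)) +
    4 * L * Real.exp (3 / 4 * (k * L ^ 2 / 2))

/-- Under a negative curvature bound `-k` on an interval contained in `[-L, L]`, the tail mass `v`
at a point `y` beyond the median satisfies `v (2 - log v) ≤ J y * tailWeight k L y`. The
parabola `k x ^ 2 / 2` is factored out of `log J`, so that the sign of the remaining slope decides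
which of the two sides of `y` is used. -/
theorem tail_mul_log_le {J : ℝ → ℝ} {a y b k s L : ℝ} (hay : a ≤ y) (hyb : y < b)
    (haL : -L ≤ a) (hbL : b ≤ L)
    (hJ : Continuous J) (hpos : ∀ x, 0 < J x) (hk : 0 < k)
    (htan : ∀ x ∈ Icc a b, J x ≤ J y * Real.exp (-s * (x - y) - (-k) * (x - y) ^ 2 / 2))
    (hleft : 1 / 2 ≤ ∫ t in a..y, J t) (hright : ∫ t in y..b, J t ≤ 1) :
    (∫ t in y..b, J t) * (2 - Real.log (∫ t in y..b, J t)) ≤ J y * tailWeight k L y := by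
  have hv : 0 < ∫ t in y..b, J t := tail_pos hJ hpos hyb
  have hL : 0 < L := by linarith
  unfold tailWeight
  set v := ∫ t in y..b, J t with hvdef
  have hJy := hpos y
  set Φ := ∫ x in (-L)..L, Real.exp (k * x ^ 2 / 2) with hΦ
  set E := Real.exp (-(k * y ^ 2 / 2)) with hE
  have hE0 : 0 < E := Real.exp_pos _
  set T := Real.exp (3 / 4 * (k * L ^ 2 / 2)) with hT
  have hT0 : 0 < T := Real.exp_pos _
  have hcexp : Continuous fun x : ℝ => Real.exp (k * x ^ 2 / 2) := by fun_prop
  have hΦ' : ∀ {p q : ℝ}, -L ≤ p → p ≤ q → q ≤ L →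
      ∫ x in p..q, Real.exp (k * x ^ 2 / 2) ≤ Φ := fun {p q} hp hpq hq =>
    intervalIntegral.integral_mono_interval hp hpq hq
      (Filter.Eventually.of_forall fun x => (Real.exp_pos _).le) (hcexp.intervalIntegrable _ _)
  have hΦ0 : 0 < Φ := tail_pos hcexp (fun x => Real.exp_pos _) (by linarith)
  set σ := s + k * y with hσ
  have htan' : ∀ x ∈ Icc a b,
      J x ≤ J y * (E * Real.exp (k * x ^ 2 / 2) * Real.exp (-σ * (x - y))) := fun x hx => by
    refine (htan x hx).trans (le_of_eq ?_)
    rw [hE, ← Real.exp_add, ← Real.exp_add]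
    congr 2
    ring
  have hside : ∀ {p q c : ℝ}, a ≤ p → p ≤ q → q ≤ b → (∀ x ∈ Icc p q, -σ * (x - y) ≤ c) →
      ∫ t in p..q, J t ≤ J y * (E * Φ) * Real.exp c := fun {p q c} hp hpq hq hc => by
    calc ∫ t in p..q, J t
        ≤ ∫ t in p..q, J y * E * Real.exp c * Real.exp (k * t ^ 2 / 2) := by
          refine intervalIntegral.integral_mono_on hpq (hJ.intervalIntegrable _ _)
              (Continuous.intervalIntegrable (by fun_prop) _ _) fun x hx => ?_
          refine (htan' x ⟨hp.trans hx.1, hx.2.trans hq⟩).trans ?_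
          have : Real.exp (-σ * (x - y)) ≤ Real.exp c := Real.exp_le_exp.2 (hc x hx)
          calc J y * (E * Real.exp (k * x ^ 2 / 2) * Real.exp (-σ * (x - y)))
              ≤ J y * (E * Real.exp (k * x ^ 2 / 2) * Real.exp c) := by gcongr
            _ = _ := by ring
      _ ≤ J y * E * Real.exp c * Φ := by
          rw [intervalIntegral.integral_const_mul]
          gcongr
          exact hΦ' (haL.trans hp) hpq (hq.trans hbL)
      _ = _ := by ring
  have hvlog := neg_mul_log_le hv.le
  have hJEΦ : 0 < J y * (E * Φ) := by positivity
  have hJLT : 0 < J y * (L * T) := by positivity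
  rcases le_or_gt σ 0 with hs | hs
  · have h1 : 1 / 2 ≤ J y * (E * Φ) := by
      refine hleft.trans ((hside (c := 0) le_rfl hay hyb.le fun x hx => ?_).trans (by simp))
      nlinarith [mul_nonneg_of_nonpos_of_nonpos hs (sub_nonpos.2 hx.2)]
    nlinarith
  · have h1 : v ≤ J y * (E * Φ) := by
      refine (hside (c := 0) hay hyb.le le_rfl fun x hx => ?_).trans (by simp)
      nlinarith [mul_nonneg hs.le (sub_nonneg.2 hx.1)]
    have h3 : 1 / 2 ≤ J y * (E * Φ) * Real.exp (2 * L * σ) := by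
      refine hleft.trans (hside le_rfl hay hyb.le fun x hx => ?_)
      have : y - x ≤ 2 * L := by linarith [hx.1]
      nlinarith
    -- the integrand is split at distance `L / 2` from `y`: beyond it the exponential beats the slope,
    -- and within it `x ^ 2 - y ^ 2` stays below `3 / 4 * L ^ 2`
    have h2 : 2 * L * σ * v ≤ J y * (4 * (E * Φ) + 2 * L * T) := by
      have hpt : ∀ x ∈ Icc y b, 2 * L * σ * J x ≤ J y * (4 * E * Real.exp (k * x ^ 2 / 2) +
          2 * L * T * (σ * Real.exp (-σ * (x - y)))) := fun x hx => by
        have hJx := htan' x ⟨hay.trans hx.1, hx.2⟩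
        have h5 : 2 * L * σ * J x ≤ 2 * L * σ *
            (J y * (E * Real.exp (k * x ^ 2 / 2) * Real.exp (-σ * (x - y)))) := by gcongr
        refine h5.trans ?_
        have hX : 0 < Real.exp (k * x ^ 2 / 2) := Real.exp_pos _
        have hY : 0 < Real.exp (-σ * (x - y)) := Real.exp_pos _
        rcases le_or_gt (L / 2) (x - y) with h6 | h6
        · have h7 : σ * (x - y) * Real.exp (-σ * (x - y)) ≤ 1 := by
            have := Real.add_one_le_exp (σ * (x - y))
            rw [neg_mul, Real.exp_neg, ← div_eq_mul_inv, div_le_one (Real.exp_pos _)]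
            linarith
          have h8 : 2 * L * σ * Real.exp (-σ * (x - y)) ≤ 4 := by
            have : σ * (L / 2) * Real.exp (-σ * (x - y)) ≤
                σ * (x - y) * Real.exp (-σ * (x - y)) := by gcongr
            linarith
          have h9 : 0 ≤ J y * (2 * L * T * (σ * Real.exp (-σ * (x - y)))) := by positivity
          have h10 : 0 < J y * E * Real.exp (k * x ^ 2 / 2) := by positivity
          have := mul_le_mul_of_nonneg_left h8 h10.le
          linarith
        · have h7 : E * Real.exp (k * x ^ 2 / 2) ≤ T := by
            rw [hE, hT, ← Real.exp_add, Real.exp_le_exp]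
            have hx2 : x ≤ L := hx.2.trans hbL
            have hd : 0 ≤ x - y := sub_nonneg.2 hx.1
            have : (x - y) * (x + y) ≤ 3 / 4 * L ^ 2 := by nlinarith
            nlinarith
          have h9 : 0 ≤ J y * (4 * E * Real.exp (k * x ^ 2 / 2)) := by positivity
          have h10 : 0 < J y * (2 * L * σ) * Real.exp (-σ * (x - y)) := by positivity
          have := mul_le_mul_of_nonneg_left h7 h10.le
          linarith
      calc 2 * L * σ * v = ∫ t in y..b, 2 * L * σ * J t := by
            rw [intervalIntegral.integral_const_mul]
        _ ≤ ∫ x in y..b, J y * (4 * E * Real.exp (k * x ^ 2 / 2) +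
              2 * L * T * (σ * Real.exp (-σ * (x - y)))) :=
            intervalIntegral.integral_mono_on hyb.le
              ((hJ.const_mul _).intervalIntegrable _ _)
              (Continuous.intervalIntegrable (by fun_prop) _ _) hpt
        _ = J y * (4 * E * (∫ x in y..b, Real.exp (k * x ^ 2 / 2)) +
              2 * L * T * ∫ x in y..b, σ * Real.exp (-σ * (x - y))) := by
            rw [intervalIntegral.integral_const_mul, intervalIntegral.integral_add
              (Continuous.intervalIntegrable (by fun_prop) _ _)
              (Continuous.intervalIntegrable (by fun_prop) _ _),
              intervalIntegral.integral_const_mul (4 * E),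
              intervalIntegral.integral_const_mul (2 * L * T)]
        _ ≤ J y * (4 * E * Φ + 2 * L * T * 1) := by
            gcongr
            · exact hΦ' (haL.trans hay) hyb.le hbL
            · exact intervalIntegral_mul_exp_neg_le_one σ y b
        _ = _ := by ring
    have hsq := Real.sq_sqrt hv.le
    have hsv : 0 < Real.sqrt v := Real.sqrt_pos.2 hv
    rcases le_or_gt (Real.sqrt v) (J y * (E * Φ)) with h4 | h4
    · have h5 := sqrt_mul_two_sub_log_le hv.le
      have h6 : v * (2 - Real.log v) = Real.sqrt v * (Real.sqrt v * (2 - Real.log v)) := by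
        rw [← mul_assoc, ← pow_two, hsq]
      rw [h6]
      nlinarith
    · have h5 : 1 / 2 ≤ Real.sqrt v * Real.exp (2 * L * σ) := h3.trans (by gcongr)
      have h6 := Real.log_le_log (by norm_num) h5
      rw [Real.log_mul hsv.ne' (Real.exp_pos _).ne', Real.log_exp, Real.log_sqrt hv.le,
        one_div, Real.log_inv] at h6
      have h7 := Real.log_two_lt_d9
      have h8 : 2 - Real.log v ≤ 4 + 2 * (2 * L * σ) := by linarith
      calc v * (2 - Real.log v) ≤ v * (4 + 2 * (2 * L * σ)) := by gcongr
        _ = 4 * v + 2 * (2 * L * σ * v) := by ring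
        _ ≤ _ := by linarith

/-! ### The logarithmic Sobolev inequality on compact intervals -/

/-- The curvature bound `-(log J)'' ≥ K` on `[a, b]`, in integrated form: `log J` lies below the
parabolas of second derivative `-K` which touch it. -/
def HasCurvatureBound (K a b : ℝ) (J : ℝ → ℝ) : Prop :=
  ∃ s : ℝ → ℝ, ∀ y ∈ Icc a b, ∀ x ∈ Icc a b,
    J x ≤ J y * Real.exp (-s y * (x - y) - K * (x - y) ^ 2 / 2)

theorem HasCurvatureBound.comp_neg {K a b : ℝ} {J : ℝ → ℝ} (h : HasCurvatureBound K a b J) :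
    HasCurvatureBound K (-b) (-a) fun x => J (-x) := by
  obtain ⟨s, hs⟩ := h
  refine ⟨fun y => -s (-y), fun y hy x hx => ?_⟩
  have := hs (-y) ⟨by linarith [hy.2], by linarith [hy.1]⟩ (-x)
    ⟨by linarith [hx.2], by linarith [hx.1]⟩
  convert this using 3
  ring

theorem hasDerivAt_tail_mul_log {J : ℝ → ℝ} (hJ : Continuous J) (hpos : ∀ x, 0 < J x) {x b : ℝ}
    (hx : x < b) :
    HasDerivAt (fun x => (∫ t in x..b, J t) * (2 - Real.log (∫ t in x..b, J t)))
      (-(1 - Real.log (∫ t in x..b, J t)) * J x) x := by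
  have hv := tail_pos hJ hpos hx
  have h1 := hasDerivAt_tail hJ b x
  refine (h1.mul ((h1.log hv.ne').const_sub 2)).congr_deriv ?_
  field_simp
  ring

/-- The constant in the entropy bound for curvature `K`: for `K > 0` it is of order `1 / K`, and
otherwise it is of the order of the integral of the tail weight over the interval `[-L, L]`; only
`K ≠ 0` is of interest. -/
noncomputable def entropyConst (K L : ℝ) : ℝ :=
  if 0 < K then 64 * (2 * Real.pi / K) else 4 * ∫ y in (-L)..L, tailWeight (-K) L y

theorem continuous_tailWeight (k L : ℝ) : Continuous (tailWeight k L) := by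
  unfold tailWeight; fun_prop

theorem tailWeight_pos {k L : ℝ} (hL : 0 < L) (y : ℝ) : 0 < tailWeight k L y := by
  unfold tailWeight
  have hΦ0 : 0 < ∫ x in (-L)..L, Real.exp (k * x ^ 2 / 2) :=
    tail_pos (by fun_prop) (fun x => Real.exp_pos _) (by linarith)
  positivity

theorem entropyConst_pos {K L : ℝ} (hL : K ≤ 0 → 0 < L) : 0 < entropyConst K L := by
  unfold entropyConst
  split_ifs with h
  · positivity
  · have hL' := hL (not_lt.1 h)
    have := tail_pos (continuous_tailWeight (-K) L) (fun y => tailWeight_pos hL' y)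
      (show -L < L by linarith)
    positivity

/-- The entropy bound on the half-interval to the right of the median. With `H = v (2 - log v)` and
`v` the tail mass, the supersolution is `2 H` for `K > 0`. For `K < 0` it is `H (1 + ψ)`, where `ψ`
is the integral of the tail weight over `[x, L]` divided by the one over `[-L, L]`: the derivative
of `ψ` then absorbs the quadratic term. -/
theorem integral_entropyGap_right_le {J f : ℝ → ℝ} {K a b m L σ : ℝ} (hK : K ≠ 0)
    (ham : a < m) (hmb : m < b) (hL : K < 0 → -L ≤ a ∧ b ≤ L)
    (hJ : Continuous J) (hpos : ∀ x, 0 < J x) (hcurv : HasCurvatureBound K a b J)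
    (hleft : ∫ t in a..m, J t = 1 / 2) (hright : ∫ t in m..b, J t = 1 / 2)
    (hf : ContDiff ℝ 1 f) (hσ : 0 < σ)
    (hE : entropyConst K L * ∫ t in m..b, deriv f t ^ 2 * J t ≤ σ) :
    ∫ t in m..b, entropyGap (max (f m ^ 2) σ) (f t ^ 2) * J t ≤ 18 * σ := by
  have hA : 0 < entropyConst K L := entropyConst_pos fun h => by
    have := hL (lt_of_le_of_ne h hK); linarith
  have hv0 : ∀ x ∈ Ico m b, 0 < ∫ t in x..b, J t := fun x hx => tail_pos hJ hpos hx.2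
  have hl : ∀ x ∈ Ico m b, 1 / 2 ≤ ∫ t in a..x, J t := fun x hx => by
    rw [← hleft]
    exact intervalIntegral.integral_mono_interval le_rfl ham.le hx.1
      (Filter.Eventually.of_forall fun t => (hpos t).le) (hJ.intervalIntegrable _ _)
  have hr : ∀ x ∈ Ico m b, ∫ t in x..b, J t ≤ 1 := fun x hx => by
    have : ∫ t in x..b, J t ≤ ∫ t in m..b, J t :=
      intervalIntegral.integral_mono_interval hx.1 hx.2.le le_rfl
        (Filter.Eventually.of_forall fun t => (hpos t).le) (hJ.intervalIntegrable _ _)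
    linarith
  obtain ⟨s, hs⟩ := hcurv
  rcases lt_or_gt_of_ne hK with hneg | hKpos
  · obtain ⟨haL, hbL⟩ := hL hneg
    have hL0 : 0 < L := by linarith
    set k := -K with hk
    have hk0 : 0 < k := neg_pos.2 hneg
    set S := ∫ y in (-L)..L, tailWeight k L y with hS
    have hcont := continuous_tailWeight k L
    have hS0 : 0 < S := tail_pos hcont (fun y => tailWeight_pos hL0 y) (by linarith)
    have hAS : entropyConst K L = 4 * S := by
      unfold entropyConst; rw [if_neg (not_lt.2 hneg.le)]
    set ψ : ℝ → ℝ := fun x => (∫ y in x..L, tailWeight k L y) / S with hψ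
    have hψ0 : ∀ x ∈ Ico m b, 0 ≤ ψ x := fun x hx =>
      div_nonneg (intervalIntegral.integral_nonneg (hx.2.le.trans hbL)
        fun y _ => (tailWeight_pos hL0 y).le) hS0.le
    have hψ1 : ∀ x ∈ Ico m b, ψ x ≤ 1 := fun x hx => by
      rw [hψ]; simp only
      rw [div_le_one hS0]
      exact intervalIntegral.integral_mono_interval (by linarith [hx.1]) (hx.2.le.trans hbL)
        le_rfl (Filter.Eventually.of_forall fun y => (tailWeight_pos hL0 y).le)
        (hcont.intervalIntegrable _ _)
    refine integral_entropyGap_le_of_riccati hmb hJ hpos (by linarith) hA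
      (w := fun x => (∫ t in x..b, J t) * (2 - Real.log (∫ t in x..b, J t)) * (1 + ψ x))
      (fun x hx => (hasDerivAt_tail_mul_log hJ hpos hx.2).mul
        (((hasDerivAt_tail hcont L x).div_const S).const_add 1))
      (fun x hx => ?_) (fun x hx => ?_) hf hσ hE
    · exact le_mul_of_one_le_right (mul_two_sub_log_nonneg (hv0 x hx).le (hr x hx))
        (by linarith [hψ0 x hx])
    · have hmain := tail_mul_log_le (ham.le.trans hx.1) hx.2 haL hbL hJ hpos hk0
        (s := s x) (fun z hz => by
          have := hs x ⟨ham.le.trans hx.1, hx.2.le⟩ z hz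
          simpa [hk] using this) (hl x hx) (hr x hx)
      have hH0 := mul_two_sub_log_nonneg (hv0 x hx).le (hr x hx)
      have hlog := Real.log_nonpos (hv0 x hx).le (hr x hx)
      have hJx := hpos x
      have h0 := hψ0 x hx
      have h1 := hψ1 x hx
      set v := ∫ t in x..b, J t with hv
      set H := v * (2 - Real.log v) with hH
      rw [hAS]
      have h2 : (H * (1 + ψ x)) ^ 2 / (4 * S * J x) ≤ H * tailWeight k L x / S := by
        rw [div_le_div_iff₀ (by positivity) hS0]
        have : (1 + ψ x) ^ 2 ≤ 4 := by nlinarith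
        have h3 : (H * (1 + ψ x)) ^ 2 ≤ H * (J x * tailWeight k L x) * 4 := by
          rw [mul_pow, pow_two H]
          exact mul_le_mul (mul_le_mul_of_nonneg_left hmain hH0) this (sq_nonneg _)
            (mul_nonneg hH0 (mul_nonneg hJx.le (tailWeight_pos hL0 x).le))
        calc (H * (1 + ψ x)) ^ 2 * S ≤ H * (J x * tailWeight k L x) * 4 * S := by gcongr
          _ = _ := by ring
      have h3 : 0 ≤ (1 - Real.log v) * J x * ψ x :=
        mul_nonneg (mul_nonneg (by linarith) hJx.le) h0
      have h4 : -(1 - Real.log v) * J x * (1 + ψ x) + H * (-tailWeight k L x / S) +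
          (1 - Real.log v) * J x + H * tailWeight k L x / S =
          -((1 - Real.log v) * J x * ψ x) := by ring
      linarith
  · have hAS : entropyConst K L = 64 * (2 * Real.pi / K) := by
      unfold entropyConst; rw [if_pos hKpos]
    refine integral_entropyGap_le_of_riccati hmb hJ hpos (by linarith) hA
      (w := fun x => 2 * ((∫ t in x..b, J t) * (2 - Real.log (∫ t in x..b, J t))))
      (fun x hx => (hasDerivAt_tail_mul_log hJ hpos hx.2).const_mul 2)
      (fun x hx => ?_) (fun x hx => ?_) hf hσ hE
    · have hH0 := mul_two_sub_log_nonneg (hv0 x hx).le (hr x hx)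
      linarith
    · have hmain := sq_tail_mul_log_le (ham.le.trans hx.1) hx.2 hJ hpos hKpos
        (s := s x) (fun z hz => hs x ⟨ham.le.trans hx.1, hx.2.le⟩ z hz) (hl x hx) (hr x hx)
      have hlog := Real.log_nonpos (hv0 x hx).le (hr x hx)
      have hJx := hpos x
      have hv0' := hv0 x hx
      set v := ∫ t in x..b, J t with hv
      have h2 : (2 * (v * (2 - Real.log v))) ^ 2 / (entropyConst K L * J x) ≤
          (1 - Real.log v) * J x := by
        rw [div_le_iff₀ (by positivity), hAS]
        have h3 : (v * (2 - Real.log v)) ^ 2 ≤ 4 * (v ^ 2 * (1 - Real.log v)) *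
            (1 - Real.log v) := by
          have : 2 - Real.log v ≤ 2 * (1 - Real.log v) := by linarith
          calc (v * (2 - Real.log v)) ^ 2 ≤ (v * (2 * (1 - Real.log v))) ^ 2 := by
                have : 0 ≤ v * (2 - Real.log v) := mul_nonneg hv0'.le (by linarith)
                gcongr
            _ = _ := by ring
        have h4 := mul_le_mul_of_nonneg_right hmain (by linarith : 0 ≤ 1 - Real.log v)
        nlinarith
      have h5 : 2 * (-(1 - Real.log v) * J x) + (1 - Real.log v) * J x =
        -((1 - Real.log v) * J x) := by ring
      linarith

theorem integral_entropyGap_left_le {J f : ℝ → ℝ} {K a b m L σ : ℝ} (hK : K ≠ 0)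
    (ham : a < m) (hmb : m < b) (hL : K < 0 → -L ≤ a ∧ b ≤ L)
    (hJ : Continuous J) (hpos : ∀ x, 0 < J x) (hcurv : HasCurvatureBound K a b J)
    (hleft : ∫ t in a..m, J t = 1 / 2) (hright : ∫ t in m..b, J t = 1 / 2)
    (hf : ContDiff ℝ 1 f) (hσ : 0 < σ)
    (hE : entropyConst K L * ∫ t in a..m, deriv f t ^ 2 * J t ≤ σ) :
    ∫ t in a..m, entropyGap (max (f m ^ 2) σ) (f t ^ 2) * J t ≤ 18 * σ := by
  have h := integral_entropyGap_right_le (J := fun x => J (-x)) (f := fun x => f (-x)) (a := -b)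
    (b := -a) (m := -m) (L := L) (σ := σ) hK (by linarith) (by linarith)
    (fun h => ⟨by linarith [(hL h).2], by linarith [(hL h).1]⟩)
    (hJ.comp continuous_neg) (fun x => hpos _) hcurv.comp_neg
    (by rw [intervalIntegral.integral_comp_neg (fun x => J x)]; simpa using hright)
    (by rw [intervalIntegral.integral_comp_neg (fun x => J x)]; simpa using hleft)
    (hf.comp contDiff_neg) hσ (by
      simp only [deriv_comp_neg, neg_sq]
      rw [intervalIntegral.integral_comp_neg (fun x => deriv f x ^ 2 * J x)]
      simpa using hE)
  simp only [neg_neg] at h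
  rw [intervalIntegral.integral_comp_neg
    (fun x => entropyGap (max (f m ^ 2) σ) (f x ^ 2) * J x)] at h
  simpa using h

/-- The logarithmic Sobolev inequality for a probability density on a compact interval: the bounds
on both sides of the median are added. -/
theorem integral_mul_log_le_of_integral_eq_one {J f : ℝ → ℝ} {K a b L : ℝ} (hK : K ≠ 0)
    (hab : a < b) (hL : K < 0 → -L ≤ a ∧ b ≤ L)
    (hJ : Continuous J) (hpos : ∀ x, 0 < J x) (hcurv : HasCurvatureBound K a b J)
    (hmass : ∫ t in a..b, J t = 1) (hf : ContDiff ℝ 1 f) :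
    ∫ t in a..b, f t ^ 2 * Real.log (f t ^ 2) * J t ≤
      (∫ t in a..b, f t ^ 2 * J t) * Real.log (∫ t in a..b, f t ^ 2 * J t) +
        36 * (entropyConst K L * ∫ t in a..b, deriv f t ^ 2 * J t) := by
  have hA : 0 < entropyConst K L := entropyConst_pos fun h => by
    have := hL (lt_of_le_of_ne h hK); linarith
  have hdf : Continuous (deriv f) := hf.continuous_deriv le_rfl
  have hcE : Continuous fun t => deriv f t ^ 2 * J t := (hdf.pow 2).mul hJ
  have hcN : Continuous fun t => f t ^ 2 * J t := (hf.continuous.pow 2).mul hJ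
  have hcL : Continuous fun t => f t ^ 2 * Real.log (f t ^ 2) * J t :=
    (Real.continuous_mul_log.comp (hf.continuous.pow 2)).mul hJ
  -- the median
  obtain ⟨m, hm, hmed⟩ : ∃ m ∈ Ioo a b, ∫ t in a..m, J t = 1 / 2 := by
    have hc : ContinuousOn (fun x => ∫ t in a..x, J t) (Icc a b) :=
      (intervalIntegral.continuous_primitive (fun p q => hJ.intervalIntegrable p q) a).continuousOn
    have := intermediate_value_Ioo hab.le hc
    simp only [intervalIntegral.integral_same, hmass] at this
    exact this (by norm_num)
  have hmed' : ∫ t in m..b, J t = 1 / 2 := by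
    have := intervalIntegral.integral_add_adjacent_intervals (hJ.intervalIntegrable a m)
      (hJ.intervalIntegrable (μ := volume) m b)
    linarith
  -- `ε` makes the level `σ` positive even if the energy vanishes
  refine le_of_forall_pos_le_add fun ε hε => ?_
  set E := ∫ t in a..b, deriv f t ^ 2 * J t with hE
  have hE0 : ∀ t, 0 ≤ deriv f t ^ 2 * J t := fun t => mul_nonneg (sq_nonneg _) (hpos t).le
  have hE0' : 0 ≤ E := intervalIntegral.integral_nonneg hab.le fun t _ => hE0 t
  set σ := entropyConst K L * E + ε / 36 with hσ
  have hσ0 : 0 < σ := by positivity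
  set s := max (f m ^ 2) σ with hs
  have hs0 : 0 < s := lt_max_of_lt_right hσ0
  have hcP : Continuous fun t => entropyGap s (f t ^ 2) * J t :=
    ((continuous_entropyGap _ hs0).comp (hf.continuous.pow 2)).mul hJ
  have h1 := integral_entropyGap_left_le hK hm.1 hm.2 hL hJ hpos hcurv hmed hmed' hf hσ0 (by
    have : ∫ t in a..m, deriv f t ^ 2 * J t ≤ E :=
      intervalIntegral.integral_mono_interval le_rfl hm.1.le hm.2.le
        (Filter.Eventually.of_forall hE0) (hcE.intervalIntegrable _ _)
    rw [hσ]
    nlinarith)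
  have h2 := integral_entropyGap_right_le hK hm.1 hm.2 hL hJ hpos hcurv hmed hmed' hf hσ0 (by
    have : ∫ t in m..b, deriv f t ^ 2 * J t ≤ E :=
      intervalIntegral.integral_mono_interval hm.1.le hm.2.le le_rfl
        (Filter.Eventually.of_forall hE0) (hcE.intervalIntegrable _ _)
    rw [hσ]
    nlinarith)
  have h3 := intervalIntegral.integral_add_adjacent_intervals (hcP.intervalIntegrable a m)
      (hcP.intervalIntegrable (μ := volume) m b)
  set N := ∫ t in a..b, f t ^ 2 * J t with hN
  have hN0 : 0 ≤ N := intervalIntegral.integral_nonneg hab.le fun t _ =>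
    mul_nonneg (sq_nonneg _) (hpos t).le
  have h4 : ∫ t in a..b, entropyGap s (f t ^ 2) * J t =
      (∫ t in a..b, f t ^ 2 * Real.log (f t ^ 2) * J t) - (Real.log s + 1) * N + s := by
    have hpt : ∀ t, entropyGap s (f t ^ 2) * J t =
        f t ^ 2 * Real.log (f t ^ 2) * J t - (Real.log s + 1) * (f t ^ 2 * J t) + s * J t := by
      intro t
      unfold entropyGap
      rcases eq_or_ne (f t) 0 with h | h
      · simp [h]
      · rw [Real.log_div (by positivity) hs0.ne']
        ring
    have hcD : Continuous fun t => f t ^ 2 * Real.log (f t ^ 2) * J t -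
        (Real.log s + 1) * (f t ^ 2 * J t) := hcL.sub (hcN.const_mul _)
    simp only [hpt]
    rw [intervalIntegral.integral_add (hcD.intervalIntegrable _ _)
      ((hJ.const_mul s).intervalIntegrable _ _), intervalIntegral.integral_sub
      (hcL.intervalIntegrable _ _) ((hcN.const_mul _).intervalIntegrable _ _),
      intervalIntegral.integral_const_mul, intervalIntegral.integral_const_mul, hmass, mul_one]
  -- the choice of the reference level only increases the entropy functional
  have h5 : (Real.log s + 1) * N - s ≤ N * Real.log N := by
    rcases hN0.eq_or_lt with h | h
    · rw [← h]; simp [hs0.le]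
    · have := Real.log_le_sub_one_of_pos (div_pos hs0 h)
      rw [Real.log_div hs0.ne' h.ne'] at this
      have h6 := mul_le_mul_of_nonneg_left this h.le
      have : N * (s / N - 1) = s - N := by field_simp
      nlinarith
  linarith

/-- The logarithmic Sobolev inequality on a compact interval, for a density of arbitrary mass. -/
theorem integral_mul_log_le {J f : ℝ → ℝ} {K a b L : ℝ} (hK : K ≠ 0)
    (hab : a < b) (hL : K < 0 → -L ≤ a ∧ b ≤ L)
    (hJ : Continuous J) (hpos : ∀ x, 0 < J x) (hcurv : HasCurvatureBound K a b J)
    (hf : ContDiff ℝ 1 f) :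
    ∫ t in a..b, f t ^ 2 * Real.log (f t ^ 2) * J t ≤
      (∫ t in a..b, f t ^ 2 * J t) *
          Real.log ((∫ t in a..b, f t ^ 2 * J t) / ∫ t in a..b, J t) +
        36 * (entropyConst K L * ∫ t in a..b, deriv f t ^ 2 * J t) := by
  have hZ : 0 < ∫ t in a..b, J t := tail_pos hJ hpos hab
  set Z := ∫ t in a..b, J t with hZdef
  have h := integral_mul_log_le_of_integral_eq_one (J := fun t => J t / Z) hK hab hL
    (hJ.div_const Z) (fun x => div_pos (hpos x) hZ) (by
      obtain ⟨s, hs⟩ := hcurv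
      refine ⟨s, fun y hy x hx => ?_⟩
      rw [div_mul_eq_mul_div]
      exact (div_le_div_iff_of_pos_right hZ).2 (hs y hy x hx))
    (by rw [intervalIntegral.integral_div, div_self hZ.ne']) hf
  simp only [mul_div_assoc', intervalIntegral.integral_div] at h
  rw [div_mul_eq_mul_div, ← add_div] at h
  exact (div_le_div_iff_of_pos_right hZ).1 h

/-! ### Measures with a curvature bound -/

/-- The function `log J + K x ^ 2 / 2` is concave, hence below its tangents. -/
theorem HasCurvatureBound.of_deriv_deriv_log {J : ℝ → ℝ} {I : Set ℝ} {K a b : ℝ} (hI : IsOpen I)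
    (hconv : I.OrdConnected) (hJ : ContDiffOn ℝ ∞ J I) (hpos : ∀ x ∈ I, 0 < J x)
    (hK : ∀ x ∈ I, K ≤ -deriv (deriv fun y => Real.log (J y)) x) (hab : Icc a b ⊆ I) :
    HasCurvatureBound K a b J := by
  set φ : ℝ → ℝ := fun y => Real.log (J y) with hφ
  have hφs : ContDiffOn ℝ ∞ φ I := hJ.log fun x hx => (hpos x hx).ne'
  have hd1 : ∀ x ∈ I, HasDerivAt φ (deriv φ x) x := fun x hx =>
    ((hφs.differentiableOn (by simp)).differentiableAt (hI.mem_nhds hx)).hasDerivAt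
  have hd2 : ∀ x ∈ I, HasDerivAt (deriv φ) (deriv (deriv φ) x) x := fun x hx =>
    (((hφs.deriv_of_isOpen (m := ∞) hI (by simp)).differentiableOn (by simp)).differentiableAt
      (hI.mem_nhds hx)).hasDerivAt
  set u : ℝ → ℝ := fun x => φ x + K * x ^ 2 / 2 with hu
  have hu1 : ∀ x ∈ I, HasDerivAt u (deriv φ x + K * x) x := fun x hx =>
    ((hd1 x hx).add ((((hasDerivAt_id x).pow 2).const_mul K).div_const 2)).congr_deriv (by
      simp; ring)
  have hu2 : ∀ x ∈ I, HasDerivAt (fun x => deriv φ x + K * x) (deriv (deriv φ) x + K) x :=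
    fun x hx => ((hd2 x hx).add ((hasDerivAt_id x).const_mul K)).congr_deriv (by simp)
  have hconc : ConcaveOn ℝ I u := by
    refine concaveOn_of_hasDerivWithinAt2_nonpos hconv.convex
      (fun x hx => (hu1 x hx).continuousAt.continuousWithinAt)
      (fun x hx => (hu1 x (interior_subset hx)).hasDerivWithinAt)
      (fun x hx => (hu2 x (interior_subset hx)).hasDerivWithinAt) fun x hx => ?_
    have := hK x (interior_subset hx)
    linarith
  refine ⟨fun y => -deriv φ y, fun y hy x hx => ?_⟩
  have hx' := hab hx
  have hy' := hab hy
  have htan : u x ≤ u y + (deriv φ y + K * y) * (x - y) := by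
    rcases lt_trichotomy x y with h | rfl | h
    · have := hconc.le_slope_of_hasDerivAt hx' hy' h (hu1 y hy')
      rw [slope_def_field, le_div_iff₀ (sub_pos.2 h)] at this
      linarith
    · simp
    · have := hconc.slope_le_of_hasDerivAt hy' hx' h (hu1 y hy')
      rw [slope_def_field, div_le_iff₀ (sub_pos.2 h)] at this
      linarith
  have hlog : φ x ≤ φ y + (-(-deriv φ y) * (x - y) - K * (x - y) ^ 2 / 2) := by
    simp only [hu] at htan
    nlinarith
  calc J x = Real.exp (φ x) := (Real.exp_log (hpos x hx')).symm
    _ ≤ Real.exp (φ y + (-(-deriv φ y) * (x - y) - K * (x - y) ^ 2 / 2)) :=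
        Real.exp_le_exp.2 hlog
    _ = _ := by rw [Real.exp_add, hφ, Real.exp_log (hpos y hy')]

/-- The logarithmic Sobolev inequality on a compact interval, of length at most `2 * L` if `K < 0`,
for a density which is only controlled on that interval. -/
theorem integral_mul_log_le_of_continuousOn {J f : ℝ → ℝ} {K a b L : ℝ} (hK : K ≠ 0)
    (hab : a < b) (hL : K < 0 → b - a ≤ 2 * L)
    (hJ : ContinuousOn J (Icc a b)) (hpos : ∀ x ∈ Icc a b, 0 < J x)
    (hcurv : HasCurvatureBound K a b J) (hf : ContDiff ℝ 1 f) :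
    ∫ t in a..b, f t ^ 2 * Real.log (f t ^ 2) * J t ≤
      (∫ t in a..b, f t ^ 2 * J t) *
          Real.log ((∫ t in a..b, f t ^ 2 * J t) / ∫ t in a..b, J t) +
        36 * (entropyConst K L * ∫ t in a..b, deriv f t ^ 2 * J t) := by
  set J' : ℝ → ℝ := IccExtend hab.le ((Icc a b).domRestrict J) with hJ'
  have hJ'c : Continuous J' := hJ.domRestrict.Icc_extend'
  have hJ'pos : ∀ x, 0 < J' x := fun x => hpos _ (Subtype.coe_prop _)
  have hJ'eq : ∀ x ∈ Icc a b, J' x = J x := fun x hx => IccExtend_of_mem hab.le _ hx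
  set c := (a + b) / 2 with hc
  have h := integral_mul_log_le (J := fun x => J' (x + c)) (f := fun x => f (x + c))
    (a := a - c) (b := b - c) (L := L) (K := K) hK (by linarith)
    (fun h => by have := hL h; constructor <;> linarith) (by fun_prop) (fun x => hJ'pos _) (by
      obtain ⟨s, hs⟩ := hcurv
      refine ⟨fun y => s (y + c), fun y hy x hx => ?_⟩
      have hy' : y + c ∈ Icc a b := ⟨by linarith [hy.1], by linarith [hy.2]⟩
      have hx' : x + c ∈ Icc a b := ⟨by linarith [hx.1], by linarith [hx.2]⟩
      simp only [hJ'eq _ hy', hJ'eq _ hx']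
      convert hs (y + c) hy' (x + c) hx' using 3
      ring) (hf.comp (contDiff_id.add contDiff_const))
  simp only [deriv_comp_add_const] at h
  rw [intervalIntegral.integral_comp_add_right
      (fun x => f x ^ 2 * Real.log (f x ^ 2) * J' x) c,
    intervalIntegral.integral_comp_add_right (fun x => f x ^ 2 * J' x) c,
    intervalIntegral.integral_comp_add_right (fun x => J' x) c,
    intervalIntegral.integral_comp_add_right (fun x => deriv f x ^ 2 * J' x) c] at h
  simp only [sub_add_cancel] at h
  have hcongr : ∀ F : ℝ → ℝ, ∫ t in a..b, F t * J' t = ∫ t in a..b, F t * J t := fun F =>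
    intervalIntegral.integral_congr fun x hx => by
      rw [uIcc_of_le hab.le] at hx
      simp only [hJ'eq x hx]
  have hcongr1 : ∫ t in a..b, J' t = ∫ t in a..b, J t := by simpa using hcongr 1
  rwa [hcongr, hcongr, hcongr, hcongr1] at h

theorem exists_monotone_iUnion_Icc_eq {I : Set ℝ} (hI : IsOpen I) (hconv : I.OrdConnected)
    (hne : I.Nonempty) : ∃ a b : ℕ → ℝ, (∀ n, a n < b n) ∧
      Monotone (fun n => Icc (a n) (b n)) ∧ ⋃ n, Icc (a n) (b n) = I := by
  obtain ⟨p, hp⟩ := hne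
  obtain ⟨ε, hε, hball⟩ := Metric.isOpen_iff.1 hI p hp
  have hr : p + ε / 2 ∈ I := hball (by simp [abs_of_pos, hε])
  have : Nonempty I := ⟨⟨p, hp⟩⟩
  set q : ℕ → ℝ := fun n => (TopologicalSpace.denseSeq I n : ℝ) with hq
  set b : ℕ → ℝ := fun n => partialSups (fun i => max (p + ε / 2) (q i)) n with hb
  set a : ℕ → ℝ := fun n => -partialSups (fun i => max (-p) (-q i)) n with ha
  have hbI : ∀ n, b n ∈ I := fun n => by
    have hmax : ∀ i, max (p + ε / 2) (q i) ∈ I := fun i => by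
      rcases max_choice (p + ε / 2) (q i) with h | h <;> rw [h]
      exacts [hr, Subtype.coe_prop _]
    induction n with
    | zero => simpa [hb] using hmax 0
    | succ n ih =>
      simp only [hb, partialSups_add_one] at ih ⊢
      rcases max_choice (partialSups (fun i => max (p + ε / 2) (q i)) n)
        (max (p + ε / 2) (q (n + 1))) with h | h <;> rw [h]
      exacts [ih, hmax _]
  have haI : ∀ n, a n ∈ I := fun n => by
    have hmax : ∀ i, -max (-p) (-q i) ∈ I := fun i => by
      rcases max_choice (-p) (-q i) with h | h <;> rw [h, neg_neg]
      exacts [hp, Subtype.coe_prop _]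
    induction n with
    | zero => simpa [ha] using hmax 0
    | succ n ih =>
      simp only [ha, partialSups_add_one] at ih ⊢
      rcases max_choice (partialSups (fun i => max (-p) (-q i)) n)
        (max (-p) (-q (n + 1))) with h | h <;> rw [h]
      exacts [ih, hmax _]
  have hbm : Monotone b := (partialSups fun i => max (p + ε / 2) (q i)).monotone
  have ham : Antitone a := fun i j hij =>
    neg_le_neg ((partialSups fun i => max (-p) (-q i)).monotone hij)
  have hbq : ∀ n, max (p + ε / 2) (q n) ≤ b n := fun n =>
    le_partialSups (fun i => max (p + ε / 2) (q i)) n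
  have haq : ∀ n, max (-p) (-q n) ≤ -a n := fun n => by
    simpa [ha] using le_partialSups (fun i => max (-p) (-q i)) n
  refine ⟨a, b, fun n => ?_, fun i j hij => Icc_subset_Icc (ham hij) (hbm hij), ?_⟩
  · have h1 := (le_max_left _ _).trans (hbq n)
    have h2 := (le_max_left _ _).trans (haq n)
    linarith
  · apply subset_antisymm
    · exact iUnion_subset fun n => hconv.out (haI n) (hbI n)
    · intro x hx
      obtain ⟨δ, hδ, hδI⟩ := Metric.isOpen_iff.1 hI x hx
      have hdense := TopologicalSpace.denseRange_denseSeq I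
      have hex : ∀ U : Set ℝ, IsOpen U → (U ∩ I).Nonempty → ∃ n, q n ∈ U := by
        rintro U hU ⟨z, hzU, hzI⟩
        obtain ⟨n, hn⟩ := hdense.exists_mem_open (hU.preimage continuous_subtype_val)
          ⟨⟨z, hzI⟩, hzU⟩
        exact ⟨n, hn⟩
      obtain ⟨i, hi⟩ := hex (Iio x) isOpen_Iio
        ⟨x - δ / 2, by simp [hδ], hδI (by simp [abs_of_pos, hδ])⟩
      obtain ⟨j, hj⟩ := hex (Ioi x) isOpen_Ioi
        ⟨x + δ / 2, by simp [hδ], hδI (by simp [abs_of_pos, hδ])⟩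
      refine mem_iUnion.2 ⟨max i j, ?_, ?_⟩
      · have h1 := (le_max_right _ _).trans (haq i)
        have h2 := ham (le_max_left i j)
        simp only [mem_Iio] at hi
        linarith
      · have h1 := (le_max_right _ _).trans (hbq j)
        have h2 := hbm (le_max_right i j)
        simp only [mem_Ioi] at hj
        linarith

theorem deriv_eq_zero_of_notMem_tsupport {f g : ℝ → ℝ} (hf : ContDiff ℝ ∞ f)
    (hfg : ∀ x, f x ^ 2 = 1 + g x) {x : ℝ} (hx : x ∉ tsupport g) : deriv f x = 0 := by
  have hev : (fun y => f y ^ 2) =ᶠ[nhds x] fun _ => 1 := by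
    filter_upwards [(isClosed_tsupport g).isOpen_compl.mem_nhds hx] with y hy
    rw [hfg, image_eq_zero_of_notMem_tsupport hy, add_zero]
  have hd := (hf.differentiable (by simp) x).hasDerivAt
  have h1 := (hd.pow 2).deriv
  have h2 : deriv (fun y => f y ^ 2) x = 0 := by rw [hev.deriv_eq]; simp
  have hfx : f x ≠ 0 := by
    intro h
    have := hev.self_of_nhds
    simp [h] at this
  have h3 : (f ^ 2) = fun y => f y ^ 2 := rfl
  rw [h3, h2] at h1
  simpa [hfx] using h1.symm

theorem deriv_hasCompactSupport_of_sq_eq {f g : ℝ → ℝ} (hf : ContDiff ℝ ∞ f)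
    (hg : HasCompactSupport g) (hfg : ∀ x, f x ^ 2 = 1 + g x) : HasCompactSupport (deriv f) :=
  HasCompactSupport.intro hg fun _ hx => deriv_eq_zero_of_notMem_tsupport hf hfg hx

/-- The logarithmic Sobolev inequality for measures with a curvature bound: on compact
subintervals of the interior of the support it is `integral_mul_log_le_of_continuousOn`, and the
four integrals converge along an exhaustion. -/
theorem IsCDD.integral_mul_log_le {ξ : Measure ℝ} {K L : ℝ} {D : ℝ≥0∞} (h : IsCDD K D ξ)
    (hξ : ξ ≠ 0) (hK : K ≠ 0) (hL : K < 0 → 0 ≤ L ∧ D ≤ ENNReal.ofReal (2 * L)) {f : ℝ → ℝ}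
    (hf : f ∈ LSTest ξ) :
    ∫ x, f x ^ 2 * Real.log (f x ^ 2) ∂ξ ≤
      36 * (entropyConst K L * ∫ x, deriv f x ^ 2 ∂ξ) := by
  obtain ⟨hfs, g, ⟨hgs, hgc, hg0⟩, hfg⟩ := hf
  have := h.finite
  obtain ⟨J, hJm, hJ, hJs, hJK⟩ := h.density
  set I := interior ξ.support with hI
  have hIopen : IsOpen I := isOpen_interior
  have hIconv : I.OrdConnected := h.interval.convex.interior.ordConnected
  -- the boundary of an interval is a null set
  have hIc : ξ Iᶜ = 0 := by
    have h1 : ξ (frontier ξ.support) = 0 := by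
      have hac : ξ ≪ volume := by
        rw [hJ]
        exact withDensity_absolutelyContinuous _ _
      exact hac (h.interval.convex.addHaar_frontier volume)
    refine measure_mono_null ?_ (measure_union_null h1 (Measure.measure_compl_support (μ := ξ)))
    intro x hx
    by_cases hxs : x ∈ ξ.support
    · exact Or.inl ⟨subset_closure hxs, hx⟩
    · exact Or.inr hxs
  have hIne : I.Nonempty := by
    by_contra hne
    rw [not_nonempty_iff_eq_empty] at hne
    rw [hne, compl_empty, Measure.measure_univ_eq_zero] at hIc
    exact hξ hIc
  obtain ⟨a, b, hab, hmono, hUn⟩ := exists_monotone_iUnion_Icc_eq hIopen hIconv hIne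
  have hsub : ∀ n, Icc (a n) (b n) ⊆ I := fun n =>
    (subset_iUnion (fun n => Icc (a n) (b n)) n).trans hUn.subset
  have hlen : K < 0 → ∀ n, b n - a n ≤ 2 * L := fun hneg n => by
    obtain ⟨hL0, hDL⟩ := hL hneg
    have h1 := Metric.edist_le_ediam_of_mem
      (interior_subset (hsub n (right_mem_Icc.2 (hab n).le)))
      (interior_subset (hsub n (left_mem_Icc.2 (hab n).le)))
    have h2 := (h1.trans h.diam_le).trans hDL
    rw [edist_dist, ENNReal.ofReal_le_ofReal_iff (by positivity), Real.dist_eq,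
      abs_of_pos (sub_pos.2 (hab n))] at h2
    exact h2
  have hlim : ∀ {F : ℝ → ℝ}, Integrable F ξ →
      Filter.Tendsto (fun n => ∫ t in (a n)..(b n), F t * J t) Filter.atTop
        (nhds (∫ x, F x ∂ξ)) := fun {F} hF => by
    have h1 := tendsto_setIntegral_of_monotone (μ := ξ) (f := F)
      (fun n => measurableSet_Icc (a := a n) (b := b n)) hmono hF.integrableOn
    rw [hUn, setIntegral_eq_integral_of_ae_compl_eq_zero] at h1
    · refine h1.congr fun n => ?_
      rw [intervalIntegral.integral_of_le (hab n).le, ← integral_Icc_eq_integral_Ioc]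
      nth_rw 1 [hJ]
      rw [setIntegral_withDensity_eq_setIntegral_toReal_smul hJm.ennreal_ofReal
        (Filter.Eventually.of_forall fun x => ENNReal.ofReal_lt_top) _ measurableSet_Icc]
      refine setIntegral_congr_fun measurableSet_Icc fun x hx => ?_
      have := (hJK x (hsub n hx)).1
      simp only [smul_eq_mul, ENNReal.toReal_ofReal this.le]
      ring
    · have : ∀ᵐ x ∂ξ, x ∈ I := by rwa [ae_iff]
      filter_upwards [this] with x hx hx'
      exact absurd hx hx'
  have hgcont : Continuous g := hgs.continuous
  have hi1 : Integrable (fun x => f x ^ 2 * Real.log (f x ^ 2)) ξ := by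
    refine Continuous.integrable_of_hasCompactSupport
      (Real.continuous_mul_log.comp (hfs.continuous.pow 2)) ?_
    refine HasCompactSupport.intro hgc fun x hx => ?_
    rw [hfg, image_eq_zero_of_notMem_tsupport hx]
    simp
  have hgi : Integrable g ξ := hgcont.integrable_of_hasCompactSupport hgc
  have hi2 : Integrable (fun x => f x ^ 2) ξ := by
    simp only [hfg]
    exact (integrable_const 1).add hgi
  have hi3 : Integrable (fun x => deriv f x ^ 2) ξ := by
    refine Continuous.integrable_of_hasCompactSupport
      ((hfs.continuous_deriv (by simp)).pow 2) ?_
    have := deriv_hasCompactSupport_of_sq_eq hfs hgc hfg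
    exact this.comp_left (g := fun x => x ^ 2) (by simp)
  have hN : ∫ x, f x ^ 2 ∂ξ = ξ.real univ := by
    simp only [hfg]
    rw [integral_add (integrable_const 1) hgi, hg0]
    simp
  have hN0 : 0 < ξ.real univ := by
    rw [Measure.real, ENNReal.toReal_pos_iff]
    exact ⟨Measure.measure_univ_pos.2 hξ, measure_lt_top _ _⟩
  -- in the limit `∫ f ^ 2` equals the total mass, so that the logarithmic correction disappears
  have hl1 := hlim hi1
  have hl2 := hlim hi2
  have hl3 := hlim hi3
  have hl4 := hlim (integrable_const (1 : ℝ) (μ := ξ))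
  rw [hN] at hl2
  simp only [one_mul, integral_const, smul_eq_mul, mul_one] at hl4
  have hR := (hl2.mul ((hl2.div hl4 hN0.ne').log (by rw [div_self hN0.ne']; exact one_ne_zero))).add
    ((hl3.const_mul (entropyConst K L)).const_mul 36)
  rw [div_self hN0.ne', Real.log_one, mul_zero, zero_add] at hR
  refine le_of_tendsto_of_tendsto' hl1 hR fun n => ?_
  exact integral_mul_log_le_of_continuousOn hK (hab n) (fun h => hlen h n)
    (hJs.continuousOn.mono (hsub n)) (fun x hx => (hJK x (hsub n hx)).1)
    (HasCurvatureBound.of_deriv_deriv_log hIopen hIconv hJs (fun x hx => (hJK x hx).1)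
      (fun x hx => (hJK x hx).2) (hsub n)) (hfs.of_le (by exact_mod_cast le_top))

/-- The lower bound on the logarithmic Sobolev constant under a curvature bound. -/
theorem IsCDD.le_logSobolevConst {ξ : Measure ℝ} {K L : ℝ} {D : ℝ≥0∞} (h : IsCDD K D ξ)
    (hξ : ξ ≠ 0) (hK : K ≠ 0) (hL : K < 0 → 0 < L ∧ D ≤ ENNReal.ofReal (2 * L)) :
    ENNReal.ofReal (1 / (18 * entropyConst K L)) ≤ logSobolevConst ξ := by
  have hA : 0 < entropyConst K L := entropyConst_pos fun h => (hL (lt_of_le_of_ne h hK)).1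
  refine le_iInf fun f => le_iInf fun hf => le_iInf fun hent => ENNReal.ofReal_le_ofReal ?_
  have := h.integral_mul_log_le hξ hK (fun h => ⟨(hL h).1.le, (hL h).2⟩) hf
  rw [div_le_div_iff₀ (by positivity) hent]
  linarith

/-! ### Log-Sobolev implies Poincaré -/

theorem sub_one_add_sq_le_mul_log {y : ℝ} (hy : 0 < y) :
    (y - 1) + (Real.sqrt y - 1) ^ 2 ≤ y * Real.log y := by
  have hw := Real.sqrt_pos.2 hy
  have hsq := Real.sq_sqrt hy.le
  have h := neg_mul_log_le hw.le
  rw [Real.log_sqrt hy.le] at h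
  nlinarith

/-- The logarithmic Sobolev inequality implies the Poincaré inequality: it is tested on
`√(1 + 2 ε f)` for a bounded mean zero function `f` and a small `ε`. -/
theorem logSobolevConst_le_mul_poincareConst (ξ : Measure ℝ) [IsFiniteMeasure ξ] :
    logSobolevConst ξ ≤ 5 * poincareConst ξ := by
  rw [mul_comm, ← ENNReal.div_le_iff (by norm_num) (by norm_num)]
  refine le_iInf fun f => le_iInf fun hf => le_iInf fun hpos => ?_
  rw [ENNReal.div_le_iff (by norm_num) (by norm_num)]
  obtain ⟨hfs, hfc, hf0⟩ := hf
  obtain ⟨M, hM⟩ := hfc.exists_bound_of_continuous hfs.continuous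
  obtain ⟨ε, hε0, hz⟩ : ∃ ε > 0, ∀ x, |2 * ε * f x| ≤ 1 / 2 := by
    have hN0 : 0 < max M 1 := lt_max_of_lt_right one_pos
    refine ⟨1 / (4 * max M 1), by positivity, fun x => ?_⟩
    rw [abs_mul, abs_of_pos (by positivity : 0 < 2 * (1 / (4 * max M 1)))]
    have h1 : |f x| ≤ max M 1 := (hM x).trans (le_max_left _ _)
    calc 2 * (1 / (4 * max M 1)) * |f x| ≤ 2 * (1 / (4 * max M 1)) * max M 1 := by gcongr
      _ = 1 / 2 := by field_simp; norm_num
  have hy0 : ∀ x, 1 / 2 ≤ 1 + 2 * ε * f x := fun x => by linarith [(abs_le.1 (hz x)).1]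
  have hy1 : ∀ x, 1 + 2 * ε * f x ≤ 3 / 2 := fun x => by linarith [(abs_le.1 (hz x)).2]
  set F : ℝ → ℝ := fun x => Real.sqrt (1 + 2 * ε * f x) with hF
  have hFsq : ∀ x, F x ^ 2 = 1 + 2 * ε * f x := fun x => Real.sq_sqrt (by linarith [hy0 x])
  have hFs : ContDiff ℝ ∞ F :=
    (contDiff_const.add (contDiff_const.mul hfs)).sqrt fun x => by linarith [hy0 x]
  have hgP : (fun x => 2 * ε * f x) ∈ PoiTest ξ := by
    refine ⟨contDiff_const.mul hfs, hfc.mul_left, ?_⟩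
    rw [integral_const_mul, hf0, mul_zero]
  have hFLS : F ∈ LSTest ξ := ⟨hFs, fun x => 2 * ε * f x, hgP, hFsq⟩
  have hfi : Integrable f ξ := hfs.continuous.integrable_of_hasCompactSupport hfc
  have hf2i : Integrable (fun x => f x ^ 2) ξ := by
    refine Continuous.integrable_of_hasCompactSupport (hfs.continuous.pow 2) ?_
    exact hfc.comp_left (g := fun x => x ^ 2) (by simp)
  have hf'i : Integrable (fun x => deriv f x ^ 2) ξ := by
    refine Continuous.integrable_of_hasCompactSupport
      ((hfs.continuous_deriv (by simp)).pow 2) ?_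
    exact hfc.deriv.comp_left (g := fun x => x ^ 2) (by simp)
  have hent : 4 * ε ^ 2 / 5 * ∫ x, f x ^ 2 ∂ξ ≤ ∫ x, F x ^ 2 * Real.log (F x ^ 2) ∂ξ := by
    have h1 : ∫ x, (2 * ε * f x + 4 * ε ^ 2 / 5 * f x ^ 2) ∂ξ =
        4 * ε ^ 2 / 5 * ∫ x, f x ^ 2 ∂ξ := by
      rw [integral_add (hfi.const_mul _) (hf2i.const_mul _), integral_const_mul,
        integral_const_mul, hf0, mul_zero, zero_add]
    rw [← h1]
    refine integral_mono ((hfi.const_mul _).add (hf2i.const_mul _)) ?_ fun x => ?_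
    · refine Continuous.integrable_of_hasCompactSupport
        (Real.continuous_mul_log.comp (hFs.continuous.pow 2)) ?_
      refine HasCompactSupport.intro hfc fun x hx => ?_
      rw [hFsq, image_eq_zero_of_notMem_tsupport hx]
      simp
    · have hy := hy0 x
      have hw := Real.sqrt_nonneg (1 + 2 * ε * f x)
      have hsq := Real.sq_sqrt (by linarith : 0 ≤ 1 + 2 * ε * f x)
      have h2 := sub_one_add_sq_le_mul_log (by linarith : 0 < 1 + 2 * ε * f x)
      simp only [hFsq]
      refine le_trans ?_ h2
      set w := Real.sqrt (1 + 2 * ε * f x) with hwdef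
      have h3 : 4 * ε ^ 2 * f x ^ 2 = (w - 1) ^ 2 * (w + 1) ^ 2 := by
        have : 2 * ε * f x = (w - 1) * (w + 1) := by linarith
        calc 4 * ε ^ 2 * f x ^ 2 = (2 * ε * f x) ^ 2 := by ring
          _ = _ := by rw [this]; ring
      have h4 : (w + 1) ^ 2 ≤ 5 := by nlinarith [hy1 x, sq_nonneg (w - 1)]
      have h5 := mul_le_mul_of_nonneg_left h4 (sq_nonneg (w - 1))
      linarith
  have hen : ∫ x, deriv F x ^ 2 ∂ξ ≤ 2 * ε ^ 2 * ∫ x, deriv f x ^ 2 ∂ξ := by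
    rw [← integral_const_mul]
    refine integral_mono_of_nonneg (Filter.Eventually.of_forall fun x => sq_nonneg _)
      (hf'i.const_mul _) (Filter.Eventually.of_forall fun x => ?_)
    have hd : HasDerivAt (fun x => 1 + 2 * ε * f x) (2 * ε * deriv f x) x :=
      ((hfs.differentiable (by simp) x).hasDerivAt.const_mul (2 * ε)).const_add 1
    have hd2 := (hd.sqrt (by linarith [hy0 x])).deriv
    have hsq := Real.sq_sqrt (by linarith [hy0 x] : 0 ≤ 1 + 2 * ε * f x)
    have hw : 0 < Real.sqrt (1 + 2 * ε * f x) := Real.sqrt_pos.2 (by linarith [hy0 x])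
    simp only
    rw [hF, hd2, div_pow, div_le_iff₀ (by positivity), mul_pow, mul_pow 2 (√(1 + 2 * ε * f x)), hsq]
    have := hy0 x
    have : 0 ≤ ε ^ 2 * deriv f x ^ 2 := by positivity
    nlinarith
  have hc : 0 < 4 * ε ^ 2 / 5 * ∫ x, f x ^ 2 ∂ξ := by positivity
  have hE0 : 0 ≤ ∫ x, deriv f x ^ 2 ∂ξ := integral_nonneg fun x => sq_nonneg _
  have hle : logSobolevConst ξ ≤ ENNReal.ofReal
      ((2 * ∫ x, deriv F x ^ 2 ∂ξ) / ∫ x, F x ^ 2 * Real.log (F x ^ 2) ∂ξ) :=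
    (iInf_le _ F).trans ((iInf_le _ hFLS).trans (iInf_le _ (hc.trans_le hent)))
  refine hle.trans ?_
  rw [show (5 : ℝ≥0∞) = ENNReal.ofReal 5 by norm_num, ← ENNReal.ofReal_mul (by positivity)]
  refine ENNReal.ofReal_le_ofReal ?_
  calc (2 * ∫ x, deriv F x ^ 2 ∂ξ) / ∫ x, F x ^ 2 * Real.log (F x ^ 2) ∂ξ
      ≤ (2 * (2 * ε ^ 2 * ∫ x, deriv f x ^ 2 ∂ξ)) / (4 * ε ^ 2 / 5 * ∫ x, f x ^ 2 ∂ξ) := by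
        gcongr
    _ = (∫ x, deriv f x ^ 2 ∂ξ) / (∫ x, f x ^ 2 ∂ξ) * 5 := by
        field_simp
        ring

/-! ### Smooth odd test functions -/

/-- A smooth transition from `-1` to `1` between `-δ` and `δ`, cut off between `R` and `2 * R` on
either side of the origin. -/
noncomputable def oddStep (δ R x : ℝ) : ℝ :=
  (Real.smoothTransition (x / δ) - Real.smoothTransition (-x / δ)) *
    (Real.smoothTransition (2 - x / R) * Real.smoothTransition (2 + x / R))

theorem oddStep_neg (δ R x : ℝ) : oddStep δ R (-x) = -oddStep δ R x := by
  unfold oddStep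
  simp only [neg_neg, neg_div, sub_neg_eq_add, ← sub_eq_add_neg]
  ring

theorem contDiff_oddStep (δ R : ℝ) : ContDiff ℝ ∞ (oddStep δ R) := by
  have hT : ContDiff ℝ ∞ Real.smoothTransition := Real.smoothTransition.contDiff
  unfold oddStep
  exact ((hT.comp (contDiff_id.div_const δ)).sub (hT.comp (contDiff_neg.div_const δ))).mul
    ((hT.comp (contDiff_const.sub (contDiff_id.div_const R))).mul
      (hT.comp (contDiff_const.add (contDiff_id.div_const R))))

theorem oddStep_eq_zero {δ R x : ℝ} (hR : 0 < R) (hx : 2 * R ≤ |x|) : oddStep δ R x = 0 := by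
  unfold oddStep
  rcases le_abs.1 hx with h | h
  · rw [Real.smoothTransition.zero_of_nonpos (x := 2 - x / R)]
    · ring
    · rw [sub_nonpos, le_div_iff₀ hR]; exact h
  · rw [Real.smoothTransition.zero_of_nonpos (x := 2 + x / R)]
    · ring
    · have : 2 ≤ -x / R := by rw [le_div_iff₀ hR]; exact h
      rw [neg_div] at this
      linarith

theorem oddStep_eq_one {δ R x : ℝ} (hδ : 0 < δ) (hR : 0 < R) (h1 : δ ≤ x) (h2 : x ≤ R) :
    oddStep δ R x = 1 := by
  unfold oddStep
  have hxR : x / R ≤ 1 := (div_le_one hR).2 h2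
  have hxR0 : 0 ≤ x / R := div_nonneg (hδ.le.trans h1) hR.le
  rw [Real.smoothTransition.one_of_one_le (x := x / δ) ((one_le_div hδ).2 h1),
    Real.smoothTransition.zero_of_nonpos (x := -x / δ)
      (div_nonpos_of_nonpos_of_nonneg (by linarith) hδ.le),
    Real.smoothTransition.one_of_one_le (x := 2 - x / R) (by linarith),
    Real.smoothTransition.one_of_one_le (x := 2 + x / R) (by linarith)]
  norm_num

theorem deriv_oddStep_eq_zero {δ R x : ℝ} (hδ : 0 < δ) (hR : 0 < R) (h1 : δ < |x|)
    (h2 : |x| < R) : deriv (oddStep δ R) x = 0 := by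
  rcases lt_abs.1 h1 with h | h
  · have : oddStep δ R =ᶠ[nhds x] fun _ => 1 := by
      filter_upwards [Ioo_mem_nhds h (lt_of_abs_lt h2)] with y hy
      exact oddStep_eq_one hδ hR hy.1.le hy.2.le
    rw [this.deriv_eq]; simp
  · have : oddStep δ R =ᶠ[nhds x] fun _ => -1 := by
      filter_upwards [Ioo_mem_nhds (neg_lt_of_abs_lt h2) (lt_neg_of_lt_neg h)] with y hy
      have := oddStep_eq_one (x := -y) hδ hR (by linarith [hy.2]) (by linarith [hy.1])
      rw [oddStep_neg] at this
      linarith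
    rw [this.deriv_eq]; simp

theorem deriv_oddStep_eq_zero_of_lt {δ R x : ℝ} (hR : 0 < R) (hx : 2 * R < |x|) :
    deriv (oddStep δ R) x = 0 := by
  have : oddStep δ R =ᶠ[nhds x] fun _ => 0 := by
    filter_upwards [continuous_abs.continuousAt.eventually (lt_mem_nhds hx)] with y hy
    exact oddStep_eq_zero hR (le_of_lt hy)
  rw [this.deriv_eq]; simp

theorem hasCompactSupport_oddStep {δ R : ℝ} (hR : 0 < R) : HasCompactSupport (oddStep δ R) :=
  HasCompactSupport.intro (isCompact_Icc (a := -(2 * R)) (b := 2 * R)) fun x hx =>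
    oddStep_eq_zero hR (by
      by_contra h
      exact hx (abs_le.1 (not_le.1 h).le))

theorem exists_deriv_smoothTransition_bound :
    ∃ b : ℝ, 0 < b ∧ ∀ x, |deriv Real.smoothTransition x| ≤ b := by
  have hT : ContDiff ℝ ∞ Real.smoothTransition := Real.smoothTransition.contDiff
  have hc : Continuous (deriv Real.smoothTransition) := hT.continuous_deriv (by simp)
  have hs : HasCompactSupport (deriv Real.smoothTransition) := by
    refine HasCompactSupport.intro (isCompact_Icc (a := (0 : ℝ)) (b := 1)) fun x hx => ?_
    rcases lt_or_ge x 0 with h | h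
    · have : Real.smoothTransition =ᶠ[nhds x] fun _ => 0 := by
        filter_upwards [Iio_mem_nhds h] with y hy
        exact Real.smoothTransition.zero_of_nonpos (le_of_lt hy)
      rw [this.deriv_eq]; simp
    · have h1 : 1 < x := by
        by_contra h'
        exact hx ⟨h, not_lt.1 h'⟩
      have : Real.smoothTransition =ᶠ[nhds x] fun _ => 1 := by
        filter_upwards [Ioi_mem_nhds h1] with y hy
        exact Real.smoothTransition.one_of_one_le (le_of_lt hy)
      rw [this.deriv_eq]; simp
  obtain ⟨b, hb⟩ := hs.exists_bound_of_continuous hc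
  exact ⟨max b 1, lt_max_of_lt_right one_pos, fun x => (hb x).trans (le_max_left _ _)⟩

/-- The cut-off at scale `R ≥ δ` does not worsen the order `1 / δ` of the derivative. -/
theorem exists_deriv_oddStep_sq_le :
    ∃ B : ℝ, 0 < B ∧ ∀ δ R x : ℝ, 0 < δ → δ ≤ R → deriv (oddStep δ R) x ^ 2 ≤ B / δ ^ 2 := by
  obtain ⟨b, hb0, hb⟩ := exists_deriv_smoothTransition_bound
  refine ⟨(4 * b) ^ 2, by positivity, fun δ R x hδ hR => ?_⟩
  have hR0 : 0 < R := hδ.trans_le hR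
  have hT : ∀ y, HasDerivAt Real.smoothTransition (deriv Real.smoothTransition y) y := fun y =>
    ((Real.smoothTransition.contDiff (n := ⊤)).differentiable (by simp) y).hasDerivAt
  have h1 := (hT (x / δ)).comp x ((hasDerivAt_id x).div_const δ)
  have h2 := (hT (-x / δ)).comp x ((hasDerivAt_neg x).div_const δ)
  have h3 := (hT (2 - x / R)).comp x (((hasDerivAt_id x).div_const R).const_sub 2)
  have h4 := (hT (2 + x / R)).comp x (((hasDerivAt_id x).div_const R).const_add 2)
  have h := ((h1.sub h2).mul (h3.mul h4)).deriv
  have hfun : oddStep δ R = ((Real.smoothTransition ∘ fun x => id x / δ) -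
      Real.smoothTransition ∘ fun x => -x / δ) * ((Real.smoothTransition ∘ fun x => 2 - id x / R) *
      Real.smoothTransition ∘ fun x => 2 + id x / R) := rfl
  have hval : |deriv (oddStep δ R) x| ≤ 4 * b / δ := by
    rw [hfun, h]
    simp only [Pi.sub_apply, Pi.mul_apply, Function.comp_apply, id]
    have hT0 := Real.smoothTransition.nonneg
    have hT1 := Real.smoothTransition.le_one
    have e1 := hb (x / δ)
    have e2 := hb (-x / δ)
    have e3 := hb (2 - x / R)
    have e4 := hb (2 + x / R)
    set p := deriv Real.smoothTransition (x / δ)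
    set q := deriv Real.smoothTransition (-x / δ)
    set r := deriv Real.smoothTransition (2 - x / R)
    set t := deriv Real.smoothTransition (2 + x / R)
    have hbR : b * (1 / R) ≤ b * (1 / δ) := by gcongr
    have hδi : 0 < 1 / δ := by positivity
    have hRi : 0 < 1 / R := by positivity
    have hA : |p * (1 / δ) - q * (-1 / δ)| ≤ 2 * (b * (1 / δ)) := by
      rw [show p * (1 / δ) - q * (-1 / δ) = (p + q) * (1 / δ) by ring, abs_mul, abs_of_pos hδi]
      have := abs_add_le p q
      nlinarith
    have hB : |r * -(1 / R)| ≤ b * (1 / δ) := by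
      rw [abs_mul, abs_neg, abs_of_pos hRi]
      exact (mul_le_mul_of_nonneg_right e3 hRi.le).trans hbR
    have hC : |t * (1 / R)| ≤ b * (1 / δ) := by
      rw [abs_mul, abs_of_pos hRi]
      exact (mul_le_mul_of_nonneg_right e4 hRi.le).trans hbR
    have hu : |Real.smoothTransition (x / δ) - Real.smoothTransition (-x / δ)| ≤ 1 :=
      abs_le.2 ⟨by linarith [hT0 (x / δ), hT1 (-x / δ)], by linarith [hT1 (x / δ), hT0 (-x / δ)]⟩
    have hc : ∀ y, |Real.smoothTransition y| ≤ 1 := fun y => by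
      rw [abs_of_nonneg (hT0 y)]; exact hT1 y
    have hM : 0 ≤ b * (1 / δ) := by positivity
    calc |(p * (1 / δ) - q * (-1 / δ)) * (Real.smoothTransition (2 - x / R) *
              Real.smoothTransition (2 + x / R)) +
            (Real.smoothTransition (x / δ) - Real.smoothTransition (-x / δ)) *
              (r * -(1 / R) * Real.smoothTransition (2 + x / R) +
                Real.smoothTransition (2 - x / R) * (t * (1 / R)))|
        ≤ |p * (1 / δ) - q * (-1 / δ)| * (|Real.smoothTransition (2 - x / R)| *
              |Real.smoothTransition (2 + x / R)|) +
            |Real.smoothTransition (x / δ) - Real.smoothTransition (-x / δ)| *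
              (|r * -(1 / R)| * |Real.smoothTransition (2 + x / R)| +
                |Real.smoothTransition (2 - x / R)| * |t * (1 / R)|) := by
          refine (abs_add_le _ _).trans ?_
          rw [abs_mul, abs_mul, abs_mul (_ - _ : ℝ)]
          gcongr
          refine (abs_add_le _ _).trans ?_
          rw [abs_mul (r * _), abs_mul _ (t * _)]
      _ ≤ 2 * (b * (1 / δ)) * (1 * 1) + 1 * (b * (1 / δ) * 1 + 1 * (b * (1 / δ))) := by
          gcongr <;> apply hc
      _ = 4 * b / δ := by ring
  rw [← sq_abs, ← div_pow]
  gcongr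

/-! ### The model measures and their Poincaré constants -/

theorem symInterval_top : symInterval ⊤ = univ := by
  ext x
  simp [symInterval, ENNReal.top_div_of_ne_top]

theorem symInterval_ofReal {D : ℝ} (hD : 0 ≤ D) :
    symInterval (ENNReal.ofReal D) = Icc (-(D / 2)) (D / 2) := by
  ext x
  have : ENNReal.ofReal D / 2 = ENNReal.ofReal (D / 2) := by
    rw [ENNReal.ofReal_div_of_pos (by norm_num)]; norm_num
  rw [symInterval, mem_ofPred_eq, this, ENNReal.ofReal_le_ofReal_iff (by positivity), abs_le,
    mem_Icc]

theorem isClosed_symInterval (D : ℝ≥0∞) : IsClosed (symInterval D) :=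
  isClosed_le (ENNReal.continuous_ofReal.comp continuous_abs) continuous_const

theorem measurableSet_symInterval (D : ℝ≥0∞) : MeasurableSet (symInterval D) :=
  (isClosed_symInterval D).measurableSet

theorem symInterval_mono_abs {D : ℝ≥0∞} {x y : ℝ} (h : |x| ≤ |y|) (hy : y ∈ symInterval D) :
    x ∈ symInterval D :=
  (ENNReal.ofReal_le_ofReal h).trans hy

theorem ordConnected_symInterval (D : ℝ≥0∞) : (symInterval D).OrdConnected :=
  ⟨fun _ hx _ hy z hz => by
    rcases le_total 0 z with h | h
    · exact symInterval_mono_abs (abs_le_abs_of_nonneg h hz.2) hy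
    · exact symInterval_mono_abs (abs_le_abs_of_nonpos h hz.1) hx⟩

theorem eq_top_or_exists_ofReal {D : ℝ≥0∞} (hD : 0 < D) :
    D = ⊤ ∨ ∃ d : ℝ, 0 < d ∧ D = ENNReal.ofReal d := by
  rcases eq_or_ne D ⊤ with h | h
  · exact Or.inl h
  · exact Or.inr ⟨D.toReal, ENNReal.toReal_pos hD.ne' h, (ENNReal.ofReal_toReal h).symm⟩

theorem integrableOn_exp_symInterval {K : ℝ} {D : ℝ≥0∞} (hD : 0 < D) (hKD : D = ⊤ → 0 < K) :
    IntegrableOn (fun x : ℝ => Real.exp (-K * x ^ 2 / 2)) (symInterval D) := by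
  rcases eq_top_or_exists_ofReal hD with rfl | ⟨d, hd, rfl⟩
  · rw [symInterval_top, integrableOn_univ]
    refine (integrable_exp_neg_mul_sq (half_pos (hKD rfl))).congr
      (Filter.Eventually.of_forall fun x => ?_)
    simp only
    congr 1
    ring
  · rw [symInterval_ofReal hd.le]
    exact Continuous.integrableOn_Icc (by fun_prop)

/-- The normalizing constant of `xi K D`. -/
noncomputable def xiMass (K : ℝ) (D : ℝ≥0∞) : ℝ :=
  ∫ y in symInterval D, Real.exp (-K * y ^ 2 / 2)

theorem symInterval_mem_nhds_zero {D : ℝ≥0∞} (hD : 0 < D) : symInterval D ∈ nhds 0 := by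
  rcases eq_top_or_exists_ofReal hD with rfl | ⟨d, hd, rfl⟩
  · rw [symInterval_top]; exact Filter.univ_mem
  · rw [symInterval_ofReal hd.le]
    exact Icc_mem_nhds (by linarith) (by linarith)

theorem xiMass_pos {K : ℝ} {D : ℝ≥0∞} (hD : 0 < D) (hKD : D = ⊤ → 0 < K) : 0 < xiMass K D := by
  unfold xiMass
  rw [setIntegral_pos_iff_support_of_nonneg_ae
    (Filter.Eventually.of_forall fun x => (Real.exp_pos _).le) (integrableOn_exp_symInterval hD hKD)]
  have : Function.support (fun y : ℝ => Real.exp (-K * y ^ 2 / 2)) = univ := by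
    ext x; simp
  rw [this, univ_inter]
  exact Measure.measure_pos_of_mem_nhds volume (symInterval_mem_nhds_zero hD)

theorem measurable_xiDensity (K : ℝ) (D : ℝ≥0∞) : Measurable (xiDensity K D) :=
  Measurable.indicator (by fun_prop) (measurableSet_symInterval D)

theorem xiDensity_of_mem {K : ℝ} {D : ℝ≥0∞} {x : ℝ} (hx : x ∈ symInterval D) :
    xiDensity K D x = ENNReal.ofReal (Real.exp (-K * x ^ 2 / 2) / xiMass K D) := by
  simp only [xiDensity, indicator_of_mem hx, xiMass]

theorem xiDensity_of_notMem {K : ℝ} {D : ℝ≥0∞} {x : ℝ} (hx : x ∉ symInterval D) :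
    xiDensity K D x = 0 := by
  simp only [xiDensity, indicator_of_notMem hx]

theorem xiDensity_neg (K : ℝ) (D : ℝ≥0∞) (x : ℝ) : xiDensity K D (-x) = xiDensity K D x := by
  by_cases h : x ∈ symInterval D
  · rw [xiDensity_of_mem h, xiDensity_of_mem (symInterval_mono_abs (by simp) h), neg_sq]
  · rw [xiDensity_of_notMem h, xiDensity_of_notMem fun h' => h (symInterval_mono_abs (by simp) h')]

theorem xi_univ {K : ℝ} {D : ℝ≥0∞} (hD : 0 < D) (hKD : D = ⊤ → 0 < K) : xi K D univ = 1 := by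
  have hZ := xiMass_pos hD hKD
  rw [xi, withDensity_apply _ MeasurableSet.univ, Measure.restrict_univ]
  simp only [xiDensity]
  change ∫⁻ x, (symInterval D).indicator
    (fun x => ENNReal.ofReal (Real.exp (-K * x ^ 2 / 2) / xiMass K D)) x = 1
  rw [lintegral_indicator (measurableSet_symInterval D), ← ofReal_integral_eq_lintegral_ofReal
    ((integrableOn_exp_symInterval hD hKD).div_const _)
    (Filter.Eventually.of_forall fun x => div_nonneg (Real.exp_pos _).le hZ.le), integral_div]
  change ENNReal.ofReal (xiMass K D / xiMass K D) = 1
  rw [div_self hZ.ne', ENNReal.ofReal_one]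

theorem integral_xi {K : ℝ} {D : ℝ≥0∞} (hZ : 0 ≤ xiMass K D) (F : ℝ → ℝ) :
    ∫ x, F x ∂(xi K D) = (∫ x in symInterval D, F x * Real.exp (-K * x ^ 2 / 2)) / xiMass K D := by
  rw [xi, integral_withDensity_eq_integral_toReal_smul (measurable_xiDensity K D)
    (Filter.Eventually.of_forall fun x => by
      by_cases h : x ∈ symInterval D
      · rw [xiDensity_of_mem h]; exact ENNReal.ofReal_lt_top
      · rw [xiDensity_of_notMem h]; exact ENNReal.zero_lt_top),
    ← integral_indicator (measurableSet_symInterval D), ← integral_div]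
  refine integral_congr_ae (Filter.Eventually.of_forall fun x => ?_)
  by_cases h : x ∈ symInterval D
  · simp only [xiDensity_of_mem h, indicator_of_mem h, smul_eq_mul,
      ENNReal.toReal_ofReal (div_nonneg (Real.exp_pos _).le hZ)]
    ring
  · simp only [xiDensity_of_notMem h, indicator_of_notMem h]
    simp

theorem interior_symInterval_nonempty {D : ℝ≥0∞} (hD : 0 < D) :
    (interior (symInterval D)).Nonempty :=
  ⟨0, mem_interior_iff_mem_nhds.2 (symInterval_mem_nhds_zero hD)⟩

theorem support_xi {K : ℝ} {D : ℝ≥0∞} (hD : 0 < D) (hKD : D = ⊤ → 0 < K) :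
    (xi K D).support = symInterval D := by
  have hZ := xiMass_pos hD hKD
  have hset : {x | xiDensity K D x ≠ 0} = symInterval D := by
    ext x
    by_cases h : x ∈ symInterval D
    · simp only [mem_ofPred_eq, xiDensity_of_mem h, h, iff_true]
      exact (ENNReal.ofReal_pos.2 (by positivity)).ne'
    · simp [xiDensity_of_notMem h, h]
  have hzero : ∀ U : Set ℝ, xi K D U = 0 ↔ volume (symInterval D ∩ U) = 0 := fun U => by
    rw [xi, withDensity_apply_eq_zero (measurable_xiDensity K D), hset]
  apply subset_antisymm
  · refine Measure.support_subset_of_isClosed (isClosed_symInterval D) ?_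
    rw [mem_ae_iff, hzero, inter_compl_self, measure_empty]
  · have h1 : interior (symInterval D) ⊆ (xi K D).support := fun x hx => by
      rw [Measure.mem_support_iff_forall]
      intro U hU
      rw [pos_iff_ne_zero, Ne, hzero]
      exact (Measure.measure_pos_of_mem_nhds volume
        (Filter.inter_mem (mem_interior_iff_mem_nhds.1 hx) hU)).ne'
    have hconv : Convex ℝ (symInterval D) := (ordConnected_symInterval D).convex
    have h2 := hconv.closure_interior_eq_closure_of_nonempty_interior
      (interior_symInterval_nonempty hD)
    rw [(isClosed_symInterval D).closure_eq] at h2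
    rw [← h2]
    exact closure_minimal h1 Measure.isClosed_support

theorem isCDD_xi {K : ℝ} {D : ℝ≥0∞} (hD : 0 < D) (hKD : D = ⊤ → 0 < K) : IsCDD K D (xi K D) := by
  have hZ := xiMass_pos hD hKD
  have hsupp := support_xi hD hKD
  refine ⟨⟨by rw [xi_univ hD hKD]; exact ENNReal.one_lt_top⟩, ?_, ?_, ?_⟩
  · rw [hsupp]; exact ordConnected_symInterval D
  · rw [hsupp]
    rcases eq_top_or_exists_ofReal hD with rfl | ⟨d, hd, rfl⟩
    · exact le_top
    · rw [symInterval_ofReal hd.le, Real.ediam_Icc]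
      exact ENNReal.ofReal_le_ofReal (by linarith)
  · rw [hsupp]
    have hcont : ContDiff ℝ ∞ fun x : ℝ => Real.exp (-K * x ^ 2 / 2) / xiMass K D := by fun_prop
    refine ⟨(symInterval D).indicator fun x => Real.exp (-K * x ^ 2 / 2) / xiMass K D,
      hcont.continuous.measurable.indicator (measurableSet_symInterval D), ?_, ?_, ?_⟩
    · rw [xi]
      congr 1
      funext x
      by_cases h : x ∈ symInterval D
      · rw [xiDensity_of_mem h, indicator_of_mem h]
      · rw [xiDensity_of_notMem h, indicator_of_notMem h, ENNReal.ofReal_zero]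
    · exact hcont.contDiffOn.congr fun x hx => indicator_of_mem (interior_subset hx) _
    · intro x hx
      refine ⟨by rw [indicator_of_mem (interior_subset hx)]; positivity, ?_⟩
      have h1 : (fun y => Real.log ((symInterval D).indicator
          (fun x => Real.exp (-K * x ^ 2 / 2) / xiMass K D) y)) =ᶠ[nhds x]
          fun y => -K * y ^ 2 / 2 - Real.log (xiMass K D) := by
        filter_upwards [isOpen_interior.mem_nhds hx] with y hy
        rw [indicator_of_mem (interior_subset hy), Real.log_div (Real.exp_pos _).ne' hZ.ne',
          Real.log_exp]
      have h2 : deriv (fun y : ℝ => -K * y ^ 2 / 2 - Real.log (xiMass K D)) = fun y => -K * y := by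
        funext y
        have : HasDerivAt (fun y : ℝ => -K * y ^ 2 / 2 - Real.log (xiMass K D))
            (-K * (2 * y) / 2) y :=
          ((((hasDerivAt_pow 2 y).const_mul (-K)).div_const 2).sub_const _).congr_deriv (by simp)
        rw [this.deriv]; ring
      rw [h1.deriv.deriv_eq, h2, deriv_const_mul_field, deriv_id'']
      simp

theorem IsCDD.mono {K K' : ℝ} {D D' : ℝ≥0∞} {ξ : Measure ℝ} (h : IsCDD K D ξ) (hK : K' ≤ K)
    (hD : D ≤ D') : IsCDD K' D' ξ := by
  obtain ⟨J, h1, h2, h3, h4⟩ := h.density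
  exact ⟨h.finite, h.interval, h.diam_le.trans hD, J, h1, h2, h3,
    fun x hx => ⟨(h4 x hx).1, hK.trans (h4 x hx).2⟩⟩

theorem xi_ne_zero {K : ℝ} {D : ℝ≥0∞} (hD : 0 < D) (hKD : D = ⊤ → 0 < K) : xi K D ≠ 0 := by
  intro h
  have := xi_univ hD hKD
  rw [h] at this
  simp at this

/-- The Poincaré constant of `xi K D` is tested on the odd function `oddStep δ R`. -/
theorem poincareConst_xi_le_of_oddStep {K δ R U l : ℝ} {D : ℝ≥0∞} (hD : 0 < D)
    (hKD : D = ⊤ → 0 < K) (hR : 0 < R)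
    (hU : ∫ x in symInterval D, deriv (oddStep δ R) x ^ 2 * Real.exp (-K * x ^ 2 / 2) ≤ U)
    (hl : l ≤ ∫ x in symInterval D, oddStep δ R x ^ 2 * Real.exp (-K * x ^ 2 / 2)) (hl0 : 0 < l) :
    poincareConst (xi K D) ≤ ENNReal.ofReal (U / l) := by
  have hZ := xiMass_pos hD hKD
  have hmean : ∫ x, oddStep δ R x ∂(xi K D) = 0 := by
    rw [integral_xi hZ.le, ← integral_indicator (measurableSet_symInterval D)]
    set G := (symInterval D).indicator fun x => oddStep δ R x * Real.exp (-K * x ^ 2 / 2) with hG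
    have hodd : ∀ x, G (-x) = -G x := fun x => by
      by_cases h : x ∈ symInterval D
      · rw [hG, indicator_of_mem h, indicator_of_mem (symInterval_mono_abs (by simp) h),
          oddStep_neg, neg_sq, neg_mul]
      · rw [hG, indicator_of_notMem h,
          indicator_of_notMem fun h' => h (symInterval_mono_abs (by simp) h'), neg_zero]
    have h1 := integral_neg_eq_self G volume
    simp only [hodd, integral_neg] at h1
    have : ∫ x, G x = 0 := by linarith
    rw [this, zero_div]
  have hP : oddStep δ R ∈ PoiTest (xi K D) :=
    ⟨contDiff_oddStep δ R, hasCompactSupport_oddStep hR, hmean⟩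
  have h0 : 0 < ∫ x, oddStep δ R x ^ 2 ∂(xi K D) := by
    rw [integral_xi hZ.le (fun x => oddStep δ R x ^ 2)]
    exact div_pos (hl0.trans_le hl) hZ
  refine ((iInf_le _ (oddStep δ R)).trans ((iInf_le _ hP).trans (iInf_le _ h0))).trans ?_
  refine ENNReal.ofReal_le_ofReal ?_
  rw [integral_xi hZ.le (fun x => oddStep δ R x ^ 2),
    integral_xi hZ.le (fun x => deriv (oddStep δ R) x ^ 2), div_div_div_cancel_right₀ hZ.ne']
  have hU0 : 0 ≤ ∫ x in symInterval D,
      deriv (oddStep δ R) x ^ 2 * Real.exp (-K * x ^ 2 / 2) :=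
    integral_nonneg fun x => mul_nonneg (sq_nonneg _) (Real.exp_pos _).le
  have := hU0.trans hU
  gcongr

theorem integrableOn_oddStep_sq_mul_exp {K δ R : ℝ} (hR : 0 < R) (S : Set ℝ) :
    IntegrableOn (fun x => oddStep δ R x ^ 2 * Real.exp (-K * x ^ 2 / 2)) S := by
  refine Integrable.integrableOn (Continuous.integrable_of_hasCompactSupport
    (((contDiff_oddStep δ R).continuous.pow 2).mul (by fun_prop)) ?_)
  refine HasCompactSupport.intro (hasCompactSupport_oddStep hR (δ := δ)) fun x hx => ?_
  rw [image_eq_zero_of_notMem_tsupport hx]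
  simp

theorem setIntegral_le_mul_of_le {S : Set ℝ} (hS : MeasurableSet S) {F : ℝ → ℝ} {p q c : ℝ}
    (hF0 : ∀ x, 0 ≤ F x) (hpq : p ≤ q) (hin : ∀ x ∈ S, x ∈ Icc p q → F x ≤ c)
    (hout : ∀ x ∈ S, x ∉ Icc p q → F x = 0) (hc : 0 ≤ c) : ∫ x in S, F x ≤ (q - p) * c := by
  have h1 : ∫ x, (Icc p q).indicator (fun _ => c) x = (q - p) * c := by
    rw [integral_indicator measurableSet_Icc, setIntegral_const, smul_eq_mul, Measure.real,
      Real.volume_Icc, ENNReal.toReal_ofReal (by linarith)]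
  rw [← integral_indicator hS, ← h1]
  refine integral_mono_of_nonneg (Filter.Eventually.of_forall fun x => indicator_nonneg
    (fun x _ => hF0 x) x) ((integrable_indicator_iff measurableSet_Icc).2 (by simp))
    (Filter.Eventually.of_forall fun x => ?_)
  by_cases h : x ∈ S
  · simp only [indicator_of_mem h]
    by_cases h2 : x ∈ Icc p q
    · rw [indicator_of_mem h2]; exact hin x h h2
    · rw [indicator_of_notMem h2, hout x h h2]
  · simp only [indicator_of_notMem h]
    exact indicator_nonneg (fun _ _ => hc) x

/-- The upper bound on the Poincaré constant in the case of nonnegative curvature: up to the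
length scale `ℓ` the density stays above half its maximum. -/
theorem exists_poincareConst_xi_le_of_nonneg : ∃ C : ℝ, 0 < C ∧ ∀ (K ℓ : ℝ) (D : ℝ≥0∞), 0 ≤ K →
    0 < D → (D = ⊤ → 0 < K) → 0 < ℓ → ENNReal.ofReal ℓ ≤ D / 2 → K * ℓ ^ 2 ≤ 1 →
    poincareConst (xi K D) ≤ ENNReal.ofReal (C * (1 / ℓ ^ 2)) := by
  obtain ⟨B, hB0, hB⟩ := exists_deriv_oddStep_sq_le
  refine ⟨64 * B, by positivity, fun K ℓ D hK hD hKD hℓ hℓD hKℓ => ?_⟩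
  have hS : Icc (ℓ / 2) ℓ ⊆ symInterval D := fun x hx => by
    refine symInterval_mono_abs (y := ℓ) (abs_le_abs_of_nonneg (by linarith [hx.1]) hx.2) ?_
    rw [symInterval, mem_ofPred_eq, abs_of_pos hℓ]
    exact hℓD
  refine (poincareConst_xi_le_of_oddStep (δ := ℓ / 2) (R := ℓ) (U := 16 * B / ℓ) (l := ℓ / 4)
    hD hKD hℓ ?_ ?_ (by positivity)).trans (ENNReal.ofReal_le_ofReal (le_of_eq ?_))
  · refine (setIntegral_le_mul_of_le (measurableSet_symInterval D) (p := -(2 * ℓ)) (q := 2 * ℓ)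
      (c := B / (ℓ / 2) ^ 2) (fun x => mul_nonneg (sq_nonneg _) (Real.exp_pos _).le)
      (by linarith) (fun x _ _ => ?_) (fun x _ hx => ?_) (by positivity)).trans (le_of_eq ?_)
    · have h1 := hB (ℓ / 2) ℓ x (by positivity) (by linarith)
      have h2 : Real.exp (-K * x ^ 2 / 2) ≤ 1 := Real.exp_le_one_iff.2 (by nlinarith [sq_nonneg x])
      have := sq_nonneg (deriv (oddStep (ℓ / 2) ℓ) x)
      nlinarith
    · rw [deriv_oddStep_eq_zero_of_lt hℓ]
      · ring
      · by_contra h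
        exact hx (abs_le.1 (not_lt.1 h))
    · field_simp; ring
  · calc ℓ / 4 = ∫ x in Icc (ℓ / 2) ℓ, (1 / 2 : ℝ) := by
          rw [setIntegral_const, smul_eq_mul, Measure.real, Real.volume_Icc,
            ENNReal.toReal_ofReal (by linarith)]; ring
      _ ≤ ∫ x in Icc (ℓ / 2) ℓ, oddStep (ℓ / 2) ℓ x ^ 2 * Real.exp (-K * x ^ 2 / 2) := by
          refine setIntegral_mono_on (by simp) (integrableOn_oddStep_sq_mul_exp hℓ _)
            measurableSet_Icc fun x hx => ?_
          rw [oddStep_eq_one (by positivity) hℓ hx.1 hx.2, one_pow, one_mul]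
          have h2 : x ^ 2 ≤ ℓ ^ 2 := by have := hx.1; have := hx.2; gcongr; linarith
          have := Real.add_one_le_exp (-K * x ^ 2 / 2)
          nlinarith
      _ ≤ _ := setIntegral_mono_set (integrableOn_oddStep_sq_mul_exp hℓ _)
          (Filter.Eventually.of_forall fun x => mul_nonneg (sq_nonneg _) (Real.exp_pos _).le)
          hS.eventuallyLE
  · field_simp; ring

theorem integral_exp_sq_symm (k L : ℝ) :
    ∫ x in (-L)..L, Real.exp (k * x ^ 2 / 2) = 2 * ∫ x in 0..L, Real.exp (k * x ^ 2 / 2) := by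
  have hI : ∀ p q, IntervalIntegrable (fun x : ℝ => Real.exp (k * x ^ 2 / 2)) volume p q :=
    fun p q => Continuous.intervalIntegrable (by fun_prop) p q
  have e1 := intervalIntegral.integral_add_adjacent_intervals (hI (-L) 0) (hI 0 L)
  have e2 := intervalIntegral.integral_comp_neg (a := 0) (b := L)
    (fun x : ℝ => Real.exp (k * x ^ 2 / 2))
  simp only [neg_sq, neg_zero] at e2
  linarith

theorem xiMass_neg_eq {k D : ℝ} (hD : 0 < D) : xiMass (-k) (ENNReal.ofReal D) =
    ∫ x in (-(D / 2))..(D / 2), Real.exp (k * x ^ 2 / 2) := by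
  rw [xiMass, symInterval_ofReal hD.le, integral_Icc_eq_integral_Ioc,
    ← intervalIntegral.integral_of_le (by linarith)]
  simp only [neg_neg]

/-- The upper bound on the Poincaré constant in the case of negative curvature: the derivative of
the test function is concentrated near `0`, where the density is smallest. -/
theorem exists_poincareConst_xi_le_of_neg : ∃ C : ℝ, 0 < C ∧ ∀ k D δ : ℝ, 0 < k → 0 < D →
    0 < δ → k * δ ^ 2 ≤ 1 → δ ≤ D / 4 →
    poincareConst (xi (-k) (ENNReal.ofReal D)) ≤
      ENNReal.ofReal (C * (1 / δ) / xiMass (-k) (ENNReal.ofReal D)) := by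
  obtain ⟨B, hB0, hB⟩ := exists_deriv_oddStep_sq_le
  refine ⟨16 * B, by positivity, fun k D δ hk hD hδ hkδ hδD => ?_⟩
  have hD' : 0 < ENNReal.ofReal D := ENNReal.ofReal_pos.2 hD
  have hKD : ENNReal.ofReal D = ⊤ → 0 < -k := fun h => absurd h ENNReal.ofReal_ne_top
  have hZ := xiMass_pos hD' hKD
  have hc : Continuous fun x : ℝ => Real.exp (k * x ^ 2 / 2) := by fun_prop
  have hS : Icc δ (D / 2) ⊆ symInterval (ENNReal.ofReal D) := by
    rw [symInterval_ofReal hD.le]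
    exact Icc_subset_Icc (by linarith) le_rfl
  refine (poincareConst_xi_le_of_oddStep (δ := δ) (R := D) (U := 4 * B * (1 / δ))
    (l := xiMass (-k) (ENNReal.ofReal D) / 4) hD' hKD hD ?_ ?_ (by positivity)).trans
    (ENNReal.ofReal_le_ofReal (le_of_eq ?_))
  · refine (setIntegral_le_mul_of_le (measurableSet_symInterval _) (p := -δ) (q := δ)
      (c := B / δ ^ 2 * 2) (fun x => mul_nonneg (sq_nonneg _) (Real.exp_pos _).le)
      (by linarith) (fun x _ hx => ?_) (fun x hxS hx => ?_) (by positivity)).trans (le_of_eq ?_)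
    · have h1 := hB δ D x hδ (by linarith)
      have h3 : x ^ 2 ≤ δ ^ 2 := sq_le_sq' hx.1 hx.2
      have h2 : Real.exp (- -k * x ^ 2 / 2) ≤ 2 := by
        have h4 : - -k * x ^ 2 / 2 ≤ 1 / 2 := by nlinarith
        refine (Real.exp_le_exp.2 h4).trans ?_
        have h5 : Real.exp (1 / 2) ^ 2 = Real.exp 1 := by rw [← Real.exp_nat_mul]; norm_num
        have := Real.exp_one_lt_d9
        nlinarith [Real.exp_pos (1 / 2)]
      gcongr
    · rw [deriv_oddStep_eq_zero hδ hD]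
      · ring
      · by_contra h
        exact hx (abs_le.1 (not_lt.1 h))
      · rw [symInterval_ofReal hD.le] at hxS
        have := abs_le.2 hxS
        linarith
    · field_simp; ring
  · have hQ : ∫ x in Icc δ (D / 2), Real.exp (k * x ^ 2 / 2) ≤ ∫ x in
        symInterval (ENNReal.ofReal D), oddStep δ D x ^ 2 * Real.exp (- -k * x ^ 2 / 2) := by
      refine le_trans (le_of_eq ?_) (setIntegral_mono_set (integrableOn_oddStep_sq_mul_exp hD _)
          (Filter.Eventually.of_forall fun x => mul_nonneg (sq_nonneg _) (Real.exp_pos _).le)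
          hS.eventuallyLE)
      refine setIntegral_congr_fun measurableSet_Icc fun x hx => ?_
      simp only [oddStep_eq_one hδ hD hx.1 (by linarith [hx.2] : x ≤ D), one_pow, one_mul, neg_neg]
    refine le_trans ?_ hQ
    rw [xiMass_neg_eq hD, integral_exp_sq_symm, integral_Icc_eq_integral_Ioc,
      ← intervalIntegral.integral_of_le (by linarith)]
    have hI : ∀ p q, IntervalIntegrable (fun x : ℝ => Real.exp (k * x ^ 2 / 2)) volume p q :=
      fun p q => hc.intervalIntegrable p q
    have e2 := intervalIntegral.integral_add_adjacent_intervals (hI 0 δ) (hI δ (D / 2))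
    -- the density increases on the positive half-line
    have e4 : ∫ x in 0..δ, Real.exp (k * x ^ 2 / 2) ≤ δ * Real.exp (k * δ ^ 2 / 2) := by
      have := intervalIntegral.integral_mono_on hδ.le (hI 0 δ) (intervalIntegrable_const
        (c := Real.exp (k * δ ^ 2 / 2))) fun x hx => by
          have := hx.1; have := hx.2
          gcongr
      simpa using this
    have e5 : (D / 2 - δ) * Real.exp (k * δ ^ 2 / 2) ≤
        ∫ x in δ..(D / 2), Real.exp (k * x ^ 2 / 2) := by
      have := intervalIntegral.integral_mono_on (by linarith : δ ≤ D / 2)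
        (intervalIntegrable_const (c := Real.exp (k * δ ^ 2 / 2))) (hI δ (D / 2)) fun x hx => by
          have := hx.1; have := hx.2
          gcongr
      simpa using this
    have e6 : δ * Real.exp (k * δ ^ 2 / 2) ≤ (D / 2 - δ) * Real.exp (k * δ ^ 2 / 2) := by
      gcongr; linarith
    linarith
  · field_simp; ring

/-! ### The Cheeger constant of the model measures -/

theorem uIcc_inter_frontier_nonempty {A : Set ℝ} {x y : ℝ} (hx : x ∈ A) (hy : y ∉ A) :
    (uIcc x y ∩ frontier A).Nonempty := by
  rw [frontier_eq_closure_inter_closure]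
  refine isPreconnected_closed_iff.1 isPreconnected_uIcc _ _ isClosed_closure isClosed_closure
    (fun z _ => ?_) ⟨x, left_mem_uIcc, subset_closure hx⟩ ⟨y, right_mem_uIcc, subset_closure hy⟩
  by_cases h : z ∈ A
  · exact Or.inl (subset_closure h)
  · exact Or.inr (subset_closure h)

theorem xi_absolutelyContinuous (K : ℝ) (D : ℝ≥0∞) : xi K D ≪ volume :=
  withDensity_absolutelyContinuous _ _

theorem xi_preimage_neg (K : ℝ) (D : ℝ≥0∞) {A : Set ℝ} (hA : MeasurableSet A) :
    xi K D (Neg.neg ⁻¹' A) = xi K D A := by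
  rw [xi, withDensity_apply _ hA, withDensity_apply _ (measurable_neg hA),
    ← lintegral_indicator hA, ← lintegral_indicator (measurable_neg hA),
    ← lintegral_neg_eq_self]
  refine lintegral_congr fun x => ?_
  by_cases h : x ∈ A
  · rw [indicator_of_mem (show -x ∈ Neg.neg ⁻¹' A by simpa using h), indicator_of_mem h,
      xiDensity_neg]
  · rw [indicator_of_notMem (show -x ∉ Neg.neg ⁻¹' A by simpa using h), indicator_of_notMem h]

/-- A lower bound for the Cheeger constant from the comparison of the tails with the density: the
boundary points of `A` which are closest to `0` on both sides cut off two half-lines which contain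
`A` or its complement. -/
theorem le_cheegerConst_of_tail_le {K : ℝ} {D : ℝ≥0∞} (huniv : xi K D univ = 1)
    (hT : ∀ x, 0 ≤ x → xi K D (Ici x) * xiDensity K D 0 ≤ xiDensity K D x) :
    xiDensity K D 0 ≤ cheegerConst (xiDensity K D) := by
  have hT' : ∀ x, x ≤ 0 → xi K D (Iic x) * xiDensity K D 0 ≤ xiDensity K D x := fun x hx => by
    have h := hT (-x) (by linarith)
    rwa [xiDensity_neg, ← xi_preimage_neg K D measurableSet_Ici,
      show Neg.neg ⁻¹' Ici (-x) = Iic x by ext y; simp] at h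
  refine le_iInf fun A => le_iInf fun hA => le_iInf fun h0 => le_iInf fun h2 => ?_
  change 0 < xi K D A at h0
  change xi K D A ≤ 1 / 2 at h2
  change _ ≤ _ / xi K D A
  have hA1 : xi K D A ≤ 1 := huniv ▸ measure_mono (subset_univ A)
  rw [ENNReal.le_div_iff_mul_le (Or.inl h0.ne') (Or.inl (hA1.trans_lt ENNReal.one_lt_top).ne)]
  set J := xiDensity K D with hJ
  have hmem : ∀ a : frontier A, J a ≤ surfaceMeasure J A := fun a =>
    ENNReal.le_tsum (f := fun x : frontier A => J x) a
  by_cases hz : (0 : ℝ) ∈ frontier A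
  · calc J 0 * xi K D A ≤ J 0 * 1 := by gcongr
      _ = J 0 := mul_one _
      _ ≤ _ := hmem ⟨0, hz⟩
  set Lf : Set ℝ := {x | ∃ y ∈ frontier A, x ≤ y ∧ y ≤ 0} with hLf
  set Rt : Set ℝ := {x | ∃ y ∈ frontier A, y ≤ x ∧ 0 ≤ y} with hRt
  have hsame : ∀ x, x ∉ Lf ∪ Rt → (x ∈ A ↔ (0 : ℝ) ∈ A) := fun x hx => by
    by_contra hne
    have hfr : (uIcc x 0 ∩ frontier A).Nonempty := by
      by_cases h : x ∈ A
      · have h0' : (0 : ℝ) ∉ A := fun h' => hne (by simp [h, h'])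
        exact uIcc_inter_frontier_nonempty h h0'
      · have h0' : (0 : ℝ) ∈ A := by
          by_contra h'
          exact hne (by simp [h, h'])
        rw [uIcc_comm]
        exact uIcc_inter_frontier_nonempty h0' h
    obtain ⟨y, hy, hyA⟩ := hfr
    apply hx
    rcases mem_uIcc.1 hy with h | h
    · exact Or.inl ⟨y, hyA, h.1, h.2⟩
    · exact Or.inr ⟨y, hyA, h.2, h.1⟩
  have hcover : xi K D A ≤ xi K D Lf + xi K D Rt := by
    refine le_trans ?_ (measure_union_le Lf Rt)
    by_cases h : (0 : ℝ) ∈ A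
    · have hsub : Aᶜ ⊆ Lf ∪ Rt := fun x hx => by
        by_contra hx'
        exact hx ((hsame x hx').2 h)
      refine le_trans ?_ (measure_mono hsub)
      have hadd : (1 : ℝ≥0∞) ≤ xi K D A + xi K D Aᶜ := by
        rw [← huniv, ← union_compl_self A]; exact measure_union_le _ _
      by_contra hlt
      push Not at hlt
      have h3 : xi K D A + xi K D Aᶜ < 1 / 2 + 1 / 2 :=
        ENNReal.add_lt_add_of_le_of_lt (hA1.trans_lt ENNReal.one_lt_top).ne h2 (hlt.trans_le h2)
      rw [ENNReal.add_halves] at h3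
      exact absurd hadd (not_le.2 h3)
    · refine measure_mono fun x hx => ?_
      by_contra hx'
      exact h ((hsame x hx').1 hx)
  have hL : xi K D Lf = 0 ∨ ∃ a : frontier A, (a : ℝ) < 0 ∧ xi K D Lf * J 0 ≤ J a := by
    rcases (frontier A ∩ Iic 0).eq_empty_or_nonempty with h | h
    · left
      have : Lf = ∅ := by
        ext x
        simp only [mem_empty_iff_false, iff_false]
        rintro ⟨y, hy, _, hy0⟩
        exact (h ▸ (⟨hy, hy0⟩ : y ∈ frontier A ∩ Iic 0) : y ∈ (∅ : Set ℝ))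
      rw [this, measure_empty]
    · right
      have hbdd : BddAbove (frontier A ∩ Iic 0) := ⟨0, fun y hy => hy.2⟩
      have ha := (isClosed_frontier.inter isClosed_Iic).csSup_mem h hbdd
      refine ⟨⟨_, ha.1⟩, lt_of_le_of_ne ha.2 fun h' => hz (h' ▸ ha.1), ?_⟩
      refine le_trans ?_ (hT' _ ha.2)
      gcongr
      rintro x ⟨y, hy, hxy, hy0⟩
      exact hxy.trans (le_csSup hbdd ⟨hy, hy0⟩)
  have hR : xi K D Rt = 0 ∨ ∃ a : frontier A, 0 < (a : ℝ) ∧ xi K D Rt * J 0 ≤ J a := by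
    rcases (frontier A ∩ Ici 0).eq_empty_or_nonempty with h | h
    · left
      have : Rt = ∅ := by
        ext x
        simp only [mem_empty_iff_false, iff_false]
        rintro ⟨y, hy, _, hy0⟩
        exact (h ▸ (⟨hy, hy0⟩ : y ∈ frontier A ∩ Ici 0) : y ∈ (∅ : Set ℝ))
      rw [this, measure_empty]
    · right
      have hbdd : BddBelow (frontier A ∩ Ici 0) := ⟨0, fun y hy => hy.2⟩
      have ha := (isClosed_frontier.inter isClosed_Ici).csInf_mem h hbdd
      refine ⟨⟨_, ha.1⟩, lt_of_le_of_ne ha.2 fun h' => hz (h' ▸ ha.1), ?_⟩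
      refine le_trans ?_ (hT _ ha.2)
      gcongr
      rintro x ⟨y, hy, hxy, hy0⟩
      exact (csInf_le hbdd ⟨hy, hy0⟩).trans hxy
  calc J 0 * xi K D A ≤ J 0 * (xi K D Lf + xi K D Rt) := by gcongr
    _ = xi K D Lf * J 0 + xi K D Rt * J 0 := by ring
    _ ≤ surfaceMeasure J A := by
      rcases hL with hL | ⟨a, ha, hL⟩ <;> rcases hR with hR | ⟨b, hb, hR⟩
      · simp [hL, hR]
      · rw [hL, zero_mul, zero_add]; exact hR.trans (hmem b)
      · rw [hR, zero_mul, add_zero]; exact hL.trans (hmem a)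
      · have hab : a ≠ b := fun h => by rw [h] at ha; exact lt_asymm ha hb
        classical
        have := ENNReal.sum_le_tsum (f := fun x : frontier A => J x) {a, b}
        rw [Finset.sum_pair hab] at this
        exact (add_le_add hL hR).trans this

theorem xi_Ioi_zero {K : ℝ} {D : ℝ≥0∞} (huniv : xi K D univ = 1) : xi K D (Ioi 0) = 1 / 2 := by
  have h0 : xi K D {0} = 0 := xi_absolutelyContinuous K D (by simp)
  have h1 : xi K D (Iio 0) = xi K D (Ioi 0) := by
    rw [← xi_preimage_neg K D measurableSet_Ioi]
    congr 1
    ext x; simp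
  have h2 : xi K D (Ioi 0) + xi K D (Ioi 0) = 1 := by
    apply le_antisymm
    · rw [← huniv]
      nth_rw 1 [← h1]
      rw [← measure_union (by
        rw [Set.disjoint_left]; intro x hx hx'; exact lt_asymm (mem_Iio.1 hx) (mem_Ioi.1 hx'))
        measurableSet_Ioi]
      exact measure_mono (subset_univ _)
    · rw [← huniv, show (univ : Set ℝ) = (Iio 0 ∪ Ioi 0) ∪ {0} by
        ext x; simp only [mem_univ, mem_union, mem_Iio, mem_Ioi, mem_singleton_iff, true_iff]
        rcases lt_trichotomy x 0 with h | h | h <;> simp [h]]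
      refine (measure_union_le _ _).trans ?_
      rw [h0, add_zero]
      refine (measure_union_le _ _).trans ?_
      rw [h1]
  rw [← h2, ENNReal.div_eq_inv_mul, ← two_mul, ← mul_assoc,
    ENNReal.inv_mul_cancel (by norm_num) (by norm_num), one_mul]

/-- The half-line `(0, ∞)` bounds the Cheeger constant from above. -/
theorem cheegerConst_le {K : ℝ} {D : ℝ≥0∞} (huniv : xi K D univ = 1) :
    cheegerConst (xiDensity K D) ≤ 2 * xiDensity K D 0 := by
  have hhalf := xi_Ioi_zero huniv
  have hsm : IsSmoothOpen (Ioi 0) := by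
    refine ⟨isOpen_Ioi, fun x hx => ⟨1, one_pos, Or.inr ?_⟩⟩
    rw [frontier_Ioi, mem_singleton_iff] at hx
    subst hx
    ext y
    simp only [mem_inter_iff, mem_Ioi, mem_Ioo]
    constructor
    · rintro ⟨h1, _, h2⟩; exact ⟨h1, h2⟩
    · rintro ⟨h1, h2⟩; exact ⟨h1, by linarith, h2⟩
  have hle : cheegerConst (xiDensity K D) ≤ surfaceMeasure (xiDensity K D) (Ioi 0) /
      xi K D (Ioi 0) :=
    (iInf_le _ (Ioi 0)).trans ((iInf_le _ hsm).trans ((iInf_le _ (by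
      change 0 < xi K D (Ioi 0)
      rw [hhalf]; norm_num)).trans (iInf_le _ hhalf.le)))
  refine hle.trans (le_of_eq ?_)
  rw [hhalf, surfaceMeasure, frontier_Ioi, tsum_singleton 0 (xiDensity K D),
    ENNReal.div_eq_inv_mul]
  simp

theorem xi_Ici_mul_le {K : ℝ} {D : ℝ≥0∞} (hD : 0 < D) (hKD : D = ⊤ → 0 < K) {x : ℝ}
    (hx : 0 ≤ x) : xi K D (Ici x) * xiDensity K D 0 ≤ xiDensity K D x := by
  have hZ := xiMass_pos hD hKD
  have huniv := xi_univ hD hKD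
  have h0S : (0 : ℝ) ∈ symInterval D := mem_of_mem_nhds (symInterval_mem_nhds_zero hD)
  by_cases hxS : x ∈ symInterval D
  swap
  · have : xi K D (Ici x) = 0 := by
      rw [xi, withDensity_apply _ measurableSet_Ici]
      refine setLIntegral_eq_zero measurableSet_Ici fun y hy => ?_
      exact xiDensity_of_notMem fun h => hxS (symInterval_mono_abs (abs_le_abs_of_nonneg hx hy) h)
    rw [this, zero_mul]; exact zero_le
  rcases lt_or_ge K 0 with hK | hK
  · calc xi K D (Ici x) * xiDensity K D 0 ≤ 1 * xiDensity K D 0 := by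
          gcongr
          exact huniv ▸ measure_mono (subset_univ _)
      _ = xiDensity K D 0 := one_mul _
      _ ≤ xiDensity K D x := by
          rw [xiDensity_of_mem h0S, xiDensity_of_mem hxS]
          apply ENNReal.ofReal_le_ofReal
          gcongr
          nlinarith [sq_nonneg x]
  · have hmain : xi K D (Ici x) ≤ ENNReal.ofReal (Real.exp (-K * x ^ 2 / 2)) := by
      calc xi K D (Ici x) = ∫⁻ u, (Ici x).indicator (xiDensity K D) u := by
            rw [xi, withDensity_apply _ measurableSet_Ici, lintegral_indicator measurableSet_Ici]
        _ = ∫⁻ u, (Ici x).indicator (xiDensity K D) (u + x) :=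
            (lintegral_add_right_eq_self _ x).symm
        _ ≤ ∫⁻ u, ENNReal.ofReal (Real.exp (-K * x ^ 2 / 2)) * xiDensity K D u := by
            refine lintegral_mono fun u => ?_
            by_cases hu : 0 ≤ u
            · rw [indicator_of_mem (by simpa using hu)]
              by_cases hux : u + x ∈ symInterval D
              · rw [xiDensity_of_mem hux, xiDensity_of_mem (symInterval_mono_abs
                  (abs_le_abs_of_nonneg hu (by linarith)) hux),
                  ← ENNReal.ofReal_mul (Real.exp_pos _).le]
                apply ENNReal.ofReal_le_ofReal
                rw [← mul_div_assoc, ← Real.exp_add]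
                gcongr
                nlinarith [mul_nonneg hK (mul_nonneg hu hx)]
              · rw [xiDensity_of_notMem hux]; exact zero_le
            · rw [indicator_of_notMem (by simpa using hu)]; exact zero_le
        _ = ENNReal.ofReal (Real.exp (-K * x ^ 2 / 2)) := by
            rw [lintegral_const_mul _ (measurable_xiDensity K D)]
            have : ∫⁻ u, xiDensity K D u = 1 := by
              rw [← huniv, xi, withDensity_apply _ MeasurableSet.univ, Measure.restrict_univ]
            rw [this, mul_one]
    calc xi K D (Ici x) * xiDensity K D 0
        ≤ ENNReal.ofReal (Real.exp (-K * x ^ 2 / 2)) * xiDensity K D 0 := by gcongr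
      _ = xiDensity K D x := by
          rw [xiDensity_of_mem h0S, xiDensity_of_mem hxS, ← ENNReal.ofReal_mul (Real.exp_pos _).le]
          congr 1
          simp [div_eq_mul_inv]

/-- The Cheeger constant of `xi K D` is comparable to the density at the origin. -/
theorem cheegerConst_xi_bounds {K : ℝ} {D : ℝ≥0∞} (hD : 0 < D) (hKD : D = ⊤ → 0 < K) :
    ENNReal.ofReal (1 / xiMass K D) ≤ cheegerConst (xiDensity K D) ∧
      cheegerConst (xiDensity K D) ≤ 2 * ENNReal.ofReal (1 / xiMass K D) := by
  have h0 : xiDensity K D 0 = ENNReal.ofReal (1 / xiMass K D) := by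
    rw [xiDensity_of_mem (mem_of_mem_nhds (symInterval_mem_nhds_zero hD))]
    simp
  rw [← h0]
  exact ⟨le_cheegerConst_of_tail_le (xi_univ hD hKD) fun x hx => xi_Ici_mul_le hD hKD hx,
    cheegerConst_le (xi_univ hD hKD)⟩

/-! ### Comparison of the bounds with explicit rates -/

theorem integral_exp_linear {κ : ℝ} (hκ : κ ≠ 0) (c L : ℝ) :
    ∫ x in (0 : ℝ)..L, Real.exp (κ * x + c) =
      (Real.exp (κ * L + c) - Real.exp c) / κ := by
  have h : ∀ x ∈ uIcc 0 L, HasDerivAt (fun x => Real.exp (κ * x + c) / κ)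
      (Real.exp (κ * x + c)) x := fun x _ => by
    have h1 : HasDerivAt (fun x : ℝ => κ * x + c) (κ * 1) x :=
      ((hasDerivAt_id x).const_mul κ).add_const c
    exact (h1.exp.div_const κ).congr_deriv (by field_simp)
  rw [intervalIntegral.integral_eq_sub_of_hasDerivAt h
    (Continuous.intervalIntegrable (by fun_prop) _ _)]
  simp [sub_div]

/-- Comparison of the parabola with its chord on `[0, D / 2]`. -/
theorem integral_exp_sq_le {k D : ℝ} (hk : 0 < k) (hD : 0 < D) :
    ∫ x in (-(D / 2))..(D / 2), Real.exp (k * x ^ 2 / 2) ≤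
      8 * ((Real.exp (k * D ^ 2 / 8) - 1) / (k * D)) := by
  rw [integral_exp_sq_symm]
  have h : ∫ x in 0..(D / 2), Real.exp (k * x ^ 2 / 2) ≤
      ∫ x in 0..(D / 2), Real.exp (k * D / 4 * x + 0) := by
    refine intervalIntegral.integral_mono_on (by positivity)
      (Continuous.intervalIntegrable (by fun_prop) _ _)
      (Continuous.intervalIntegrable (by fun_prop) _ _) fun x hx => ?_
    rw [Real.exp_le_exp]
    nlinarith [mul_nonneg hk.le (mul_nonneg hx.1 (sub_nonneg.2 hx.2))]
  rw [integral_exp_linear (by positivity)] at h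
  have e : k * D / 4 * (D / 2) + 0 = k * D ^ 2 / 8 := by ring
  rw [e, Real.exp_zero] at h
  have : 8 * ((Real.exp (k * D ^ 2 / 8) - 1) / (k * D)) =
      2 * ((Real.exp (k * D ^ 2 / 8) - 1) / (k * D / 4)) := by field_simp; ring
  linarith

/-- Comparison of the parabola with its tangent at `D / 2`. -/
theorem le_integral_exp_sq {k D : ℝ} (hk : 0 < k) (hD : 0 < D) :
    4 * ((Real.exp (k * D ^ 2 / 8) - 1) / (k * D)) ≤
      ∫ x in (-(D / 2))..(D / 2), Real.exp (k * x ^ 2 / 2) := by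
  rw [integral_exp_sq_symm]
  have h : ∫ x in 0..(D / 2), Real.exp (k * D / 2 * x + -(k * D ^ 2 / 8)) ≤
      ∫ x in 0..(D / 2), Real.exp (k * x ^ 2 / 2) := by
    refine intervalIntegral.integral_mono_on (by positivity)
      (Continuous.intervalIntegrable (by fun_prop) _ _)
      (Continuous.intervalIntegrable (by fun_prop) _ _) fun x hx => ?_
    rw [Real.exp_le_exp]
    nlinarith [mul_nonneg hk.le (sq_nonneg (x - D / 2))]
  rw [integral_exp_linear (by positivity)] at h
  have e : k * D / 2 * (D / 2) + -(k * D ^ 2 / 8) = k * D ^ 2 / 8 := by ring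
  rw [e] at h
  have h1 : Real.exp (-(k * D ^ 2 / 8)) ≤ 1 := Real.exp_le_one_iff.2 (by
    have : 0 < k * D ^ 2 / 8 := by positivity
    linarith)
  have h2 : (Real.exp (k * D ^ 2 / 8) - 1) / (k * D / 2) ≤
      (Real.exp (k * D ^ 2 / 8) - Real.exp (-(k * D ^ 2 / 8))) / (k * D / 2) := by gcongr
  have : 4 * ((Real.exp (k * D ^ 2 / 8) - 1) / (k * D)) =
      2 * ((Real.exp (k * D ^ 2 / 8) - 1) / (k * D / 2)) := by field_simp; ring
  linarith

/-- The integral over the interval of the constant term of the tail weight is at most of the order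
of the inverse of the rate. -/
theorem sq_mul_exp_le {k D : ℝ} (hk : 0 < k) (hD : 0 < D) :
    D ^ 2 * Real.exp (3 / 4 * (k * D ^ 2 / 8)) * max (Real.sqrt k) (1 / D) * (k * D) ≤
      128 * (Real.exp (k * D ^ 2 / 8) - 1) := by
  set s := k * D ^ 2 / 8 with hs
  have hs0 : 0 < s := by positivity
  set r := Real.sqrt k * D with hr
  have hr0 : 0 < r := by positivity
  have hr2 : r ^ 2 = 8 * s := by rw [hr, mul_pow, Real.sq_sqrt hk.le, hs]; ring
  have h1 : D ^ 2 * max (Real.sqrt k) (1 / D) * (k * D) = max r 1 * r ^ 2 := by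
    have : max (Real.sqrt k) (1 / D) * D = max r 1 := by
      rw [max_mul_of_nonneg _ _ hD.le, hr, one_div, inv_mul_cancel₀ hD.ne']
    rw [← this, hr2, hs]; ring
  have h2 : Real.exp s - 1 ≥ Real.exp (3 / 4 * s) * (s / 4 + s ^ 2 / 32) := by
    have e1 : Real.exp s = Real.exp (3 / 4 * s) * Real.exp (s / 4) := by
      rw [← Real.exp_add]; congr 1; ring
    have e2 : 1 ≤ Real.exp (3 / 4 * s) := Real.one_le_exp (by positivity)
    have e3 := Real.quadratic_le_exp_of_nonneg (by positivity : 0 ≤ s / 4)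
    rw [e1]
    nlinarith
  have h3 : max r 1 * r ^ 2 ≤ 128 * (s / 4 + s ^ 2 / 32) := by
    have : s = r ^ 2 / 8 := by linarith
    rw [this]
    rcases le_total r 1 with h | h
    · rw [max_eq_right h]; nlinarith [sq_nonneg (r ^ 2)]
    · rw [max_eq_left h]; nlinarith [mul_nonneg (sq_nonneg r) (sq_nonneg (r - 8))]
  have hE := Real.exp_pos (3 / 4 * s)
  calc D ^ 2 * Real.exp (3 / 4 * s) * max (Real.sqrt k) (1 / D) * (k * D)
      = Real.exp (3 / 4 * s) * (D ^ 2 * max (Real.sqrt k) (1 / D) * (k * D)) := by ring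
    _ ≤ Real.exp (3 / 4 * s) * (128 * (s / 4 + s ^ 2 / 32)) := by rw [h1]; gcongr
    _ ≤ _ := by linarith

/-- The rate `max (√k, 1 / D) * k D / (exp (k D ^ 2 / 8) - 1)` for the curvature bound `-k`. -/
noncomputable def negRate (k D : ℝ) : ℝ :=
  max (Real.sqrt k) (1 / D) * (k * D / (Real.exp (k * D ^ 2 / 8) - 1))

theorem exp_mul_sq_div_eight_sub_one_pos {k D : ℝ} (hk : 0 < k) (hD : 0 < D) :
    0 < Real.exp (k * D ^ 2 / 8) - 1 :=
  sub_pos.2 (Real.one_lt_exp_iff.2 (by positivity))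

/-- The integral of the tail weight is at most of the order of the inverse of the rate. -/
theorem entropyConst_mul_negRate_le {k D : ℝ} (hk : 0 < k) (hD : 0 < D) :
    entropyConst (-k) (D / 2) * negRate k D ≤ 2176 := by
  have hX := exp_mul_sq_div_eight_sub_one_pos hk hD
  have hm : 0 < max (Real.sqrt k) (1 / D) := lt_max_of_lt_right (by positivity)
  have hA : entropyConst (-k) (D / 2) = 48 * ((∫ x in (-(D / 2))..(D / 2),
      Real.exp (-(k * x ^ 2 / 2))) * ∫ x in (-(D / 2))..(D / 2), Real.exp (k * x ^ 2 / 2)) +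
      8 * (D ^ 2 * Real.exp (3 / 4 * (k * D ^ 2 / 8))) := by
    rw [entropyConst, if_neg (by linarith)]
    simp only [neg_neg, tailWeight]
    rw [intervalIntegral.integral_add (Continuous.intervalIntegrable (by fun_prop) _ _)
      intervalIntegrable_const, intervalIntegral.integral_const_mul,
      intervalIntegral.integral_mul_const, intervalIntegral.integral_const, smul_eq_mul,
      show k * (D / 2) ^ 2 / 2 = k * D ^ 2 / 8 by ring]
    ring
  have hG : (∫ x in (-(D / 2))..(D / 2), Real.exp (-(k * x ^ 2 / 2))) *
      max (Real.sqrt k) (1 / D) ≤ 3 := by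
    set G := ∫ x in (-(D / 2))..(D / 2), Real.exp (-(k * x ^ 2 / 2)) with hGdef
    have hGD : G ≤ D := by
      have := intervalIntegral.integral_mono_on (by linarith : -(D / 2) ≤ D / 2)
        (Continuous.intervalIntegrable (by fun_prop) _ _)
        (intervalIntegrable_const (c := (1 : ℝ)))
        (f := fun x => Real.exp (-(k * x ^ 2 / 2))) (μ := volume) fun x _ =>
          Real.exp_le_one_iff.2 (by have : 0 ≤ k * x ^ 2 / 2 := by positivity
                                    linarith)
      simpa using this
    have hGk : G ≤ Real.sqrt (2 * Real.pi / k) := by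
      have := intervalIntegral_exp_neg_sq_le hk 0 (by linarith : -(D / 2) ≤ D / 2)
      refine le_trans (le_of_eq ?_) this
      rw [hGdef]
      congr 1
      funext x
      congr 1
      ring
    rcases max_choice (Real.sqrt k) (1 / D) with h | h <;> rw [h]
    · calc G * Real.sqrt k ≤ Real.sqrt (2 * Real.pi / k) * Real.sqrt k := by gcongr
        _ = Real.sqrt (2 * Real.pi) := by
            rw [← Real.sqrt_mul (by positivity), div_mul_cancel₀ _ hk.ne']
        _ ≤ 3 := by
            rw [Real.sqrt_le_left (by norm_num)]
            linarith [Real.pi_lt_d2]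
    · calc G * (1 / D) ≤ D * (1 / D) := by gcongr
        _ ≤ 3 := by rw [mul_one_div_cancel hD.ne']; norm_num
  have hΦ := integral_exp_sq_le hk hD
  have hΦ0 : 0 ≤ ∫ x in (-(D / 2))..(D / 2), Real.exp (k * x ^ 2 / 2) :=
    intervalIntegral.integral_nonneg (by linarith) fun x _ => (Real.exp_pos _).le
  have hS := sq_mul_exp_le hk hD
  rw [hA]
  unfold negRate
  set G := ∫ x in (-(D / 2))..(D / 2), Real.exp (-(k * x ^ 2 / 2))
  set Φ := ∫ x in (-(D / 2))..(D / 2), Real.exp (k * x ^ 2 / 2)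
  set m := max (Real.sqrt k) (1 / D)
  set X := Real.exp (k * D ^ 2 / 8) - 1
  set T := D ^ 2 * Real.exp (3 / 4 * (k * D ^ 2 / 8))
  have h1 : Φ * (k * D / X) ≤ 8 := by
    calc Φ * (k * D / X) ≤ 8 * (X / (k * D)) * (k * D / X) := by gcongr
      _ = 8 := by field_simp
  have h2 : T * m * (k * D) / X ≤ 128 := by rw [div_le_iff₀ hX]; exact hS
  have h3 : (G * m) * (Φ * (k * D / X)) ≤ 3 * 8 := by gcongr
  calc (48 * (G * Φ) + 8 * T) * (m * (k * D / X))
      = 48 * ((G * m) * (Φ * (k * D / X))) + 8 * (T * m * (k * D) / X) := by ring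
    _ ≤ 2176 := by linarith

/-- The lower bound on the logarithmic Sobolev constant under a negative curvature bound. -/
theorem IsCDD.negRate_le_logSobolevConst {ξ : Measure ℝ} {k D : ℝ} (hk : 0 < k) (hD : 0 < D)
    (h : IsCDD (-k) (ENNReal.ofReal D) ξ) (hξ : ξ ≠ 0) :
    ENNReal.ofReal (negRate k D) ≤ ENNReal.ofReal 39168 * logSobolevConst ξ := by
  have h1 := h.le_logSobolevConst (L := D / 2) hξ (by linarith)
    fun _ => ⟨by positivity, by rw [mul_div_cancel₀ _ two_ne_zero]⟩
  have hA : 0 < entropyConst (-k) (D / 2) := entropyConst_pos fun _ => by positivity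
  refine le_trans ?_ (mul_le_mul_right h1 _)
  rw [← ENNReal.ofReal_mul (by norm_num)]
  apply ENNReal.ofReal_le_ofReal
  rw [mul_one_div, le_div_iff₀ (by positivity)]
  have := entropyConst_mul_negRate_le hk hD
  linarith

/-- The order of magnitude of all the functional inequality constants for curvature `K` and
diameter `D`. -/
noncomputable def modelRate (K : ℝ) (D : ℝ≥0∞) : ℝ≥0∞ :=
  if 0 ≤ K then max (ENNReal.ofReal K) (1 / D ^ 2) else ENNReal.ofReal (negRate (-K) D.toReal)

theorem one_div_ofReal_sq {d : ℝ} (hd : 0 < d) :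
    1 / ENNReal.ofReal d ^ 2 = ENNReal.ofReal (1 / d ^ 2) := by
  rw [← ENNReal.ofReal_pow hd.le, ENNReal.ofReal_div_of_pos (by positivity), ENNReal.ofReal_one]

/-- The logarithmic Sobolev constants under a curvature and diameter bound are bounded below by
the model rate. -/
theorem exists_modelRate_le_logSobolevConst : ∃ C : ℝ≥0, ∀ (K : ℝ) (D : ℝ≥0∞) (ξ : Measure ℝ),
    0 < D → (D = ⊤ → 0 < K) → IsCDD K D ξ → ξ ≠ 0 →
    modelRate K D ≤ C * logSobolevConst ξ := by
  refine ⟨39168, fun K D ξ hD hKD h hξ => ?_⟩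
  have hC : ((39168 : ℝ≥0) : ℝ≥0∞) = ENNReal.ofReal 39168 := by norm_num
  rw [hC]
  unfold modelRate
  split_ifs with hK
  · refine max_le ?_ ?_
    · rcases hK.eq_or_lt with rfl | hK
      · simp
      have h1 := h.le_logSobolevConst (L := 0) hξ hK.ne' fun h => absurd h (not_lt.2 hK.le)
      refine le_trans ?_ (mul_le_mul_right h1 _)
      rw [← ENNReal.ofReal_mul (by norm_num)]
      apply ENNReal.ofReal_le_ofReal
      rw [entropyConst, if_pos hK, mul_one_div, le_div_iff₀ (by positivity)]
      have hpi := Real.pi_lt_four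
      field_simp
      linarith
    · rcases eq_top_or_exists_ofReal hD with rfl | ⟨d, hd, rfl⟩
      · simp
      -- nonnegative curvature is in particular bounded below by `-1 / d ^ 2`
      have hk : 0 < 1 / d ^ 2 := by positivity
      have h1 := (h.mono (K' := -(1 / d ^ 2)) (by linarith) le_rfl).negRate_le_logSobolevConst
        hk hd hξ
      refine le_trans ?_ h1
      rw [one_div_ofReal_sq hd]
      apply ENNReal.ofReal_le_ofReal
      have hX := exp_mul_sq_div_eight_sub_one_pos hk hd
      have e1 : 1 / d ^ 2 * d ^ 2 / 8 = 1 / 8 := by field_simp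
      rw [e1] at hX
      unfold negRate
      rw [e1]
      have h2 : Real.exp (1 / 8) - 1 ≤ 1 := by
        have := Real.exp_bound' (x := 1 / 8) (by norm_num) (by norm_num) (n := 1) (by norm_num)
        norm_num at this
        linarith
      have h3 : 1 / d ^ 2 * d ≤ 1 / d ^ 2 * d / (Real.exp (1 / 8) - 1) := by
        rw [le_div_iff₀ hX]
        have : 0 < 1 / d ^ 2 * d := by positivity
        nlinarith
      calc 1 / d ^ 2 = 1 / d * (1 / d ^ 2 * d) := by field_simp
        _ ≤ max (Real.sqrt (1 / d ^ 2)) (1 / d) * (1 / d ^ 2 * d / (Real.exp (1 / 8) - 1)) := by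
            gcongr
            exact le_max_right _ _
  · push Not at hK
    rcases eq_top_or_exists_ofReal hD with rfl | ⟨d, hd, rfl⟩
    · exact absurd (hKD rfl) (not_lt.2 hK.le)
    rw [ENNReal.toReal_ofReal hd.le]
    refine IsCDD.negRate_le_logSobolevConst (by linarith) hd ?_ hξ
    simpa using h

/-- The length scale of `xi K D` for nonnegative curvature, the smaller of `1 / √K` and `D / 2`. -/
theorem exists_scale {K : ℝ} {D : ℝ≥0∞} (hK : 0 ≤ K) (hD : 0 < D) (hKD : D = ⊤ → 0 < K) :
    ∃ ℓ : ℝ, 0 < ℓ ∧ ENNReal.ofReal ℓ ≤ D / 2 ∧ K * ℓ ^ 2 ≤ 1 ∧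
      ENNReal.ofReal (1 / ℓ ^ 2) ≤ 4 * max (ENNReal.ofReal K) (1 / D ^ 2) := by
  have hsq : 0 < K → K * (1 / Real.sqrt K) ^ 2 = 1 := fun hK => by
    rw [div_pow, Real.sq_sqrt hK.le]; field_simp
  have hinv : 0 < K → 1 / (1 / Real.sqrt K) ^ 2 = K := fun hK => by
    rw [div_pow, Real.sq_sqrt hK.le]; field_simp
  rcases eq_top_or_exists_ofReal hD with rfl | ⟨d, hd, rfl⟩
  · have hK := hKD rfl
    refine ⟨1 / Real.sqrt K, by positivity, ?_, (hsq hK).le, ?_⟩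
    · simp [ENNReal.top_div_of_ne_top]
    · rw [hinv hK]
      refine (le_max_left _ _).trans (le_mul_of_one_le_left zero_le (by norm_num))
  · have hdiv : ENNReal.ofReal d / 2 = ENNReal.ofReal (d / 2) := by
      rw [ENNReal.ofReal_div_of_pos (by norm_num)]; norm_num
    have hcase : ENNReal.ofReal (1 / (d / 2) ^ 2) ≤
        4 * max (ENNReal.ofReal K) (1 / ENNReal.ofReal d ^ 2) := by
      rw [one_div_ofReal_sq hd]
      refine le_trans (le_of_eq ?_) (mul_le_mul_right (le_max_right _ _) _)
      rw [show (4 : ℝ≥0∞) = ENNReal.ofReal 4 by norm_num, ← ENNReal.ofReal_mul (by norm_num)]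
      congr 1
      field_simp; norm_num
    rw [hdiv]
    by_cases hc : K * (d / 2) ^ 2 ≤ 1
    · exact ⟨d / 2, by positivity, le_rfl, hc, hcase⟩
    · push Not at hc
      have hK' : 0 < K := by
        rcases hK.eq_or_lt with h | h
        · rw [← h] at hc; norm_num at hc
        · exact h
      refine ⟨1 / Real.sqrt K, by positivity, ENNReal.ofReal_le_ofReal ?_, (hsq hK').le, ?_⟩
      · rw [div_le_iff₀ (Real.sqrt_pos.2 hK')]
        by_contra hlt
        push Not at hlt
        have h0 : 0 ≤ d / 2 * Real.sqrt K := by positivity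
        have : (d / 2 * Real.sqrt K) ^ 2 < 1 := by nlinarith
        rw [mul_pow, Real.sq_sqrt hK] at this
        linarith
      · rw [hinv hK']
        refine (le_max_left _ _).trans (le_mul_of_one_le_left zero_le (by norm_num))

/-- The Poincaré constant of `xi K D` is bounded above by the model rate. -/
theorem exists_poincareConst_xi_le_modelRate : ∃ C : ℝ≥0, ∀ (K : ℝ) (D : ℝ≥0∞),
    0 < D → (D = ⊤ → 0 < K) → poincareConst (xi K D) ≤ C * modelRate K D := by
  obtain ⟨C₁, hC₁, h₁⟩ := exists_poincareConst_xi_le_of_nonneg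
  obtain ⟨C₂, hC₂, h₂⟩ := exists_poincareConst_xi_le_of_neg
  refine ⟨(C₁ * 4).toNNReal + C₂.toNNReal, fun K D hD hKD => ?_⟩
  have hcoe : (((C₁ * 4).toNNReal + C₂.toNNReal : ℝ≥0) : ℝ≥0∞) =
      ENNReal.ofReal (C₁ * 4) + ENNReal.ofReal C₂ := by
    simp [ENNReal.ofReal]
  rw [hcoe]
  unfold modelRate
  split_ifs with hK
  · obtain ⟨ℓ, hℓ, hℓD, hKℓ, hℓr⟩ := exists_scale hK hD hKD
    refine (h₁ K ℓ D hK hD hKD hℓ hℓD hKℓ).trans ?_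
    rw [ENNReal.ofReal_mul hC₁.le]
    calc ENNReal.ofReal C₁ * ENNReal.ofReal (1 / ℓ ^ 2)
        ≤ ENNReal.ofReal C₁ * (4 * max (ENNReal.ofReal K) (1 / D ^ 2)) := by gcongr
      _ = ENNReal.ofReal (C₁ * 4) * max (ENNReal.ofReal K) (1 / D ^ 2) := by
          rw [ENNReal.ofReal_mul hC₁.le, ← mul_assoc]; norm_num
      _ ≤ _ := by gcongr; exact le_self_add
  · push Not at hK
    rcases eq_top_or_exists_ofReal hD with rfl | ⟨d, hd, rfl⟩
    · exact absurd (hKD rfl) (not_lt.2 hK.le)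
    rw [ENNReal.toReal_ofReal hd.le]
    obtain ⟨k, hk, rfl⟩ : ∃ k, 0 < k ∧ K = -k := ⟨-K, by linarith, by ring⟩
    rw [neg_neg]
    have hm : 0 < max (Real.sqrt k) (1 / d) := lt_max_of_lt_right (by positivity)
    have hX := exp_mul_sq_div_eight_sub_one_pos hk hd
    have hZ : 4 * ((Real.exp (k * d ^ 2 / 8) - 1) / (k * d)) ≤
        xiMass (-k) (ENNReal.ofReal d) := by
      rw [xiMass_neg_eq hd]; exact le_integral_exp_sq hk hd
    set m := max (Real.sqrt k) (1 / d) with hmdef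
    -- the step has the width `1 / (4 * m)`, the smaller of `1 / (4 √k)` and `d / 4`
    have hδ : 0 < 1 / (4 * m) := by positivity
    refine (h₂ k d (1 / (4 * m)) hk hd hδ ?_ ?_).trans ?_
    · have h1 : k ≤ m ^ 2 := by
        rw [← Real.sq_sqrt hk.le]; gcongr; exact le_max_left _ _
      rw [div_pow, one_pow, mul_one_div, div_le_one (by positivity)]
      nlinarith
    · have h1 : 1 / d ≤ m := le_max_right _ _
      have h2 : 1 / m ≤ d := by
        rw [div_le_iff₀ hm]; rw [div_le_iff₀ hd] at h1; linarith
      have h3 : 1 / (4 * m) = 1 / m / 4 := by field_simp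
      rw [h3]; linarith
    · refine le_trans ?_ (mul_le_mul_left (le_add_self) _)
      rw [← ENNReal.ofReal_mul hC₂.le]
      apply ENNReal.ofReal_le_ofReal
      unfold negRate
      rw [← hmdef]
      calc C₂ * (1 / (1 / (4 * m))) / xiMass (-k) (ENNReal.ofReal d)
          ≤ C₂ * (1 / (1 / (4 * m))) / (4 * ((Real.exp (k * d ^ 2 / 8) - 1) / (k * d))) := by
            gcongr
        _ = C₂ * (m * (k * d / (Real.exp (k * d ^ 2 / 8) - 1))) := by field_simp

/-- For nonnegative curvature, the density of `xi K D` at the origin is comparable to the square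
root of the model rate. -/
theorem one_div_xiMass_sq_bounds {K : ℝ} {D : ℝ≥0∞} (hK : 0 ≤ K) (hD : 0 < D)
    (hKD : D = ⊤ → 0 < K) :
    max (ENNReal.ofReal K) (1 / D ^ 2) ≤ 8 * ENNReal.ofReal (1 / xiMass K D) ^ 2 ∧
      ENNReal.ofReal (1 / xiMass K D) ^ 2 ≤ 4 * max (ENNReal.ofReal K) (1 / D ^ 2) := by
  have hZ := xiMass_pos hD hKD
  have hle1 : ∀ x : ℝ, Real.exp (-K * x ^ 2 / 2) ≤ 1 := fun x =>
    Real.exp_le_one_iff.2 (by nlinarith [sq_nonneg x])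
  rw [← ENNReal.ofReal_pow (by positivity), div_pow, one_pow]
  constructor
  · rw [show (8 : ℝ≥0∞) = ENNReal.ofReal 8 by norm_num, ← ENNReal.ofReal_mul (by norm_num)]
    refine max_le (ENNReal.ofReal_le_ofReal ?_) ?_
    · rcases hK.eq_or_lt with rfl | hK
      · positivity
      have h1 : xiMass K D ≤ Real.sqrt (2 * Real.pi / K) := by
        have hint : Integrable fun x : ℝ => Real.exp (-(K / 2) * x ^ 2) :=
          integrable_exp_neg_mul_sq (half_pos hK)
        calc xiMass K D = ∫ x in symInterval D, Real.exp (-(K / 2) * x ^ 2) := by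
              unfold xiMass; congr 1; funext x; congr 1; ring
          _ ≤ ∫ x, Real.exp (-(K / 2) * x ^ 2) := setIntegral_le_integral hint
              (Filter.Eventually.of_forall fun x => (Real.exp_pos _).le)
          _ = Real.sqrt (2 * Real.pi / K) := by rw [integral_gaussian]; congr 1; field_simp
      have h2 : xiMass K D ^ 2 ≤ 2 * Real.pi / K := by
        rw [← Real.sq_sqrt (by positivity : 0 ≤ 2 * Real.pi / K)]; gcongr
      rw [mul_one_div, le_div_iff₀ (by positivity)]
      rw [le_div_iff₀ hK] at h2
      have := Real.pi_lt_four
      linarith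
    · rcases eq_top_or_exists_ofReal hD with rfl | ⟨d, hd, rfl⟩
      · simp
      rw [one_div_ofReal_sq hd]
      apply ENNReal.ofReal_le_ofReal
      have h1 : xiMass K (ENNReal.ofReal d) ≤ d := by
        rw [xiMass, symInterval_ofReal hd.le]
        refine (setIntegral_le_mul_of_le measurableSet_Icc (p := -(d / 2)) (q := d / 2) (c := 1)
          (fun x => (Real.exp_pos _).le) (by linarith) (fun x _ _ => hle1 x)
          (fun x hx hx' => absurd hx hx') zero_le_one).trans (le_of_eq (by ring))
      have h2 : 1 / d ^ 2 ≤ 1 / xiMass K (ENNReal.ofReal d) ^ 2 := by gcongr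
      have h3 : 0 ≤ 1 / xiMass K (ENNReal.ofReal d) ^ 2 := by positivity
      linarith
  · obtain ⟨ℓ, hℓ, hℓD, hKℓ, hℓr⟩ := exists_scale hK hD hKD
    refine le_trans (ENNReal.ofReal_le_ofReal ?_) hℓr
    have hS : Icc (-ℓ) ℓ ⊆ symInterval D := fun x hx => by
      refine symInterval_mono_abs (y := ℓ) ?_ ?_
      · rw [abs_of_pos hℓ]; exact abs_le.2 hx
      · rw [symInterval, mem_ofPred_eq, abs_of_pos hℓ]; exact hℓD
    have h1 : ℓ ≤ xiMass K D := by
      calc ℓ = ∫ x in Icc (-ℓ) ℓ, (1 / 2 : ℝ) := by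
            rw [setIntegral_const, smul_eq_mul, Measure.real, Real.volume_Icc,
              ENNReal.toReal_ofReal (by linarith)]; ring
        _ ≤ ∫ x in Icc (-ℓ) ℓ, Real.exp (-K * x ^ 2 / 2) := by
            refine setIntegral_mono_on (by simp)
              ((integrableOn_exp_symInterval hD hKD).mono_set hS) measurableSet_Icc fun x hx => ?_
            have h2 : x ^ 2 ≤ ℓ ^ 2 := sq_le_sq' hx.1 hx.2
            have := Real.add_one_le_exp (-K * x ^ 2 / 2)
            nlinarith
        _ ≤ _ := setIntegral_mono_set (integrableOn_exp_symInterval hD hKD)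
            (Filter.Eventually.of_forall fun x => (Real.exp_pos _).le) hS.eventuallyLE
    gcongr

/-! ### Universal comparison of the constants -/

theorem EquivUpTo.symm {C : ℝ≥0} {a b : ℝ≥0∞} (h : EquivUpTo C a b) : EquivUpTo C b a :=
  ⟨h.2, h.1⟩

theorem EquivUpTo.trans {C C' : ℝ≥0} {a b c : ℝ≥0∞} (h : EquivUpTo C a b)
    (h' : EquivUpTo C' b c) : EquivUpTo (C * C') a c := by
  rw [EquivUpTo, ENNReal.coe_mul]
  constructor
  · calc a ≤ C * b := h.1
      _ ≤ C * (C' * c) := by gcongr; exact h'.1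
      _ = _ := by ring
  · calc c ≤ C' * b := h'.2
      _ ≤ C' * (C * a) := by gcongr; exact h.2
      _ = _ := by ring

theorem EquivUpTo.mono {C C' : ℝ≥0} {a b : ℝ≥0∞} (h : EquivUpTo C a b) (hC : C ≤ C') :
    EquivUpTo C' a b := by
  have hC' : (C : ℝ≥0∞) ≤ C' := by exact_mod_cast hC
  exact ⟨h.1.trans (by gcongr), h.2.trans (by gcongr)⟩

theorem worstLogSobolev_le_mul_worstPoincare (K : ℝ) (D : ℝ≥0∞) :
    worstLogSobolev K D ≤ 5 * worstPoincare K D := by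
  rw [mul_comm, ← ENNReal.div_le_iff (by norm_num) (by norm_num)]
  refine le_iInf fun ξ => le_iInf fun h => le_iInf fun h0 => ?_
  rw [ENNReal.div_le_iff (by norm_num) (by norm_num), mul_comm]
  have := h.finite
  exact ((iInf_le _ ξ).trans ((iInf_le _ h).trans (iInf_le _ h0))).trans
    (logSobolevConst_le_mul_poincareConst ξ)

theorem worstPoincare_le {K : ℝ} {D : ℝ≥0∞} {ξ : Measure ℝ} (h : IsCDD K D ξ) (h0 : ξ ≠ 0) :
    worstPoincare K D ≤ poincareConst ξ :=
  (iInf_le _ ξ).trans ((iInf_le _ h).trans (iInf_le _ h0))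

theorem worstLogSobolev_le {K : ℝ} {D : ℝ≥0∞} {ξ : Measure ℝ} (h : IsCDD K D ξ) (h0 : ξ ≠ 0) :
    worstLogSobolev K D ≤ logSobolevConst ξ :=
  (iInf_le _ ξ).trans ((iInf_le _ h).trans (iInf_le _ h0))

/-- All four constants are comparable to the model rate: the log-Sobolev lower bound for the whole
class and the Poincaré upper bound for `xi K D` close the chain of the trivial inequalities. -/
theorem exists_equivUpTo_modelRate : ∃ C : ℝ≥0, ∀ (K : ℝ) (D : ℝ≥0∞), 0 < D →
    (D = ⊤ → 0 < K) →
      EquivUpTo C (poincareConst (xi K D)) (modelRate K D) ∧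
      EquivUpTo C (logSobolevConst (xi K D)) (modelRate K D) ∧
      EquivUpTo C (worstPoincare K D) (modelRate K D) ∧
      EquivUpTo C (worstLogSobolev K D) (modelRate K D) := by
  obtain ⟨C₁, h₁⟩ := exists_modelRate_le_logSobolevConst
  obtain ⟨C₂, h₂⟩ := exists_poincareConst_xi_le_modelRate
  refine ⟨5 * (C₁ + C₂), fun K D hD hKD => ?_⟩
  have hxi := isCDD_xi hD hKD
  have hxi0 := xi_ne_zero hD hKD
  have := hxi.finite
  set M := modelRate K D
  set p := poincareConst (xi K D)
  set l := logSobolevConst (xi K D)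
  set P := worstPoincare K D
  set W := worstLogSobolev K D
  have hMW : M ≤ C₁ * W := by
    rcases eq_or_ne C₁ 0 with h0 | h0
    · have := h₁ K D (xi K D) hD hKD hxi hxi0
      rw [h0] at this ⊢
      simpa using this
    · rw [mul_comm, ← ENNReal.div_le_iff (by exact_mod_cast h0) (by simp)]
      refine le_iInf fun ξ => le_iInf fun h => le_iInf fun hξ => ?_
      rw [ENNReal.div_le_iff (by exact_mod_cast h0) (by simp), mul_comm]
      exact h₁ K D ξ hD hKD h hξ
  have hWl : W ≤ l := worstLogSobolev_le hxi hxi0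
  have hPp : P ≤ p := worstPoincare_le hxi hxi0
  have hlp : l ≤ 5 * p := logSobolevConst_le_mul_poincareConst _
  have hWP : W ≤ 5 * P := worstLogSobolev_le_mul_worstPoincare K D
  have hpM : p ≤ C₂ * M := h₂ K D hD hKD
  have hcoe : ((5 * (C₁ + C₂) : ℝ≥0) : ℝ≥0∞) = 5 * (C₁ + C₂) := by push_cast; rfl
  have hup : ∀ a, a ≤ 5 * p → a ≤ ((5 * (C₁ + C₂) : ℝ≥0) : ℝ≥0∞) * M := fun a ha => by
    rw [hcoe]
    calc a ≤ 5 * (C₂ * M) := ha.trans (by gcongr)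
      _ ≤ 5 * ((C₁ + C₂) * M) := by gcongr; exact le_add_self
      _ = _ := by ring
  have hlow : ∀ a, W ≤ 5 * a → M ≤ ((5 * (C₁ + C₂) : ℝ≥0) : ℝ≥0∞) * a := fun a ha => by
    rw [hcoe]
    calc M ≤ C₁ * (5 * a) := hMW.trans (by gcongr)
      _ ≤ (C₁ + C₂) * (5 * a) := by gcongr; exact le_self_add
      _ = _ := by ring
  have h5 : ∀ a : ℝ≥0∞, a ≤ 5 * a := fun a => le_mul_of_one_le_left zero_le (by norm_num)
  exact ⟨⟨hup p (h5 p), hlow p (hWl.trans hlp)⟩, ⟨hup l hlp, hlow l (hWl.trans (h5 l))⟩,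
    ⟨hup P (hPp.trans (h5 p)), hlow P hWP⟩, ⟨hup W (hWl.trans hlp), hlow W (h5 W)⟩⟩

/-- Without a positive curvature bound and a diameter bound there is no spectral gap: the uniform
measures on long intervals belong to the class. -/
theorem worstPoincare_top_eq_zero {K : ℝ} (hK : K ≤ 0) : worstPoincare K ⊤ = 0 := by
  obtain ⟨C, h⟩ := exists_poincareConst_xi_le_modelRate
  have hle : ∀ n : ℕ, worstPoincare K ⊤ ≤ ENNReal.ofReal (C * (1 / ((n : ℝ) + 1) ^ 2)) := by
    intro n
    have hn : (0 : ℝ) < n + 1 := by positivity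
    have hD : 0 < ENNReal.ofReal (n + 1) := ENNReal.ofReal_pos.2 hn
    have hKD : ENNReal.ofReal ((n : ℝ) + 1) = ⊤ → (0 : ℝ) < 0 :=
      fun h => absurd h ENNReal.ofReal_ne_top
    refine (worstPoincare_le ((isCDD_xi hD hKD).mono hK le_top) (xi_ne_zero hD hKD)).trans ?_
    refine (h 0 _ hD hKD).trans (le_of_eq ?_)
    rw [modelRate, if_pos le_rfl, one_div_ofReal_sq hn, ENNReal.ofReal_zero,
      max_eq_right zero_le, ENNReal.ofReal_mul C.coe_nonneg, ENNReal.ofReal_coe_nnreal]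
  have hlim : Filter.Tendsto (fun n : ℕ => ENNReal.ofReal (C * (1 / ((n : ℝ) + 1) ^ 2)))
      Filter.atTop (nhds 0) := by
    rw [← ENNReal.ofReal_zero]
    refine ENNReal.tendsto_ofReal ?_
    have h1 := (tendsto_one_div_add_atTop_nhds_zero_nat (𝕜 := ℝ)).pow 2
    have h2 := h1.const_mul (C : ℝ)
    simpa [div_pow] using h2
  exact le_antisymm (ge_of_tendsto' hlim hle) zero_le

theorem equivUpTo_cheegerConst_sq {K : ℝ} {D : ℝ≥0∞} (hK : 0 ≤ K) (hD : 0 < D)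
    (hKD : D = ⊤ → 0 < K) : EquivUpTo 16 (cheegerConst (xiDensity K D) ^ 2) (modelRate K D) := by
  obtain ⟨h1, h2⟩ := cheegerConst_xi_bounds hD hKD
  obtain ⟨h3, h4⟩ := one_div_xiMass_sq_bounds hK hD hKD
  rw [modelRate, if_pos hK]
  set J := ENNReal.ofReal (1 / xiMass K D)
  set h := cheegerConst (xiDensity K D)
  set M := max (ENNReal.ofReal K) (1 / D ^ 2)
  have hcoe : ((16 : ℝ≥0) : ℝ≥0∞) = 16 := rfl
  rw [EquivUpTo, hcoe]
  constructor
  · calc h ^ 2 ≤ (2 * J) ^ 2 := by gcongr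
      _ = 4 * J ^ 2 := by rw [mul_pow]; norm_num
      _ ≤ 4 * (4 * M) := by gcongr
      _ = 16 * M := by rw [← mul_assoc]; norm_num
  · calc M ≤ 8 * J ^ 2 := h3
      _ ≤ 16 * h ^ 2 := by gcongr; norm_num

theorem equivUpTo_cheegerConst {k D : ℝ} (hk : 0 < k) (hD : 0 < D) :
    EquivUpTo 8 (cheegerConst (xiDensity (-k) (ENNReal.ofReal D)))
      (ENNReal.ofReal (k * D / (Real.exp (k * D ^ 2 / 8) - 1))) := by
  have hD' : 0 < ENNReal.ofReal D := ENNReal.ofReal_pos.2 hD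
  have hKD : ENNReal.ofReal D = ⊤ → 0 < -k := fun h => absurd h ENNReal.ofReal_ne_top
  have hX := exp_mul_sq_div_eight_sub_one_pos hk hD
  obtain ⟨h1, h2⟩ := cheegerConst_xi_bounds hD' hKD
  have hZ := xiMass_pos hD' hKD
  have h3 := le_integral_exp_sq hk hD
  have h4 := integral_exp_sq_le hk hD
  rw [← xiMass_neg_eq hD] at h3 h4
  set Z := xiMass (-k) (ENNReal.ofReal D)
  set X := Real.exp (k * D ^ 2 / 8) - 1
  have hcoe : ((8 : ℝ≥0) : ℝ≥0∞) = ENNReal.ofReal 8 := by norm_num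
  have hcoe2 : (2 : ℝ≥0∞) = ENNReal.ofReal 2 := by norm_num
  rw [EquivUpTo, hcoe]
  constructor
  · refine h2.trans ?_
    rw [hcoe2, ← ENNReal.ofReal_mul (by norm_num), ← ENNReal.ofReal_mul (by norm_num)]
    apply ENNReal.ofReal_le_ofReal
    calc 2 * (1 / Z) ≤ 2 * (1 / (4 * (X / (k * D)))) := by gcongr
      _ = 1 / 2 * (k * D / X) := by field_simp; norm_num
      _ ≤ 8 * (k * D / X) := by gcongr; norm_num
  · refine le_trans ?_ (mul_le_mul_right h1 _)
    rw [← ENNReal.ofReal_mul (by norm_num)]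
    apply ENNReal.ofReal_le_ofReal
    calc k * D / X = 8 * (1 / (8 * (X / (k * D)))) := by field_simp
      _ ≤ 8 * (1 / Z) := by gcongr

end OneDimFunctionalInequalities

theorem mainTheorem6 :
    ∃ C : ℝ≥0,
      -- the case `K ≥ 0`, for `D ∈ (0, ∞]` (with `K > 0` if `D = ∞`)
      (∀ (K : ℝ) (D : ℝ≥0∞), 0 ≤ K → 0 < D → (D = ⊤ → 0 < K) →
        OneDimFunctionalInequalities.EquivUpTo C
          (OneDimFunctionalInequalities.logSobolevConst (OneDimFunctionalInequalities.xi K D))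
          (OneDimFunctionalInequalities.poincareConst (OneDimFunctionalInequalities.xi K D)) ∧
        OneDimFunctionalInequalities.EquivUpTo C
          (OneDimFunctionalInequalities.poincareConst (OneDimFunctionalInequalities.xi K D))
          (OneDimFunctionalInequalities.cheegerConst
            (OneDimFunctionalInequalities.xiDensity K D) ^ 2) ∧
        OneDimFunctionalInequalities.EquivUpTo C
          (OneDimFunctionalInequalities.logSobolevConst (OneDimFunctionalInequalities.xi K D))
          (max (ENNReal.ofReal K) (1 / D ^ 2)) ∧
        OneDimFunctionalInequalities.EquivUpTo C
          (OneDimFunctionalInequalities.poincareConst (OneDimFunctionalInequalities.xi K D))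
          (max (ENNReal.ofReal K) (1 / D ^ 2)) ∧
        OneDimFunctionalInequalities.EquivUpTo C
          (OneDimFunctionalInequalities.cheegerConst
            (OneDimFunctionalInequalities.xiDensity K D) ^ 2)
          (max (ENNReal.ofReal K) (1 / D ^ 2))) ∧
      -- the case `K = -k < 0`, for `D ∈ (0, ∞)`
      (∀ k D : ℝ, 0 < k → 0 < D →
        OneDimFunctionalInequalities.EquivUpTo C
          (OneDimFunctionalInequalities.poincareConst
            (OneDimFunctionalInequalities.xi (-k) (ENNReal.ofReal D)))
          (OneDimFunctionalInequalities.logSobolevConst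
            (OneDimFunctionalInequalities.xi (-k) (ENNReal.ofReal D))) ∧
        OneDimFunctionalInequalities.EquivUpTo C
          (OneDimFunctionalInequalities.poincareConst
            (OneDimFunctionalInequalities.xi (-k) (ENNReal.ofReal D)))
          (ENNReal.ofReal
            (max (Real.sqrt k) (1 / D) * (k * D / (Real.exp (k * D ^ 2 / 8) - 1)))) ∧
        OneDimFunctionalInequalities.EquivUpTo C
          (OneDimFunctionalInequalities.logSobolevConst
            (OneDimFunctionalInequalities.xi (-k) (ENNReal.ofReal D)))
          (ENNReal.ofReal
            (max (Real.sqrt k) (1 / D) * (k * D / (Real.exp (k * D ^ 2 / 8) - 1)))) ∧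
        OneDimFunctionalInequalities.EquivUpTo C
          (OneDimFunctionalInequalities.cheegerConst
            (OneDimFunctionalInequalities.xiDensity (-k) (ENNReal.ofReal D)))
          (ENNReal.ofReal (k * D / (Real.exp (k * D ^ 2 / 8) - 1)))) ∧
      -- the worst constants are, up to universal constants, those of `ξ_K`
      (∀ (K : ℝ) (D : ℝ≥0∞), 0 < D → (D = ⊤ → 0 < K) →
        OneDimFunctionalInequalities.EquivUpTo C
          (OneDimFunctionalInequalities.worstPoincare K D)
          (OneDimFunctionalInequalities.poincareConst (OneDimFunctionalInequalities.xi K D)) ∧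
        OneDimFunctionalInequalities.EquivUpTo C
          (OneDimFunctionalInequalities.worstLogSobolev K D)
          (OneDimFunctionalInequalities.logSobolevConst
            (OneDimFunctionalInequalities.xi K D))) ∧
      -- the worst Poincaré and log-Sobolev constants coincide up to universal constants
      (∀ (K : ℝ) (D : ℝ≥0∞), 0 < D →
        OneDimFunctionalInequalities.EquivUpTo C
          (OneDimFunctionalInequalities.worstPoincare K D)
          (OneDimFunctionalInequalities.worstLogSobolev K D)) := by
  obtain ⟨C, hC⟩ := OneDimFunctionalInequalities.exists_equivUpTo_modelRate
  have hCC : C * C ≤ (C + 16) * (C + 16) := by gcongr <;> exact le_self_add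
  have hC1 : C ≤ (C + 16) * (C + 16) := by
    calc C ≤ C + 16 := le_self_add
      _ ≤ (C + 16) * (C + 16) := le_mul_of_one_le_left zero_le
        (le_trans (by norm_num : (1 : ℝ≥0) ≤ 16) le_add_self)
  have hCB : C * 16 ≤ (C + 16) * (C + 16) := by
    gcongr
    · exact le_self_add
    · exact le_add_self
  have hB : ∀ B : ℝ≥0, B ≤ 16 → B ≤ (C + 16) * (C + 16) := fun B hB =>
    calc B ≤ C + 16 := hB.trans le_add_self
      _ ≤ (C + 16) * (C + 16) := le_mul_of_one_le_left zero_le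
        (le_trans (by norm_num : (1 : ℝ≥0) ≤ 16) le_add_self)
  refine ⟨(C + 16) * (C + 16), fun K D hK hD hKD => ?_, fun k D hk hD => ?_,
    fun K D hD hKD => ?_, fun K D hD => ?_⟩
  · obtain ⟨hp, hl, -, -⟩ := hC K D hD hKD
    have hh := OneDimFunctionalInequalities.equivUpTo_cheegerConst_sq hK hD hKD
    have hM : OneDimFunctionalInequalities.modelRate K D =
        max (ENNReal.ofReal K) (1 / D ^ 2) := if_pos hK
    refine ⟨(hl.trans hp.symm).mono hCC, (hp.trans hh.symm).mono hCB, ?_, ?_, ?_⟩ <;> rw [← hM]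
    exacts [hl.mono hC1, hp.mono hC1, hh.mono (hB _ le_rfl)]
  · have hD' : 0 < ENNReal.ofReal D := ENNReal.ofReal_pos.2 hD
    obtain ⟨hp, hl, -, -⟩ := hC (-k) (ENNReal.ofReal D) hD'
      fun h => absurd h ENNReal.ofReal_ne_top
    have hM : OneDimFunctionalInequalities.modelRate (-k) (ENNReal.ofReal D) = ENNReal.ofReal
        (max (Real.sqrt k) (1 / D) * (k * D / (Real.exp (k * D ^ 2 / 8) - 1))) := by
      rw [OneDimFunctionalInequalities.modelRate, if_neg (by linarith), neg_neg,
        ENNReal.toReal_ofReal hD.le, OneDimFunctionalInequalities.negRate]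
    rw [← hM]
    exact ⟨(hp.trans hl.symm).mono hCC, hp.mono hC1, hl.mono hC1,
      (OneDimFunctionalInequalities.equivUpTo_cheegerConst hk hD).mono (hB _ (by norm_num))⟩
  · obtain ⟨hp, hl, hP, hW⟩ := hC K D hD hKD
    exact ⟨(hP.trans hp.symm).mono hCC, (hW.trans hl.symm).mono hCC⟩
  · by_cases hKD : D = ⊤ → 0 < K
    · obtain ⟨-, -, hP, hW⟩ := hC K D hD hKD
      exact (hP.trans hW.symm).mono hCC
    -- both constants vanish in the excluded case `D = ∞`, `K ≤ 0`
    · push Not at hKD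
      obtain ⟨rfl, hK⟩ := hKD
      have hP := OneDimFunctionalInequalities.worstPoincare_top_eq_zero hK
      have hW := OneDimFunctionalInequalities.worstLogSobolev_le_mul_worstPoincare K ⊤
      rw [hP, mul_zero] at hW
      rw [hP, nonpos_iff_eq_zero.1 hW]
      simp [OneDimFunctionalInequalities.EquivUpTo]
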